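/- **Setting.** Let $\Bbbk$ be the extension of $\mathbb C(q)$ by all fractional powers $q^{1/n}$, $n\ge 1$. Let $(a_{ij})$ be a Cartan matrix of finite type of size $r\times r$ and $d_1,\dots,d_r$ positive integers with $d_ia_{ij}=d_ja_{ji}$; put $[k]_i=\frac{q^{kd_i}-q^{-kd_i}}{q^{d_i}-q^{-d_i}}$ and $[k]_i!=[1]_i\cdots[k]_i$. Let $U=\check U_q\mathfrak g$ be the $\Bbbk$-algebra generated by $e_i,f_i$ and pairwise commuting invertible elements $t_i$ ($1\le i\le r$), with the relations $$t_ie_jt_i^{-1}=q^{d_i\delta_{ij}}e_j,\quad t_if_jt_i^{-1}=q^{-d_i\delta_{ij}}f_j,\quad e_if_j-f_je_i=\delta_{ij}\frac{k_i-k_i^{-1}}{q^{d_i}-q^{-d_i}},\quad k_i=\prod_j t_j^{a_{ji}},$$ $$\sum_{m=0}^{1-a_{ij}}\frac{(-1)^m}{[m]_i!\,[1-a_{ij}-m]_i!}\,e_i^m e_j e_i^{1-a_{ij}-m}=0,\qquad \sum_{m=0}^{1-a_{ij}}\frac{(-1)^m}{[m]_i!\,[1-a_{ij}-m]_i!}\,f_i^m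 f_j f_i^{1-a_{ij}-m}=0\qquad(i\ne j).$$ It is a Hopf algebra with $\Delta(t_i)=t_i\otimes t_i$, $\Delta(e_i)=e_i\otimes 1+k_i\otimes e_i$, $\Delta(f_i)=f_i\otimes k_i^{-1}+1\otimes f_i$, counit $\varepsilon(t_i)=1$, $\varepsilon(e_i)=\varepsilon(f_i)=0$, and antipode $\sigma(t_i)=t_i^{-1}$, $\sigma(e_i)=-k_i^{-1}e_i$, $\sigma(f_i)=-f_ik_i$. Let $U^0,U^+,U^-$ be the subalgebras generated by the $t_i^{\pm1}$, by the $e_i$ and by the $f_i$, let $T$ be the group generated by the $t_i$, and let $U^\pm_+=\ker\varepsilon|_{U^\pm}$. Let $\theta$ be the automorphism of $U$ with $\theta(e_i)=-f_i$, $\theta(f_i)=-e_i$, $\theta(t_i)=t_i^{-1}$, put $\omega=\sigma\theta$, and let $x\mapsto(x)_0$ be the projection of $U$ onto $U^0$ along $U^-_+U+UU^+_+$. Let $\mathfrak h^*$ be the $\mathbb Q$-vector space with basis the simple roots $\alpha_1,\dots,\alpha_r$, let $u_1,\dots,u_r$ be the dual basis and $Q_+=\sum_j\mathbb Z_{\ge0}\,\alpha_j$.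 For $\lambda\in\mathfrak h^*$ let $q^\lambda:U^0\to\Bbbk$ be the character $t_i\mapsto q^{d_i\langle\lambda,u_i\rangle}$. For a $U$-module $V$ put $V[\mu]=\{v\in V: tv=q^\mu(t)v \text{ for all } t\in T\}$; an element $x\in U$ has weight $\mu$ if $txt^{-1}=q^\mu(t)x$ for all $t\in T$. Fix $\lambda\in\mathfrak h^*$ and put $$\pi_\lambda(x,y)=q^\lambda\big((\sigma(x)y)_0\big)\ \ (x\in U^+,\ y\in U^-),\qquad \mathbb S_\lambda(x,y)=q^\lambda\big((\omega(x)y)_0\big)\ \ (x,y\in U^-),$$ $$K_\lambda=\{y\in U^-:\pi_\lambda(x,y)=0\ \forall x\in U^+\},\qquad \widetilde K_\lambda=\{x\in U^+:\pi_\lambda(x,y)=0\ \forall y\in U^-\}.$$ Let $M(\lambda)$ be the Verma module with highest weight $\lambda$ and highest weight vector $\mathbf 1_\lambda$, let $L(\lambda)=M(\lambda)/K_\lambda\mathbf 1_\lambda$ be its irreducible quotient, and let $\overline{\mathbf 1}_\lambda$ be the image of $\mathbf 1_\lambda$ in $L(\lambda)$. The form $\mathbb S_\lambda$ (the Shapovalov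 form) induces a form $\overline{\mathbb S}_\lambda$ on $L(\lambda)$ by $\overline{\mathbb S}_\lambda(x\overline{\mathbf 1}_\lambda,y\overline{\mathbf 1}_\lambda)=\mathbb S_\lambda(x,y)$ for $x,y\in U^-$. Let $F\subset U^*$ be the quantized algebra of regular functions on the connected simply connected group with Cartan matrix $(a_{ij})$, that is, the span of the matrix elements of the finite-dimensional $U$-modules that are direct sums of weight spaces $V[\mu]$, $\mu\in\mathfrak h^*$; its multiplication $\mu:F\otimes F\to F$ is $\mu(f\otimes g)(x)=(f\otimes g)(\Delta(x))$. Let $U$ act on $F$ by $(\overrightarrow a f)(x)=f(xa)$, and let $U\otimes U$ act accordingly on $F\otimes F$. Let $F[0]^{K_\lambda+\widetilde K_\lambda}$ be the space of all $f\in F[0]$ with $\overrightarrow a f=0$ for all $a\in K_\lambda+\widetilde K_\lambda$. On $\mathrm{Hom}_U(L(\lambda),L(\lambda)\otimes F)$ consider the product $\varphi*\psi=(\mathrm{id}\otimes\mu)\circ(\varphi\otimes\mathrm{id})\circ\psi$ and the map $\Theta:\varphi\mapsto f_\varphi$ defined by $$\varphi(\overline{\mathbf 1}_\lambda)=\overline{\mathbf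 1}_\lambda\otimes f_\varphi+\sum_{\mu<\lambda}v_\mu\otimes f_\mu,\qquad v_\mu\in L(\lambda)[\mu].$$ For every $\beta\in Q_+$ let $y^i_\beta\in U^-$ be elements of weight $-\beta$ such that the vectors $y^i_\beta\overline{\mathbf 1}_\lambda$ form a (finite) basis of $L(\lambda)[\lambda-\beta]$, let $\overline{\mathbb S}{}^\beta_\lambda=\big(\mathbb S_\lambda(y^i_\beta,y^j_\beta)\big)_{i,j}$ be the matrix of $\overline{\mathbb S}_\lambda$ in this basis, and let $$J^{\mathrm{red}}(\lambda)=\sum_{\beta\in Q_+}\sum_{i,j}\big(\overline{\mathbb S}{}^\beta_\lambda\big)^{-1}_{ij}\;y^i_\beta\otimes\theta(y^j_\beta)$$ (a formal sum over $\beta$, that is, an element of a completion of $U^-\otimes U^+$). **Theorem 14.** The map $\Theta$ is a bijection from $\mathrm{Hom}_U(L(\lambda),L(\lambda)\otimes F)$ onto $F[0]^{K_\lambda+\widetilde K_\lambda}$, so that $f_1\star_\lambda f_2=\Theta\big(\Theta^{-1}(f_1)*\Theta^{-1}(f_2)\big)$ defines a product on $F[0]^{K_\lambda+\widetilde K_\lambda}$.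 The matrices $\overline{\mathbb S}{}^\beta_\lambda$ are invertible. For all $f_1,f_2\in F[0]^{K_\lambda+\widetilde K_\lambda}$ only finitely many of the $\beta$-components of $J^{\mathrm{red}}(\lambda)$ act on $f_1\otimes f_2$ by a non-zero vector, and $$f_1\star_\lambda f_2=\mu\Big(\overrightarrow{J^{\mathrm{red}}(\lambda)}(f_1\otimes f_2)\Big).$$ -/

import Mathlib

open scoped TensorProduct
noncomputable section
namespace StarProduct

section QuantumInteger
variable {K : Type*} [Field K]

/-- The quantum integer `[k] = (v ^ k - v ^ (-k)) / (v - v ^ (-1))`. -/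
def qInt (v : K) (k : ℕ) : K := (v ^ k - v⁻¹ ^ k) / (v - v⁻¹)

/-- The quantum factorial `[k]! = [1] [2] ... [k]`. -/
def qFact (v : K) (k : ℕ) : K := ∏ j ∈ Finset.range k, qInt v (j + 1)

/-- The left-hand side of the quantum Serre relation,
`∑ (-1) ^ m / ([m]! [n - m]!) a ^ m b a ^ (n - m)`, where `0 ≤ m ≤ n`. -/
def serre {A : Type*} [Ring A] [Algebra K A] (v : K) (n : ℕ) (a b : A) : A :=
  ∑ m ∈ Finset.range (n + 1),
    ((-1) ^ m / (qFact v m * qFact v (n - m))) • (a ^ m * b * a ^ (n - m))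

theorem map_serre {A B : Type*} [Ring A] [Algebra K A] [Ring B] [Algebra K B] (φ : A →ₐ[K] B)
    (v : K) (n : ℕ) (a b : A) : φ (serre v n a b) = serre v n (φ a) (φ b) := by
  simp [serre, map_sum, map_smul]

variable {A : Type*} [Ring A] [Algebra K A]

/-- The iterated `q`-commutator of `a` with `b`. -/
def qad (v : K) (m : ℤ) (a b : A) : ℕ → A
  | 0 => b
  | s + 1 => a * qad v m a b s - v ^ (m + 2 * s) • (qad v m a b s * a)

theorem qInt_add {v : K} (hv : v ≠ 0) (k p : ℕ) :
    qInt v (k + p) * v ^ p = qInt v k + v ^ (k + p) * qInt v p := by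
  unfold qInt
  rw [div_mul_eq_mul_div, mul_div_assoc', ← add_div]
  congr 1
  have : v⁻¹ ^ p * v ^ p = 1 := by rw [← mul_pow, inv_mul_cancel₀ hv, one_pow]
  have h2 : v⁻¹ ^ k * v ^ k = 1 := by rw [← mul_pow, inv_mul_cancel₀ hv, one_pow]
  rw [pow_add, pow_add]
  linear_combination (v ^ k - v⁻¹ ^ k) * this

theorem qad_eq_sum {v : K} (hv : v ≠ 0) (hq : ∀ k, qInt v (k + 1) ≠ 0) (n : ℕ) (a b : A)
    (s : ℕ) : qad v (1 - n) a b s = ∑ x ∈ Finset.HasAntidiagonal.antidiagonal s,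
      ((-1) ^ x.2 * v ^ ((x.2 : ℤ) * (s - n)) * (qFact v s / (qFact v x.1 * qFact v x.2))) •
        (a ^ x.1 * b * a ^ x.2) := by
  have hf : ∀ k, qFact v k ≠ 0 := fun k => Finset.prod_ne_zero_iff.2 fun j _ => hq j
  have hs : ∀ k, qFact v (k + 1) = qFact v k * qInt v (k + 1) := fun k => by
    simp [qFact, Finset.prod_range_succ]
  have hz : qInt v 0 = 0 := by simp [qInt]
  induction s with
  | zero => simp [qad, qFact]
  | succ s ih =>
    have key : ∀ x ∈ Finset.HasAntidiagonal.antidiagonal (s + 1),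
        ((-1) ^ x.2 * v ^ ((x.2 : ℤ) * ((s + 1 : ℕ) - n)) *
          (qFact v (s + 1) / (qFact v x.1 * qFact v x.2))) • (a ^ x.1 * b * a ^ x.2) =
        ((-1) ^ x.2 * v ^ ((x.2 : ℤ) * (s - n)) *
          (qFact v s * qInt v x.1 / (qFact v x.1 * qFact v x.2))) • (a ^ x.1 * b * a ^ x.2) +
        ((-1) ^ x.2 * v ^ ((x.2 : ℤ) * (s - n)) * v ^ (s + 1) *
          (qFact v s * qInt v x.2 / (qFact v x.1 * qFact v x.2))) • (a ^ x.1 * b * a ^ x.2) := by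
      intro x hx
      rw [Finset.HasAntidiagonal.mem_antidiagonal] at hx
      rw [← add_smul]
      congr 1
      have e1 : v ^ ((x.2 : ℤ) * ((s + 1 : ℕ) - n)) = v ^ ((x.2 : ℤ) * (s - n)) * v ^ x.2 := by
        rw [← zpow_natCast, ← zpow_add₀ hv]; congr 1; push_cast; ring
      have e2 := qInt_add hv x.1 x.2
      rw [hx] at e2
      rw [e1, hs]
      have h1 := hf x.1
      have h2 := hf x.2
      field_simp
      linear_combination qFact v s * e2
    rw [Finset.sum_congr rfl key, Finset.sum_add_distrib,
      Finset.Nat.sum_antidiagonal_succ]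
    conv_rhs => enter [2]; rw [Finset.Nat.sum_antidiagonal_succ']
    simp only [hz, mul_zero, zero_div, zero_smul, zero_add]
    rw [qad, ih, Finset.mul_sum, Finset.sum_mul, Finset.smul_sum, sub_eq_add_neg,
      ← Finset.sum_neg_distrib]
    congr 1
    · refine Finset.sum_congr rfl fun x hx => ?_
      rw [mul_smul_comm]
      congr 1
      · rw [hs]
        have h1 := hf x.1
        have h2 := hf x.2
        have h3 := hq x.1
        field_simp
      · rw [pow_succ' a]; simp only [mul_assoc]
    · refine Finset.sum_congr rfl fun x hx => ?_
      rw [smul_mul_assoc, smul_smul, ← neg_smul]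
      congr 1
      · rw [hs]
        have h1 := hf x.1
        have h2 := hf x.2
        have h3 := hq x.2
        have e1 : v ^ (1 - (n : ℤ) + 2 * s) * v ^ ((x.2 : ℤ) * (s - n)) =
            v ^ (((x.2 + 1 : ℕ) : ℤ) * (s - n)) * v ^ (s + 1) := by
          rw [← zpow_natCast, ← zpow_add₀ hv, ← zpow_add₀ hv]; congr 1; push_cast; ring
        rw [pow_succ (-1 : K)]
        field_simp
        linear_combination (-qFact v s) * e1
      · rw [pow_succ a]; simp only [mul_assoc]

theorem qad_eq_serre {v : K} (hv : v ≠ 0) (hq : ∀ k, qInt v (k + 1) ≠ 0) (n : ℕ) (a b : A) :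
    qad v (1 - n) a b n = ((-1) ^ n * qFact v n) • serre v n a b := by
  rw [qad_eq_sum hv hq, serre, Finset.Nat.sum_antidiagonal_eq_sum_range_succ
    (fun k p => ((-1) ^ p * v ^ ((p : ℤ) * (n - n)) * (qFact v n / (qFact v k * qFact v p))) •
        (a ^ k * b * a ^ p)), Finset.smul_sum]
  refine Finset.sum_congr rfl fun m hm => ?_
  have hm' : m ≤ n := Nat.lt_succ_iff.1 (Finset.mem_range.1 hm)
  rw [smul_smul]
  congr 1
  have : (-1 : K) ^ (n - m) = (-1) ^ n * (-1) ^ m := by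
    obtain ⟨p, rfl⟩ := Nat.exists_eq_add_of_le hm'
    rw [Nat.add_sub_cancel_left, pow_add, mul_comm ((-1 : K) ^ m), mul_assoc, ← mul_pow]
    simp
  simp [this]
  ring

theorem qad_zero_iff {v : K} (hv : v ≠ 0) (hq : ∀ k, qInt v (k + 1) ≠ 0) (n : ℕ) (a b : A) :
    qad v (1 - n) a b n = 0 ↔ serre v n a b = 0 := by
  rw [qad_eq_serre hv hq, smul_eq_zero, or_iff_right]
  exact mul_ne_zero (pow_ne_zero _ (by simp)) (Finset.prod_ne_zero_iff.2 fun j _ => hq j)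

theorem serre_eq_zero_of_qad {v : K} (hv : v ≠ 0) (hq : ∀ k, qInt v (k + 1) ≠ 0) {n : ℕ}
    {a b : A} (h : qad v (1 - n) a b n = 0) : serre v n a b = 0 :=
  (qad_zero_iff hv hq n a b).1 h

theorem qInt_inv (v : K) (k : ℕ) : qInt v⁻¹ k = qInt v k := by
  simp only [qInt, inv_inv]
  rw [← neg_sub, ← neg_sub v, neg_div_neg_eq]

theorem serre_inv (v : K) (n : ℕ) (a b : A) : serre v⁻¹ n a b = serre v n a b := by
  simp only [serre, qFact, qInt_inv]

theorem qad_inv_zero_iff {v : K} (hv : v ≠ 0) (hq : ∀ k, qInt v (k + 1) ≠ 0) (n : ℕ) (a b : A) :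
    qad v⁻¹ (1 - n) a b n = 0 ↔ serre v n a b = 0 := by
  rw [qad_zero_iff (inv_ne_zero hv) (by simpa [qInt_inv] using hq), serre_inv]

theorem serre_add_right (v : K) (n : ℕ) (a b c : A) :
    serre v n a (b + c) = serre v n a b + serre v n a c := by
  simp [serre, mul_add, add_mul, Finset.sum_add_distrib]

theorem serre_smul (v : K) (n : ℕ) (x y : K) (a b : A) :
    serre v n (x • a) (y • b) = (x ^ n * y) • serre v n a b := by
  rw [serre, serre, Finset.smul_sum]
  refine Finset.sum_congr rfl fun m hm => ?_
  have hm' : m ≤ n := Nat.lt_succ_iff.1 (Finset.mem_range.1 hm)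
  simp only [smul_pow, smul_mul_assoc, mul_smul_comm, smul_smul]
  congr 1
  rw [show x ^ n = x ^ m * x ^ (n - m) by rw [← pow_add, Nat.add_sub_cancel' hm']]
  ring

theorem serre_op (v : K) (n : ℕ) (a b : Aᵐᵒᵖ) :
    serre v n a b = (-1 : K) ^ n • MulOpposite.op (serre v n a.unop b.unop) := by
  rw [serre, serre, ← Finset.sum_range_reflect, Finset.op_sum, Finset.smul_sum]
  refine Finset.sum_congr rfl fun m hm => ?_
  have hm' : m ≤ n := Nat.lt_succ_iff.1 (Finset.mem_range.1 hm)
  rw [show n + 1 - 1 - m = n - m by omega, Nat.sub_sub_self hm', MulOpposite.op_smul, smul_smul]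
  congr 1
  · have : (-1 : K) ^ (n - m) = (-1) ^ n * (-1) ^ m := by
      obtain ⟨p, rfl⟩ := Nat.exists_eq_add_of_le hm'
      rw [Nat.add_sub_cancel_left, pow_add, mul_comm ((-1 : K) ^ m), mul_assoc, ← mul_pow]
      simp
    rw [this, mul_div_assoc', mul_comm (qFact v m)]
  · simp [mul_assoc]

theorem qad_smul_comm {v : K} {m : ℤ} {a b z : A} {x y : K}
    (ha : z * a = x • (a * z)) (hb : z * b = y • (b * z)) (s : ℕ) :
    z * qad v m a b s = (x ^ s * y) • (qad v m a b s * z) := by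
  induction s with
  | zero => simpa [qad] using hb
  | succ s ih =>
    simp only [qad, mul_sub, sub_mul, smul_sub, mul_smul_comm, smul_mul_assoc]
    rw [← mul_assoc, ha, ← mul_assoc z, ih, smul_mul_assoc, mul_assoc a, ih, smul_mul_assoc,
      mul_assoc _ z, ha]
    simp only [mul_smul_comm, smul_smul, mul_assoc]
    congr 2 <;> ring

/-- A summand that `q`-commutes suitably with `a` and `b` does not contribute. -/
theorem qad_add_left {v : K} (hv : v ≠ 0) {m : ℤ} {a b z : A}
    (ha : z * a = v ^ (2 : ℤ) • (a * z)) (hb : z * b = v ^ m • (b * z)) (s : ℕ) :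
    qad v m (a + z) b s = qad v m a b s := by
  induction s with
  | zero => rfl
  | succ s ih =>
    rw [qad, ih, qad, add_mul, mul_add, qad_smul_comm ha hb, smul_add,
      show (v ^ (2 : ℤ)) ^ s * v ^ m = v ^ (m + 2 * s) by
        rw [← zpow_natCast, ← zpow_mul, ← zpow_add₀ hv, add_comm]]
    abel

theorem qad_mul_comm {v : K} {m : ℤ} {a b z : A} {x y : K}
    (ha : a * z = x • (z * a)) (hb : b * z = y • (z * b)) (s : ℕ) :
    qad v m a b s * z = (x ^ s * y) • (z * qad v m a b s) := by
  induction s with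
  | zero => simpa [qad] using hb
  | succ s ih =>
    simp only [qad, mul_sub, sub_mul, smul_sub, mul_smul_comm, smul_mul_assoc]
    rw [mul_assoc a, ih, mul_assoc _ a z, ha, mul_smul_comm, mul_smul_comm, ← mul_assoc _ z a, ih,
      ← mul_assoc a, ha]
    simp only [smul_mul_assoc, smul_smul, mul_assoc]
    congr 2 <;> ring

theorem qad_add_left' {v : K} (hv : v ≠ 0) {m : ℤ} {a z y : A}
    (ha : z * a = v ^ (2 : ℤ) • (a * z)) (hy : y * a = v ^ m • (a * y)) (s : ℕ) :
    qad v⁻¹ m (a + z) y s = qad v⁻¹ m z y s := by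
  induction s with
  | zero => rfl
  | succ s ih =>
    rw [qad, ih, qad, add_mul, mul_add, qad_mul_comm ha hy, smul_add, smul_smul,
      show (v ^ (2 : ℤ)) ^ s * v ^ m = v ^ (m + 2 * s) by
        rw [← zpow_natCast, ← zpow_mul, ← zpow_add₀ hv, add_comm],
      inv_zpow, inv_mul_cancel₀ (zpow_ne_zero _ hv), one_smul]
    abel

theorem qad_twist {v : K} {m : ℤ} {a b k l : A} {x y : K}
    (ha : a * k = x • (k * a)) (hb : b * k = y • (k * b)) (hl : a * l = y • (l * a))
    (hkl : k * l = l * k) (s : ℕ) :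
    ∃ c : K, qad v m (k * a) (l * b) s = c • (k ^ s * l * qad v m a b s) := by
  induction s with
  | zero => exact ⟨1, by simp [qad]⟩
  | succ s ih =>
    obtain ⟨c, hc⟩ := ih
    have hp : ∀ s : ℕ, a * k ^ s = x ^ s • (k ^ s * a) := by
      intro s
      induction s with
      | zero => simp
      | succ s ih =>
        rw [pow_succ, ← mul_assoc, ih, smul_mul_assoc, mul_assoc, ha, mul_smul_comm, smul_smul,
          mul_assoc, ← pow_succ]
    have hl' : l * k = k * l := hkl.symm
    refine ⟨c * (x ^ s * y), ?_⟩
    rw [qad, hc, qad]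
    have e1 : k * a * (k ^ s * l * qad v m a b s) =
        (x ^ s * y) • (k ^ (s + 1) * l * (a * qad v m a b s)) := by
      calc k * a * (k ^ s * l * qad v m a b s) = k * (a * k ^ s) * l * qad v m a b s := by
            simp only [mul_assoc]
        _ = x ^ s • (k * k ^ s * (a * l) * qad v m a b s) := by
            rw [hp]; simp only [mul_smul_comm, smul_mul_assoc, mul_assoc]
        _ = _ := by
            rw [hl]; simp only [mul_smul_comm, smul_mul_assoc, mul_assoc, pow_succ', smul_smul]
    have e2 : k ^ s * l * qad v m a b s * (k * a) =
        (x ^ s * y) • (k ^ (s + 1) * l * (qad v m a b s * a)) := by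
      calc k ^ s * l * qad v m a b s * (k * a) = k ^ s * l * (qad v m a b s * k) * a := by
            simp only [mul_assoc]
        _ = (x ^ s * y) • (k ^ s * (l * k) * qad v m a b s * a) := by
            rw [qad_mul_comm ha hb]; simp only [mul_smul_comm, smul_mul_assoc, mul_assoc]
        _ = _ := by
            rw [hl']; simp only [mul_assoc, pow_succ]
    rw [mul_smul_comm, e1, smul_mul_assoc, e2, mul_sub, smul_sub, mul_smul_comm]
    simp only [smul_smul]
    congr 2; ring

theorem serre_twist {v : K} (hv : v ≠ 0) (hq : ∀ k, qInt v (k + 1) ≠ 0) {n : ℕ}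
    {a b k l : A} {x y : K}
    (ha : a * k = x • (k * a)) (hb : b * k = y • (k * b)) (hl : a * l = y • (l * a))
    (hkl : k * l = l * k) (h : serre v n a b = 0) : serre v n (k * a) (l * b) = 0 := by
  obtain ⟨c, hc⟩ := qad_twist (v := v) (m := 1 - n) ha hb hl hkl n
  rw [← qad_zero_iff hv hq, hc, (qad_zero_iff hv hq n a b).2 h, mul_zero, smul_zero]

/-- The quantum Serre relation is compatible with sums of the form occurring in the coproduct. -/
theorem serre_coprod {v : K} (hv : v ≠ 0) (hq : ∀ k, qInt v (k + 1) ≠ 0) {n : ℕ} {m : ℤ}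
    (hm : m = 1 - n) {a b z y : A}
    (hza : z * a = v ^ (2 : ℤ) • (a * z)) (hzb : z * b = v ^ m • (b * z))
    (hya : y * a = v ^ m • (a * y)) (h1 : serre v n a b = 0) (h2 : serre v n z y = 0) :
    serre v n (a + z) (b + y) = 0 := by
  subst hm
  rw [serre_add_right, ← qad_zero_iff hv hq n a b] at *
  rw [(qad_zero_iff hv hq n (a + z) b).1 (by rw [qad_add_left hv hza hzb, h1]),
    (qad_inv_zero_iff hv hq n (a + z) y).1
      (by rw [qad_add_left' hv hza hya, qad_inv_zero_iff hv hq, h2]), add_zero]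

theorem commutator_serre_self {v : K} (hv : v ≠ 0) (hq : ∀ k, qInt v (k + 1) ≠ 0) {n : ℕ} {m : ℤ}
    (hm : m = 1 - n) {a b e k k' : A} {δ : K}
    (hka : a * k = v ^ (2 : ℤ) • (k * a)) (hkb : b * k = v ^ m • (k * b))
    (hka' : k' * a = v ^ (2 : ℤ) • (a * k')) (hkb' : k' * b = v ^ m • (b * k'))
    (hea : e * a = a * e + δ • (k - k')) (heb : e * b = b * e) :
    e * serre v n a b = serre v n a b * e := by
  have key : ∀ s, e * qad v m a b (s + 1) = qad v m a b (s + 1) * e +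
      (δ * ∑ i ∈ Finset.range (s + 1), (v ^ (-(m + 2 * (i : ℤ))) - v ^ (m + 2 * (i : ℤ)))) •
        (qad v m a b s * k) := by
    have hk : ∀ s : ℕ, qad v m a b s * k = v ^ (m + 2 * (s : ℤ)) • (k * qad v m a b s) := by
      intro s
      rw [qad_mul_comm hka hkb, ← zpow_natCast, ← zpow_mul, ← zpow_add₀ hv, add_comm]
    have hk' : ∀ s : ℕ, k' * qad v m a b s = v ^ (m + 2 * (s : ℤ)) • (qad v m a b s * k') := by
      intro s
      rw [qad_smul_comm hka' hkb', ← zpow_natCast, ← zpow_mul, ← zpow_add₀ hv, add_comm]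
    have hk2 : ∀ s : ℕ, k * qad v m a b s = v ^ (-(m + 2 * (s : ℤ))) • (qad v m a b s * k) := by
      intro s
      rw [hk, smul_smul, zpow_neg, inv_mul_cancel₀ (zpow_ne_zero _ hv), one_smul]
    have hH : ∀ s : ℕ, (k - k') * qad v m a b s - v ^ (m + 2 * (s : ℤ)) • (qad v m a b s * (k - k'))
        = (v ^ (-(m + 2 * (s : ℤ))) - v ^ (m + 2 * (s : ℤ))) • (qad v m a b s * k) := by
      intro s
      rw [sub_mul, mul_sub, hk2, hk', smul_sub, sub_smul]
      abel
    intro s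
    induction s with
    | zero =>
      have h0 := hH 0
      simp only [qad] at h0 ⊢
      rw [mul_sub, sub_mul, ← mul_assoc, hea, mul_smul_comm, ← mul_assoc, heb, mul_assoc b, hea,
        mul_add, add_mul, mul_smul_comm, smul_mul_assoc, smul_add, mul_assoc a, heb, smul_mul_assoc,
        smul_comm _ δ, Finset.sum_range_one, mul_smul, ← h0, smul_sub]
      simp only [mul_assoc]
      abel
    | succ s ih =>
      have h0 := hH (s + 1)
      rw [qad, mul_sub, ← mul_assoc, hea, mul_smul_comm, ← mul_assoc, ih, add_mul, mul_assoc a, ih,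
        add_mul, mul_assoc _ e a, hea, Finset.sum_range_succ _ (s + 1), mul_add, mul_add δ, add_smul,
        mul_smul δ (_ - _), ← h0]
      have e3 : qad v m a b (s + 1) * k = a * (qad v m a b s * k) -
          v ^ (m + 2 * ((s + 1 : ℕ) : ℤ)) • (qad v m a b s * k * a) := by
        rw [mul_assoc _ k a, show k * a = v ^ (-2 : ℤ) • (a * k) by
          rw [hka, smul_smul, ← zpow_add₀ hv]; simp]
        rw [qad, mul_smul_comm, smul_smul, ← zpow_add₀ hv, sub_mul, smul_mul_assoc]
        simp only [mul_assoc]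
        congr 3
        push_cast; ring
      rw [e3]
      simp only [smul_sub, smul_add, mul_add, sub_mul, smul_mul_assoc, mul_smul_comm, mul_assoc, mul_sub]
      rw [smul_comm _ (v ^ (m + 2 * ((s + 1 : ℕ) : ℤ)))]
      rw [smul_comm _ (v ^ (m + 2 * ((s + 1 : ℕ) : ℤ)))]
      rw [smul_comm _ (v ^ (m + 2 * ((s + 1 : ℕ) : ℤ)))]
      abel
  rcases Nat.eq_zero_or_pos n with rfl | hn
  · simpa [serre] using by rw [heb]
  obtain ⟨s, rfl⟩ : ∃ s, n = s + 1 := ⟨n - 1, by omega⟩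
  have hsum : ∑ i ∈ Finset.range (s + 1), (v ^ (-(m + 2 * (i : ℤ))) - v ^ (m + 2 * (i : ℤ))) = 0 := by
    rw [Finset.sum_sub_distrib, sub_eq_zero, ← Finset.sum_range_reflect]
    refine Finset.sum_congr rfl fun i hi => ?_
    have : i < s + 1 := Finset.mem_range.1 hi
    congr 1
    rw [hm]
    have : ((s + 1 - 1 - i : ℕ) : ℤ) = s - i := by omega
    rw [this]; push_cast; ring
  have := key s
  rw [hsum, mul_zero, zero_smul, add_zero, hm, qad_eq_serre hv hq] at this
  rw [mul_smul_comm, smul_mul_assoc] at this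
  exact smul_right_injective A (mul_ne_zero (pow_ne_zero _ (by simp))
    (Finset.prod_ne_zero_iff.2 fun j _ => hq j)) this

theorem commutator_serre_other {v : K} (hv : v ≠ 0) (hq : ∀ k, qInt v (k + 1) ≠ 0) {n : ℕ} {m : ℤ}
    (hm : m = 1 - n) (hn : 0 < n) {a b e l l' : A} {δ : K}
    (hla : a * l = v ^ m • (l * a)) (hla' : l' * a = v ^ m • (a * l'))
    (hea : e * a = a * e) (heb : e * b = b * e + δ • (l - l')) :
    e * serre v n a b = serre v n a b * e := by
  have hla2 : l * a = v ^ (-m) • (a * l) := by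
    rw [hla, smul_smul, ← zpow_add₀ hv]; simp
  have key : ∀ s : ℕ, e * qad v m a b s = qad v m a b s * e +
      (δ * ∏ i ∈ Finset.range s, (1 - v ^ (2 * (i : ℤ)))) • (a ^ s * l) -
      (δ * ∏ i ∈ Finset.range s, (1 - v ^ (2 * m + 2 * (i : ℤ)))) • (a ^ s * l') := by
    intro s
    induction s with
    | zero => simp [qad, heb, smul_sub]; abel
    | succ s ih =>
      rw [qad, mul_sub, ← mul_assoc, hea, mul_smul_comm, ← mul_assoc, mul_assoc a, ih]
      simp only [add_mul, sub_mul, mul_add, mul_sub, smul_add, smul_sub, smul_mul_assoc,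
        mul_smul_comm, mul_assoc, hea, hla2, hla', smul_smul, Finset.prod_range_succ]
      rw [← mul_assoc a (a ^ s), ← mul_assoc a (a ^ s), ← mul_assoc (a ^ s) a, ← mul_assoc (a ^ s) a,
        ← pow_succ', ← pow_succ]
      simp only [mul_one, sub_smul]
      have h1 : ∀ c : K, v ^ (m + 2 * (s : ℤ)) * (δ * (c * v ^ (-m))) =
          δ * (c * v ^ (2 * (s : ℤ))) := by
        intro c
        rw [show 2 * (s : ℤ) = (m + 2 * s) + -m by ring, zpow_add₀ hv (m + 2 * s) (-m)]; ring_nf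
      have h2 : ∀ c : K, v ^ (m + 2 * (s : ℤ)) * (δ * (c * v ^ m)) =
          δ * (c * v ^ (2 * m + 2 * (s : ℤ))) := by
        intro c
        rw [show 2 * m + 2 * (s : ℤ) = (m + 2 * s) + m by ring, zpow_add₀ hv (m + 2 * s) m]; ring
      simp only [h1, h2]
      abel
  have := key n
  rw [Finset.prod_eq_zero (Finset.mem_range.2 hn) (by simp),
    Finset.prod_eq_zero (i := n - 1) (Finset.mem_range.2 (by omega))
      (by rw [hm, show (2 * (1 - (n : ℤ)) + 2 * ((n - 1 : ℕ) : ℤ)) = 0 by omega]; simp)] at this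
  rw [mul_zero, zero_smul, zero_smul, add_zero, sub_zero, hm, qad_eq_serre hv hq,
    mul_smul_comm, smul_mul_assoc] at this
  exact smul_right_injective A (mul_ne_zero (pow_ne_zero _ (by simp))
    (Finset.prod_ne_zero_iff.2 fun j _ => hq j)) this

end QuantumInteger

/-- The field `ℂ(q)` with all fractional powers `q ^ (1 / n)` adjoined, realised as the field of
fractions of the group algebra of `ℚ` over `ℂ`; the basis element of exponent `x` is `q ^ x`. -/
def GroundField : Type := FractionRing (AddMonoidAlgebra ℂ ℚ)

instance : Field GroundField := inferInstanceAs (Field (FractionRing (AddMonoidAlgebra ℂ ℚ)))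

local notation "𝕜" => GroundField

/-- The fractional power `q ^ x`. -/
def qpow (x : ℚ) : 𝕜 :=
  algebraMap (AddMonoidAlgebra ℂ ℚ) (FractionRing (AddMonoidAlgebra ℂ ℚ))
    (AddMonoidAlgebra.single x 1)

theorem qpow_add (x y : ℚ) : qpow (x + y) = qpow x * qpow y := by
  unfold qpow
  rw [show (AddMonoidAlgebra.single (x + y) (1 : ℂ)) =
    AddMonoidAlgebra.single x 1 * AddMonoidAlgebra.single y 1 by
      simp [AddMonoidAlgebra.single_mul_single]]
  exact map_mul _ _ _

theorem qpow_zero : qpow 0 = 1 := by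
  unfold qpow
  exact map_one _

theorem qpow_injective : Function.Injective qpow := by
  intro x y h
  have := IsFractionRing.injective (AddMonoidAlgebra ℂ ℚ)
    (FractionRing (AddMonoidAlgebra ℂ ℚ)) h
  exact AddMonoidAlgebra.single_left_injective one_ne_zero this

theorem qpow_mul_neg (x : ℚ) : qpow x * qpow (-x) = 1 := by
  rw [← qpow_add, add_neg_cancel, qpow_zero]

theorem qpow_ne_zero (x : ℚ) : qpow x ≠ 0 := left_ne_zero_of_mul_eq_one (qpow_mul_neg x)

theorem qpow_neg (x : ℚ) : qpow (-x) = (qpow x)⁻¹ :=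
  eq_inv_of_mul_eq_one_right (qpow_mul_neg x)

theorem qpow_zpow (x : ℚ) (n : ℤ) : qpow x ^ n = qpow (n * x) := by
  have h : ∀ k : ℕ, qpow x ^ k = qpow (k * x) := by
    intro k
    induction k with
    | zero => simp [qpow_zero]
    | succ k ih => rw [pow_succ, ih, ← qpow_add]; congr 1; push_cast; ring
  obtain ⟨k, rfl | rfl⟩ := n.eq_nat_or_neg
  · simpa using h k
  · rw [zpow_neg, zpow_natCast, h, ← qpow_neg]; congr 1; push_cast; ring

theorem qInt_qpow_ne_zero {x : ℚ} (hx : x ≠ 0) (k : ℕ) : qInt (qpow x) (k + 1) ≠ 0 := by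
  have h : ∀ k : ℕ, qpow x ^ (k + 1) - (qpow x)⁻¹ ^ (k + 1) ≠ 0 := by
    intro k
    rw [sub_ne_zero, ← qpow_neg, ← zpow_natCast, ← zpow_natCast, qpow_zpow, qpow_zpow]
    intro h
    have h' := qpow_injective h
    have h2 : ((k + 1 : ℕ) : ℚ) * x = 0 := by push_cast at h' ⊢; linarith
    rcases mul_eq_zero.1 h2 with h3 | h3
    · exact absurd h3 (by positivity)
    · exact hx h3
  exact div_ne_zero (h k) (by simpa using h 0)


/-- A Cartan matrix `(a i j)` of finite type with positive integers `d i` symmetrising it. -/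
structure CartanDatum (r : ℕ) where
  a : Matrix (Fin r) (Fin r) ℤ
  d : Fin r → ℕ
  a_diag : ∀ i, a i i = 2
  a_offdiag : ∀ i j, i ≠ j → a i j ≤ 0
  d_pos : ∀ i, 0 < d i
  symm : ∀ i j, (d i : ℤ) * a i j = d j * a j i
  posDef : (Matrix.of fun i j => ((d i : ℝ) * (a i j : ℝ))).PosDef

section Algebra

variable {r : ℕ} (C : CartanDatum r)

/-- `v i = q ^ (d i)`. -/
def CartanDatum.v (i : Fin r) : 𝕜 := qpow (C.d i)

/-- `1 - a i j` as a natural number (for `i ≠ j`). -/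
def CartanDatum.serreDeg (i j : Fin r) : ℕ := (1 - C.a i j).toNat

/-- The exponents of `k i = ∏ j, t j ^ (a j i)`. -/
def CartanDatum.kExp (i : Fin r) : Fin r → ℤ := fun j => C.a j i

variable {C}

theorem CartanDatum.v_ne_zero (i : Fin r) : C.v i ≠ 0 := qpow_ne_zero _

theorem CartanDatum.qInt_ne_zero (i : Fin r) (k : ℕ) : qInt (C.v i) (k + 1) ≠ 0 :=
  qInt_qpow_ne_zero (by exact_mod_cast (C.d_pos i).ne') k

theorem CartanDatum.a_eq {i j : Fin r} (h : i ≠ j) : C.a i j = 1 - C.serreDeg i j := by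
  have := C.a_offdiag i j h
  unfold CartanDatum.serreDeg
  omega

theorem CartanDatum.serreDeg_pos {i j : Fin r} (h : i ≠ j) : 0 < C.serreDeg i j := by
  have := C.a_eq h
  have := C.a_offdiag i j h
  omega

theorem CartanDatum.qpow_kExp (i j : Fin r) :
    qpow (C.d j * C.kExp i j) = C.v i ^ C.a i j := by
  rw [CartanDatum.v, qpow_zpow]
  have := C.symm i j
  have h : (C.d i : ℚ) * C.a i j = C.d j * C.a j i := by exact_mod_cast this
  rw [CartanDatum.kExp, ← h, mul_comm]

theorem CartanDatum.qpow_kExp' (i j : Fin r) :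
    qpow (C.d j * C.kExp i j) = C.v j ^ C.a j i := by
  rw [CartanDatum.v, qpow_zpow, CartanDatum.kExp, mul_comm]

variable (C)

/-- The relations between `t ^ n = t 1 ^ n 1 ⋯ t r ^ n r` (with `n ∈ ℤ ^ r`), `e i` and `f i`
other than the quantum Serre relations. -/
structure PreRelations {A : Type*} [Ring A] [Algebra 𝕜 A] (t : (Fin r → ℤ) → A)
    (e f : Fin r → A) : Prop where
  t_zero : t 0 = 1
  t_add : ∀ m n, t m * t n = t (m + n)
  t_e : ∀ n j, t n * e j = qpow (C.d j * n j) • (e j * t n)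
  t_f : ∀ n j, t n * f j = qpow (-(C.d j * n j)) • (f j * t n)
  e_f : ∀ i j, e i * f j - f j * e i =
    if i = j then (C.v i - (C.v i)⁻¹)⁻¹ • (t (C.kExp i) - t (-C.kExp i)) else 0

/-- The defining relations of the quantized universal enveloping algebra. -/
structure Relations {A : Type*} [Ring A] [Algebra 𝕜 A] (t : (Fin r → ℤ) → A)
    (e f : Fin r → A) : Prop extends PreRelations C t e f where
  serre_e : ∀ i j, i ≠ j → serre (C.v i) (C.serreDeg i j) (e i) (e j) = 0
  serre_f : ∀ i j, i ≠ j → serre (C.v i) (C.serreDeg i j) (f i) (f j) = 0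

/-- Generators: the group elements `t ^ n`, `n ∈ ℤ ^ r`, and `e i`, `f i`. -/
inductive Gen (r : ℕ) : Type
  | t (n : Fin r → ℤ) : Gen r
  | e (i : Fin r) : Gen r
  | f (i : Fin r) : Gen r

/-- The defining relations, imposed on the free algebra on the generators. -/
inductive Rel : FreeAlgebra 𝕜 (Gen r) → FreeAlgebra 𝕜 (Gen r) → Prop
  | t_zero : Rel (FreeAlgebra.ι 𝕜 (Gen.t 0)) 1
  | t_add (m n : Fin r → ℤ) : Rel (FreeAlgebra.ι 𝕜 (Gen.t m) * FreeAlgebra.ι 𝕜 (Gen.t n))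
      (FreeAlgebra.ι 𝕜 (Gen.t (m + n)))
  | t_e (n : Fin r → ℤ) (j : Fin r) : Rel (FreeAlgebra.ι 𝕜 (Gen.t n) * FreeAlgebra.ι 𝕜 (Gen.e j))
      (qpow (C.d j * n j) • (FreeAlgebra.ι 𝕜 (Gen.e j) * FreeAlgebra.ι 𝕜 (Gen.t n)))
  | t_f (n : Fin r → ℤ) (j : Fin r) : Rel (FreeAlgebra.ι 𝕜 (Gen.t n) * FreeAlgebra.ι 𝕜 (Gen.f j))
      (qpow (-(C.d j * n j)) • (FreeAlgebra.ι 𝕜 (Gen.f j) * FreeAlgebra.ι 𝕜 (Gen.t n)))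
  | e_f (i j : Fin r) : Rel
      (FreeAlgebra.ι 𝕜 (Gen.e i) * FreeAlgebra.ι 𝕜 (Gen.f j) -
        FreeAlgebra.ι 𝕜 (Gen.f j) * FreeAlgebra.ι 𝕜 (Gen.e i))
      (if i = j then (C.v i - (C.v i)⁻¹)⁻¹ •
        (FreeAlgebra.ι 𝕜 (Gen.t (C.kExp i)) - FreeAlgebra.ι 𝕜 (Gen.t (-C.kExp i))) else 0)
  | serre_e (i j : Fin r) (h : i ≠ j) : Rel (serre (C.v i) (C.serreDeg i j)
      (FreeAlgebra.ι 𝕜 (Gen.e i)) (FreeAlgebra.ι 𝕜 (Gen.e j))) 0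
  | serre_f (i j : Fin r) (h : i ≠ j) : Rel (serre (C.v i) (C.serreDeg i j)
      (FreeAlgebra.ι 𝕜 (Gen.f i)) (FreeAlgebra.ι 𝕜 (Gen.f j))) 0

/-- The quantized universal enveloping algebra `U` of simply connected type. -/
def QEA : Type := RingQuot (Rel C)

instance : Ring (QEA C) := inferInstanceAs (Ring (RingQuot (Rel C)))

instance : Algebra 𝕜 (QEA C) := inferInstanceAs (Algebra 𝕜 (RingQuot (Rel C)))

namespace QEA

/-- The quotient map from the free algebra. -/
def mk : FreeAlgebra 𝕜 (Gen r) →ₐ[𝕜] QEA C := RingQuot.mkAlgHom 𝕜 (Rel C)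

/-- The element `t ^ n = t 1 ^ n 1 ⋯ t r ^ n r`. -/
def t (n : Fin r → ℤ) : QEA C := mk C (FreeAlgebra.ι 𝕜 (Gen.t n))

/-- The generator `e i`. -/
def e (i : Fin r) : QEA C := mk C (FreeAlgebra.ι 𝕜 (Gen.e i))

/-- The generator `f i`. -/
def f (i : Fin r) : QEA C := mk C (FreeAlgebra.ι 𝕜 (Gen.f i))

/-- The element `k i = ∏ j, t j ^ (a j i)`. -/
def k (i : Fin r) : QEA C := t C (C.kExp i)

/-- The inverse of `k i`. -/
def kInv (i : Fin r) : QEA C := t C (-C.kExp i)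

theorem mk_rel {x y : FreeAlgebra 𝕜 (Gen r)} (h : Rel C x y) : mk C x = mk C y :=
  RingQuot.mkAlgHom_rel 𝕜 h

theorem relations : Relations C (t C) (e C) (f C) where
  t_zero := by simpa [t] using mk_rel C Rel.t_zero
  t_add m n := by simpa [t] using mk_rel C (Rel.t_add m n)
  t_e n j := by simpa [t, e] using mk_rel C (Rel.t_e n j)
  t_f n j := by simpa [t, f] using mk_rel C (Rel.t_f n j)
  e_f i j := by
    have := mk_rel C (Rel.e_f i j)
    split_ifs with h
    · simpa [h, t, e, f] using this
    · simpa [h, t, e, f] using this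
  serre_e i j h := by simpa [map_serre, e] using mk_rel C (Rel.serre_e i j h)
  serre_f i j h := by simpa [map_serre, f] using mk_rel C (Rel.serre_f i j h)

variable {C} {A : Type*} [Ring A] [Algebra 𝕜 A]

/-- The map on generators. -/
def genMap (t : (Fin r → ℤ) → A) (e f : Fin r → A) : Gen r → A
  | Gen.t n => t n
  | Gen.e i => e i
  | Gen.f i => f i

/-- The universal property of `U`. -/
def lift {t : (Fin r → ℤ) → A} {e f : Fin r → A} (h : Relations C t e f) : QEA C →ₐ[𝕜] A :=
  RingQuot.liftAlgHom 𝕜 ⟨FreeAlgebra.lift 𝕜 (genMap t e f), by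
    intro x y hxy
    induction hxy with
    | t_zero => simpa [genMap] using h.t_zero
    | t_add m n => simpa [genMap] using h.t_add m n
    | t_e n j => simpa [genMap] using h.t_e n j
    | t_f n j => simpa [genMap] using h.t_f n j
    | e_f i j =>
      have := h.e_f i j
      split_ifs at this ⊢ with hij
      · simpa [genMap] using this
      · simpa [genMap] using this
    | serre_e i j hij => simpa [genMap, map_serre] using h.serre_e i j hij
    | serre_f i j hij => simpa [genMap, map_serre] using h.serre_f i j hij⟩

theorem lift_mk {t : (Fin r → ℤ) → A} {e f : Fin r → A} (h : Relations C t e f)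
    (x : FreeAlgebra 𝕜 (Gen r)) : lift h (mk C x) = FreeAlgebra.lift 𝕜 (genMap t e f) x :=
  RingQuot.liftAlgHom_mkAlgHom_apply 𝕜 _ _ x

@[simp] theorem lift_t {t : (Fin r → ℤ) → A} {e f : Fin r → A} (h : Relations C t e f)
    (n : Fin r → ℤ) : lift h (QEA.t C n) = t n := by simp [QEA.t, lift_mk, genMap]

@[simp] theorem lift_e {t : (Fin r → ℤ) → A} {e f : Fin r → A} (h : Relations C t e f)
    (i : Fin r) : lift h (QEA.e C i) = e i := by simp [QEA.e, lift_mk, genMap]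

@[simp] theorem lift_f {t : (Fin r → ℤ) → A} {e f : Fin r → A} (h : Relations C t e f)
    (i : Fin r) : lift h (QEA.f C i) = f i := by simp [QEA.f, lift_mk, genMap]

theorem induction {p : QEA C → Prop} (hs : ∀ c : 𝕜, p (algebraMap 𝕜 _ c)) (ht : ∀ n, p (t C n))
    (he : ∀ i, p (e C i)) (hf : ∀ i, p (f C i)) (hadd : ∀ x y, p x → p y → p (x + y))
    (hmul : ∀ x y, p x → p y → p (x * y)) (x : QEA C) : p x := by
  obtain ⟨x, rfl⟩ := RingQuot.mkAlgHom_surjective 𝕜 (Rel C) x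
  change p (mk C x)
  induction x using FreeAlgebra.induction with
  | grade0 c => simpa using hs c
  | grade1 g => cases g with
    | t n => exact ht n
    | e i => exact he i
    | f i => exact hf i
  | mul a b ha hb => rw [map_mul]; exact hmul _ _ ha hb
  | add a b ha hb => rw [map_add]; exact hadd _ _ ha hb

end QEA

namespace PreRelations

variable {C} {A : Type*} [Ring A] [Algebra 𝕜 A] {t : (Fin r → ℤ) → A} {e f : Fin r → A}

theorem t_neg_mul (h : PreRelations C t e f) (n : Fin r → ℤ) : t (-n) * t n = 1 := by rw [h.t_add, neg_add_cancel, h.t_zero]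

theorem t_mul_neg (h : PreRelations C t e f) (n : Fin r → ℤ) : t n * t (-n) = 1 := by rw [h.t_add, add_neg_cancel, h.t_zero]

theorem e_t (h : PreRelations C t e f) (n : Fin r → ℤ) (j : Fin r) : e j * t n = qpow (-(C.d j * n j)) • (t n * e j) := by
  rw [h.t_e, smul_smul, ← qpow_add, neg_add_cancel, qpow_zero, one_smul]

theorem f_t (h : PreRelations C t e f) (n : Fin r → ℤ) (j : Fin r) : f j * t n = qpow (C.d j * n j) • (t n * f j) := by
  rw [h.t_f, smul_smul, ← qpow_add, add_neg_cancel, qpow_zero, one_smul]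

theorem t_comm (h : PreRelations C t e f) (m n : Fin r → ℤ) : t m * t n = t n * t m := by rw [h.t_add, h.t_add, add_comm]

theorem k_e (h : PreRelations C t e f) (i j : Fin r) : t (C.kExp i) * e j = C.v i ^ C.a i j • (e j * t (C.kExp i)) := by
  rw [h.t_e, C.qpow_kExp]

theorem k_f (h : PreRelations C t e f) (i j : Fin r) : t (C.kExp i) * f j = C.v i ^ (-C.a i j) • (f j * t (C.kExp i)) := by
  rw [h.t_f, qpow_neg, C.qpow_kExp, zpow_neg]

theorem kInv_e (h : PreRelations C t e f) (i j : Fin r) :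
    t (-C.kExp i) * e j = C.v i ^ (-C.a i j) • (e j * t (-C.kExp i)) := by
  rw [h.t_e, zpow_neg, ← C.qpow_kExp, ← qpow_neg]
  congr 2; simp

theorem kInv_f (h : PreRelations C t e f) (i j : Fin r) : t (-C.kExp i) * f j = C.v i ^ C.a i j • (f j * t (-C.kExp i)) := by
  rw [h.t_f, ← C.qpow_kExp]
  congr 2; simp

theorem e_mul_f (h : PreRelations C t e f) (i j : Fin r) : e i * f j = f j * e i +
    if i = j then (C.v i - (C.v i)⁻¹)⁻¹ • (t (C.kExp i) - t (-C.kExp i)) else 0 := by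
  rw [← h.e_f, add_sub_cancel]

end PreRelations

namespace QEA

variable {C}

theorem pre : PreRelations C (t C) (e C) (f C) := (relations C).toPreRelations

theorem serre_left {B : Type*} [Ring B] [Algebra 𝕜 B] {D : Type*} [Ring D] [Algebra 𝕜 D] {v : 𝕜}
    {n : ℕ} {a b : B} (h : serre v n a b = 0) :
    serre v n (a ⊗ₜ[𝕜] (1 : D)) (b ⊗ₜ[𝕜] (1 : D)) = 0 := by
  have := map_serre (Algebra.TensorProduct.includeLeft : B →ₐ[𝕜] B ⊗[𝕜] D) v n a b
  rw [h, map_zero] at this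
  exact this.symm

theorem serre_right {B : Type*} [Ring B] [Algebra 𝕜 B] {D : Type*} [Ring D] [Algebra 𝕜 D] {v : 𝕜}
    {n : ℕ} {a b : D} (h : serre v n a b = 0) :
    serre v n ((1 : B) ⊗ₜ[𝕜] a) ((1 : B) ⊗ₜ[𝕜] b) = 0 := by
  have := map_serre (Algebra.TensorProduct.includeRight : D →ₐ[𝕜] B ⊗[𝕜] D) v n a b
  rw [h, map_zero] at this
  exact this.symm

open TensorProduct Algebra.TensorProduct in
theorem comul_relations : Relations C (A := QEA C ⊗[𝕜] QEA C)
    (fun n => t C n ⊗ₜ t C n)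
    (fun i => e C i ⊗ₜ 1 + k C i ⊗ₜ e C i)
    (fun i => f C i ⊗ₜ kInv C i + 1 ⊗ₜ f C i) where
  t_zero := by rw [pre.t_zero]; rfl
  t_add m n := by rw [tmul_mul_tmul, pre.t_add]
  t_e n j := by
    simp only [mul_add, add_mul, tmul_mul_tmul, pre.t_e, k, pre.t_comm (C.kExp j) n, mul_one,
      one_mul, smul_add, tmul_smul, smul_tmul']
  t_f n j := by
    simp only [mul_add, add_mul, tmul_mul_tmul, pre.t_f, kInv, pre.t_comm n (-C.kExp j), mul_one,
      one_mul, smul_add, tmul_smul, smul_tmul']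
  e_f i j := by
    have h1 : k C i * f C j = C.v i ^ (-C.a i j) • (f C j * k C i) := pre.k_f i j
    have h2 : e C i * kInv C j = C.v i ^ C.a i j • (kInv C j * e C i) := by
      rw [kInv, pre.e_t, ← C.qpow_kExp' j i]
      congr 2; simp
    have h3 : C.v i ^ C.a i j * C.v i ^ (-C.a i j) = 1 := by
      rw [← zpow_add₀ (C.v_ne_zero i), add_neg_cancel, zpow_zero]
    simp only [mul_add, add_mul, tmul_mul_tmul, one_mul, mul_one, h1, h2, pre.e_mul_f, add_tmul,
      tmul_add, tmul_smul, smul_tmul', smul_smul, h3, one_smul]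
    split_ifs with hij
    · subst hij
      simp only [k, kInv, tmul_smul, smul_tmul', sub_tmul, tmul_sub, smul_sub]
      abel
    · simp only [zero_tmul, tmul_zero]
      abel
  serre_e i j hij := by
    have hn := C.v_ne_zero i
    have hk : ∀ i j, k C i * e C j = C.v i ^ C.a i j • (e C j * k C i) := pre.k_e
    refine serre_coprod hn (C.qInt_ne_zero i) (C.a_eq hij) ?_ ?_ ?_
      (serre_left ((relations C).serre_e i j hij)) ?_
    · rw [tmul_mul_tmul, hk, C.a_diag, tmul_mul_tmul, one_mul, mul_one, smul_tmul']
    · rw [tmul_mul_tmul, hk, tmul_mul_tmul, one_mul, mul_one, smul_tmul']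
    · rw [tmul_mul_tmul, hk, tmul_mul_tmul, one_mul, mul_one, smul_tmul',
        ← C.qpow_kExp, C.qpow_kExp']
    · have := serre_twist (A := QEA C ⊗[𝕜] QEA C) hn (C.qInt_ne_zero i) (n := C.serreDeg i j)
        (a := 1 ⊗ₜ e C i) (b := 1 ⊗ₜ e C j) (k := k C i ⊗ₜ 1) (l := k C j ⊗ₜ 1) (x := 1) (y := 1)
        (by simp) (by simp) (by simp) (by simp [k, pre.t_comm])
        (serre_right ((relations C).serre_e i j hij))
      simpa using this
  serre_f i j hij := by
    have hn := C.v_ne_zero i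
    have hk : ∀ i j, kInv C i * f C j = C.v i ^ C.a i j • (f C j * kInv C i) := pre.kInv_f
    rw [add_comm (f C i ⊗ₜ kInv C i), add_comm (f C j ⊗ₜ kInv C j)]
    refine serre_coprod hn (C.qInt_ne_zero i) (C.a_eq hij) ?_ ?_ ?_
      (serre_right ((relations C).serre_f i j hij)) ?_
    · rw [tmul_mul_tmul, hk, C.a_diag, tmul_mul_tmul, one_mul, mul_one, tmul_smul]
    · rw [tmul_mul_tmul, hk, tmul_mul_tmul, one_mul, mul_one, tmul_smul]
    · rw [tmul_mul_tmul, hk, tmul_mul_tmul, one_mul, mul_one, tmul_smul,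
        ← C.qpow_kExp, C.qpow_kExp']
    · have := serre_twist (A := QEA C ⊗[𝕜] QEA C) hn (C.qInt_ne_zero i) (n := C.serreDeg i j)
        (a := f C i ⊗ₜ 1) (b := f C j ⊗ₜ 1) (k := 1 ⊗ₜ kInv C i) (l := 1 ⊗ₜ kInv C j)
        (x := 1) (y := 1)
        (by simp) (by simp) (by simp) (by simp [kInv, pre.t_comm])
        (serre_left ((relations C).serre_f i j hij))
      simpa using this

variable (C)

/-- The comultiplication: `Δ(t) = t ⊗ t`, `Δ(e i) = e i ⊗ 1 + k i ⊗ e i`,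
`Δ(f i) = f i ⊗ (k i)⁻¹ + 1 ⊗ f i`. -/
def comul : QEA C →ₐ[𝕜] QEA C ⊗[𝕜] QEA C := lift comul_relations

theorem serre_zero {B : Type*} [Ring B] [Algebra 𝕜 B] (v : 𝕜) (n : ℕ) (a : B) :
    serre v n a 0 = 0 := by simp [serre]

theorem counit_relations : Relations C (A := 𝕜) (fun _ => 1) (fun _ => 0) (fun _ => 0) where
  t_zero := rfl
  t_add m n := by simp
  t_e n j := by simp
  t_f n j := by simp
  e_f i j := by simp
  serre_e i j _ := serre_zero _ _ _
  serre_f i j _ := serre_zero _ _ _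

/-- The counit: `ε(t) = 1`, `ε(e i) = ε(f i) = 0`. -/
def counit : QEA C →ₐ[𝕜] 𝕜 := lift (counit_relations C)

open MulOpposite in
theorem antipode_relations : Relations C (A := (QEA C)ᵐᵒᵖ) (fun n => op (t C (-n)))
    (fun i => op (-(kInv C i * e C i))) (fun i => op (-(f C i * k C i))) where
  t_zero := by simp [pre.t_zero]
  t_add m n := by rw [← op_mul, pre.t_add]; congr 2; abel
  t_e n j := by
    rw [← op_mul, ← op_mul, ← op_smul]
    congr 1
    simp only [neg_mul, mul_neg, smul_neg, kInv]
    rw [mul_assoc, pre.e_t, ← mul_assoc, pre.t_comm (-n), mul_smul_comm, mul_assoc]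
    congr 3; simp
  t_f n j := by
    rw [← op_mul, ← op_mul, ← op_smul]
    congr 1
    simp only [neg_mul, mul_neg, smul_neg, k]
    rw [mul_assoc, pre.t_comm, ← mul_assoc, pre.f_t, smul_mul_assoc, mul_assoc]
    congr 3; simp
  e_f i j := by
    have h1 : kInv C i * f C j = C.v i ^ C.a i j • (f C j * kInv C i) := pre.kInv_f i j
    have h2 : k C j * e C i = C.v i ^ C.a i j • (e C i * k C j) := by
      rw [k, pre.k_e, ← C.qpow_kExp, C.qpow_kExp']
    have h4 : f C j * k C j * (kInv C i * e C i) = kInv C i * (f C j * e C i) * k C j := by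
      have e1 : k C j * (kInv C i * e C i) = C.v i ^ C.a i j • (kInv C i * (e C i * k C j)) := by
        rw [← mul_assoc, k, kInv, pre.t_comm, mul_assoc]
        change t C (-C.kExp i) * (k C j * e C i) = _
        rw [h2, mul_smul_comm]; rfl
      calc f C j * k C j * (kInv C i * e C i)
          = f C j * (k C j * (kInv C i * e C i)) := mul_assoc _ _ _
        _ = (C.v i ^ C.a i j • (f C j * kInv C i)) * (e C i * k C j) := by
            rw [e1, mul_smul_comm, smul_mul_assoc]; simp only [mul_assoc]
        _ = _ := by rw [← h1]; simp only [mul_assoc]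
    rw [← op_mul, ← op_mul, ← op_sub]
    simp only [neg_mul, mul_neg, neg_neg]
    have h5 : kInv C i * e C i * (f C j * k C j) = kInv C i * (e C i * f C j) * k C j := by
      simp only [mul_assoc]
    rw [h4, h5, ← sub_mul, ← mul_sub, ← neg_sub (e C i * f C j), pre.e_f]
    split_ifs with hij
    · subst hij
      rw [← op_sub, ← op_smul]
      congr 1
      rw [mul_neg, mul_smul_comm, neg_mul, smul_mul_assoc, ← smul_neg, mul_sub, sub_mul, kInv, k,
        pre.t_neg_mul, one_mul, mul_assoc, pre.t_neg_mul, mul_one, neg_sub]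
    · simp
  serre_e i j hij := by
    have hn := C.v_ne_zero i
    have h0 : ∀ i j, kInv C i * e C j = C.v i ^ (-C.a i j) • (e C j * kInv C i) := pre.kInv_e
    have h : ∀ i j, e C j * kInv C i = C.v i ^ C.a i j • (kInv C i * e C j) := by
      intro i j
      rw [h0, smul_smul, ← zpow_add₀ (C.v_ne_zero i), add_neg_cancel, zpow_zero, one_smul]
    rw [serre_op, unop_op, unop_op, ← neg_one_smul 𝕜 (kInv C i * e C i), ← neg_one_smul 𝕜 (kInv C j * e C j),
      serre_smul, serre_twist hn (C.qInt_ne_zero i) (h i i) (h i j)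
        (by rw [h j i, ← C.qpow_kExp, C.qpow_kExp'])
        (by rw [kInv, kInv, pre.t_comm]) ((relations C).serre_e i j hij)]
    simp
  serre_f i j hij := by
    have hn := C.v_ne_zero i
    have h : ∀ i j, f C j * k C i = C.v i ^ C.a i j • (k C i * f C j) := by
      intro i j
      rw [k, pre.k_f, smul_smul, ← zpow_add₀ (C.v_ne_zero i), add_neg_cancel, zpow_zero, one_smul]
    rw [serre_op, unop_op, unop_op, h i i, h j j, ← neg_smul, ← neg_smul,
      serre_smul, serre_twist hn (C.qInt_ne_zero i) (h i i) (h i j)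
        (by rw [h j i, ← C.qpow_kExp, C.qpow_kExp'])
        (by rw [k, k, pre.t_comm]) ((relations C).serre_f i j hij)]
    simp

/-- The antipode, as a homomorphism to the opposite algebra: `σ(t) = t⁻¹`,
`σ(e i) = -(k i)⁻¹ e i`, `σ(f i) = - f i k i`. -/
def antipodeOp : QEA C →ₐ[𝕜] (QEA C)ᵐᵒᵖ := lift (antipode_relations C)

/-- The antipode as a linear map. -/
def antipode : QEA C →ₗ[𝕜] QEA C :=
  (MulOpposite.opLinearEquiv 𝕜).symm.toLinearMap ∘ₗ (antipodeOp C).toLinearMap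

theorem theta_relations : Relations C (fun n => t C (-n)) (fun i => -f C i) (fun i => -e C i) where
  t_zero := by simp [pre.t_zero]
  t_add m n := by rw [pre.t_add]; congr 1; abel
  t_e n j := by
    rw [mul_neg, neg_mul, smul_neg, pre.t_f]; congr 2; simp
  t_f n j := by
    rw [mul_neg, neg_mul, smul_neg, pre.t_e]; congr 2; simp
  e_f i j := by
    rw [neg_mul_neg, neg_mul_neg, ← neg_sub, pre.e_f]
    by_cases h : i = j
    · subst h; simp [← smul_neg]
    · simp [h, Ne.symm h]
  serre_e i j hij := by
    rw [← neg_one_smul 𝕜, ← neg_one_smul 𝕜 (f C j), serre_smul, (relations C).serre_f i j hij,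
      smul_zero]
  serre_f i j hij := by
    rw [← neg_one_smul 𝕜, ← neg_one_smul 𝕜 (e C j), serre_smul, (relations C).serre_e i j hij,
      smul_zero]

/-- The automorphism `θ`: `θ(e i) = - f i`, `θ(f i) = - e i`, `θ(t) = t⁻¹`. -/
def theta : QEA C →ₐ[𝕜] QEA C := lift (theta_relations C)

/-- The antiautomorphism `ω = σ θ`. -/
def omega : QEA C →ₗ[𝕜] QEA C := antipode C ∘ₗ (theta C).toLinearMap

/-- The subalgebra `U⁰` generated by the `t i` and their inverses. -/
def U0 : Subalgebra 𝕜 (QEA C) := Algebra.adjoin 𝕜 (Set.range (t C))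

/-- The subalgebra `U⁺` generated by the `e i`. -/
def UPos : Subalgebra 𝕜 (QEA C) := Algebra.adjoin 𝕜 (Set.range (e C))

/-- The subalgebra `U⁻` generated by the `f i`. -/
def UNeg : Subalgebra 𝕜 (QEA C) := Algebra.adjoin 𝕜 (Set.range (f C))

end QEA

theorem serre_conj {K : Type*} [Field K] {A : Type*} [Ring A] [Algebra K A] {v : K} {n : ℕ}
    {a b z : A} {x y : K} (ha : z * a = x • (a * z)) (hb : z * b = y • (b * z)) :
    z * serre v n a b = (x ^ n * y) • (serre v n a b * z) := by
  have hp : ∀ s : ℕ, z * a ^ s = x ^ s • (a ^ s * z) := by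
    intro s
    induction s with
    | zero => simp
    | succ s ih =>
      rw [pow_succ, ← mul_assoc, ih, smul_mul_assoc, mul_assoc, ha, mul_smul_comm, smul_smul,
        mul_assoc, ← pow_succ]
  rw [serre, Finset.mul_sum, Finset.sum_mul, Finset.smul_sum]
  refine Finset.sum_congr rfl fun m hm => ?_
  have hm' : m ≤ n := Nat.lt_succ_iff.1 (Finset.mem_range.1 hm)
  rw [mul_smul_comm, smul_mul_assoc, smul_comm, ← mul_assoc, ← mul_assoc, hp, smul_mul_assoc,
    smul_mul_assoc, mul_assoc (a ^ m), hb, mul_smul_comm, smul_mul_assoc, mul_assoc, mul_assoc,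
    hp]
  simp only [mul_smul_comm, smul_smul, mul_assoc]
  congr 1
  rw [show x ^ n = x ^ m * x ^ (n - m) by rw [← pow_add, Nat.add_sub_cancel' hm']]
  ring

namespace PreRelations

variable {C} {A : Type*} [Ring A] [Algebra 𝕜 A] {t : (Fin r → ℤ) → A} {e f : Fin r → A}

theorem map (h : PreRelations C t e f) {B : Type*} [Ring B] [Algebra 𝕜 B] (φ : A →ₐ[𝕜] B) :
    PreRelations C (fun n => φ (t n)) (fun i => φ (e i)) (fun i => φ (f i)) where
  t_zero := by rw [h.t_zero, map_one]
  t_add m n := by rw [← map_mul, h.t_add]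
  t_e n j := by rw [← map_mul, h.t_e, map_smul, map_mul]
  t_f n j := by rw [← map_mul, h.t_f, map_smul, map_mul]
  e_f i j := by
    rw [← map_mul, ← map_mul, ← map_sub, h.e_f]
    split_ifs <;> simp

theorem swap (h : PreRelations C t e f) : PreRelations C (fun n => t (-n)) f e where
  t_zero := by simp [h.t_zero]
  t_add m n := by rw [h.t_add]; congr 1; abel
  t_e n j := by rw [h.t_f]; congr 2; simp
  t_f n j := by rw [h.t_e]; congr 2; simp
  e_f i j := by
    rw [← neg_sub, h.e_f]
    by_cases hij : i = j
    · subst hij; simp [← smul_neg]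
    · simp [hij, Ne.symm hij]

theorem e_serre (h : PreRelations C t e f) {i j : Fin r} (hij : i ≠ j) (l : Fin r) :
    e l * serre (C.v i) (C.serreDeg i j) (f i) (f j) =
      serre (C.v i) (C.serreDeg i j) (f i) (f j) * e l := by
  have hfk : ∀ i j, f j * t (C.kExp i) = C.v i ^ C.a i j • (t (C.kExp i) * f j) := by
    intro i j
    rw [h.k_f, smul_smul, ← zpow_add₀ (C.v_ne_zero i), add_neg_cancel, zpow_zero, one_smul]
  by_cases hi : l = i
  · subst hi
    refine commutator_serre_self (C.v_ne_zero l) (C.qInt_ne_zero l) (C.a_eq hij)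
      (k := t (C.kExp l)) (k' := t (-C.kExp l)) (δ := (C.v l - (C.v l)⁻¹)⁻¹) ?_ (hfk l j) ?_
      (h.kInv_f l j) ?_ ?_
    · rw [hfk, C.a_diag]
    · rw [h.kInv_f, C.a_diag]
    · rw [h.e_mul_f, if_pos rfl]
    · rw [h.e_mul_f, if_neg hij, add_zero]
  by_cases hj : l = j
  · subst hj
    refine commutator_serre_other (C.v_ne_zero i) (C.qInt_ne_zero i) (C.a_eq hij)
      (C.serreDeg_pos hij)
      (l := t (C.kExp l)) (l' := t (-C.kExp l)) (δ := (C.v l - (C.v l)⁻¹)⁻¹) ?_ ?_ ?_ ?_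
    · rw [hfk, ← C.qpow_kExp, C.qpow_kExp']
    · rw [h.kInv_f, ← C.qpow_kExp, C.qpow_kExp']
    · rw [h.e_mul_f, if_neg (Ne.symm hij), add_zero]
    · rw [h.e_mul_f, if_pos rfl]
  · have := serre_conj (K := 𝕜) (v := C.v i) (n := C.serreDeg i j) (z := e l) (a := f i) (b := f j)
      (x := 1) (y := 1) (by rw [h.e_mul_f, if_neg hi, add_zero, one_smul])
      (by rw [h.e_mul_f, if_neg hj, add_zero, one_smul])
    simpa using this

theorem f_serre (h : PreRelations C t e f) {i j : Fin r} (hij : i ≠ j) (l : Fin r) :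
    f l * serre (C.v i) (C.serreDeg i j) (e i) (e j) =
      serre (C.v i) (C.serreDeg i j) (e i) (e j) * f l :=
  h.swap.e_serre hij l

end PreRelations

section Weights

/-- The value `q ^ λ (t ^ n)`, where `q ^ λ (t i) = q ^ (d i * ⟨λ, u i⟩)`. A weight `λ ∈ 𝔥*` is
given by its coordinates `⟨λ, u i⟩ ∈ ℚ` in the basis of simple roots. -/
def qwt (lam : Fin r → ℚ) (n : Fin r → ℤ) : 𝕜 := qpow (∑ i, C.d i * lam i * n i)

theorem qwt_zero_right (lam : Fin r → ℚ) : qwt C lam 0 = 1 := by simp [qwt, qpow_zero]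

theorem qwt_zero_left (n : Fin r → ℤ) : qwt C 0 n = 1 := by simp [qwt, qpow_zero]

theorem qwt_add_right (lam : Fin r → ℚ) (m n : Fin r → ℤ) :
    qwt C lam (m + n) = qwt C lam m * qwt C lam n := by
  rw [qwt, qwt, qwt, ← qpow_add, ← Finset.sum_add_distrib]
  congr 1; refine Finset.sum_congr rfl fun i _ => ?_
  push_cast [Pi.add_apply]; ring

theorem qwt_add_left (lam mu : Fin r → ℚ) (n : Fin r → ℤ) :
    qwt C (lam + mu) n = qwt C lam n * qwt C mu n := by
  rw [qwt, qwt, qwt, ← qpow_add, ← Finset.sum_add_distrib]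
  congr 1; refine Finset.sum_congr rfl fun i _ => ?_
  push_cast [Pi.add_apply]; ring

theorem qwt_single (x : ℚ) (i : Fin r) (n : Fin r → ℤ) :
    qwt C (Pi.single i x) n = qpow (C.d i * x * n i) := by
  rw [qwt]; congr 1
  rw [Finset.sum_eq_single i]
  · simp
  · intro j _ hj; simp [hj]
  · simp

end Weights

section HighestWeight

/-- The free module on words in the letters `f i`. -/
abbrev Words (r : ℕ) : Type := List (Fin r) →₀ 𝕜

/-- The weight of a word, for the empty word of weight `lam`. -/
def wordWt (lam : Fin r → ℚ) : List (Fin r) → Fin r → ℚ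
  | [] => lam
  | j :: w => wordWt lam w + Pi.single j (-1)

/-- Action of the torus on words. -/
def wordT (lam : Fin r → ℚ) (n : Fin r → ℤ) : Module.End 𝕜 (Words r) :=
  Finsupp.linearCombination 𝕜 fun w => qwt C (wordWt lam w) n • Finsupp.single w (1 : 𝕜)

/-- Action of `f i` on words. -/
def wordF (i : Fin r) : Module.End 𝕜 (Words r) :=
  Finsupp.linearCombination 𝕜 fun w => Finsupp.single (i :: w) (1 : 𝕜)

/-- Action of `e i` on a word. -/
def wordEBasis (lam : Fin r → ℚ) (i : Fin r) : List (Fin r) → Words r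
  | [] => 0
  | j :: w => wordF j (wordEBasis lam i w) +
      if i = j then (C.v i - (C.v i)⁻¹)⁻¹ •
        (wordT C lam (C.kExp i) (Finsupp.single w 1) - wordT C lam (-C.kExp i) (Finsupp.single w 1))
      else 0

/-- Action of `e i` on words. -/
def wordE (lam : Fin r → ℚ) (i : Fin r) : Module.End 𝕜 (Words r) :=
  Finsupp.linearCombination 𝕜 (wordEBasis C lam i)

variable {C}

theorem wordT_single (lam : Fin r → ℚ) (n : Fin r → ℤ) (w : List (Fin r)) :
    wordT C lam n (Finsupp.single w 1) = qwt C (wordWt lam w) n • Finsupp.single w (1 : 𝕜) := by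
  simp [wordT]

theorem wordF_single (i : Fin r) (w : List (Fin r)) :
    wordF i (Finsupp.single w 1) = Finsupp.single (i :: w) (1 : 𝕜) := by simp [wordF]

theorem wordE_single (lam : Fin r → ℚ) (i : Fin r) (w : List (Fin r)) :
    wordE C lam i (Finsupp.single w 1) = wordEBasis C lam i w := by simp [wordE]

theorem words_ext {M : Type*} [AddCommMonoid M] [Module 𝕜 M] {φ ψ : Words r →ₗ[𝕜] M}
    (h : ∀ w, φ (Finsupp.single w 1) = ψ (Finsupp.single w 1)) : φ = ψ :=
  Finsupp.lhom_ext' fun w => LinearMap.ext_ring (h w)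

theorem word_t_f (lam : Fin r → ℚ) (n : Fin r → ℤ) (j : Fin r) :
    wordT C lam n * wordF j = qpow (-(C.d j * n j)) • (wordF j * wordT C lam n) := by
  refine words_ext fun w => ?_
  simp only [Module.End.mul_apply, LinearMap.smul_apply, wordF_single, wordT_single, map_smul,
    wordWt, smul_smul, qwt_add_left, qwt_single]
  congr 1
  rw [mul_comm]; congr 2; ring

theorem word_pre (lam : Fin r → ℚ) : PreRelations C (wordT C lam) (wordE C lam) wordF where
  t_zero := words_ext fun w => by simp [wordT_single, qwt_zero_right]
  t_add m n := words_ext fun w => by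
    rw [Module.End.mul_apply, wordT_single, wordT_single, map_smul, wordT_single, smul_smul,
      qwt_add_right, mul_comm]
  t_e n j := by
    refine words_ext fun w => ?_
    induction w with
    | nil =>
      rw [Module.End.mul_apply, LinearMap.smul_apply, Module.End.mul_apply, wordT_single, map_smul,
        wordE_single, wordEBasis, map_zero, smul_zero, smul_zero]
    | cons i w ih =>
      have hT : ∀ x, wordT C lam n (wordF i x) =
          qpow (-(C.d i * n i)) • wordF i (wordT C lam n x) := fun x =>
        LinearMap.congr_fun (word_t_f lam n i) x
      simp only [Module.End.mul_apply, LinearMap.smul_apply, wordE_single, wordT_single,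
        map_smul] at ih ⊢
      rw [wordEBasis, map_add, hT, ih]
      simp only [map_smul, smul_add, smul_smul]
      congr 1
      · congr 1
        rw [wordWt, qwt_add_left, qwt_single, mul_left_comm]
        congr 1
        rw [mul_comm]; congr 2; ring
      · split_ifs with h
        · subst h
          simp only [map_smul, map_sub, wordT_single, smul_sub, smul_smul]
          have : qpow (C.d j * n j) * qwt C (wordWt lam (j :: w)) n = qwt C (wordWt lam w) n := by
            rw [wordWt, qwt_add_left, qwt_single, mul_left_comm, ← qpow_add]
            simp [qpow_zero]
          congr 2
          · rw [this]; ring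
          · rw [this]; ring
        · simp
  t_f := word_t_f lam
  e_f i j := by
    refine words_ext fun w => ?_
    simp only [LinearMap.sub_apply, Module.End.mul_apply, wordF_single, wordE_single, wordEBasis]
    rw [add_sub_cancel_left]
    split_ifs <;> simp

variable (C)

/-- The submodule generated by the quantum Serre relations for the `f i`. -/
def serreSub : Submodule 𝕜 (Words r) :=
  sInf {N | (∀ i j, i ≠ j → ∀ x,
      serre (C.v i) (C.serreDeg i j) (wordF i : Module.End 𝕜 (Words r)) (wordF j) x ∈ N) ∧
    ∀ i, ∀ x ∈ N, wordF i x ∈ N}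

variable {C}

theorem serreSub_le {N : Submodule 𝕜 (Words r)}
    (h1 : ∀ i j, i ≠ j → ∀ x,
      serre (C.v i) (C.serreDeg i j) (wordF i : Module.End 𝕜 (Words r)) (wordF j) x ∈ N)
    (h2 : ∀ i, ∀ x ∈ N, wordF i x ∈ N) : serreSub C ≤ N := sInf_le ⟨h1, h2⟩

theorem serre_mem_serreSub {i j : Fin r} (hij : i ≠ j) (x : Words r) :
    serre (C.v i) (C.serreDeg i j) (wordF i : Module.End 𝕜 (Words r)) (wordF j) x
      ∈ serreSub C := by
  rw [serreSub, Submodule.mem_sInf]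
  exact fun N hN => hN.1 i j hij x

theorem wordF_mem_serreSub (i : Fin r) {x : Words r} (hx : x ∈ serreSub C) :
    wordF i x ∈ serreSub C := by
  rw [serreSub, Submodule.mem_sInf] at *
  exact fun N hN => hN.2 i x (hx N hN)

theorem serreSub_stable (lam : Fin r → ℚ) {x : Words r} (hx : x ∈ serreSub C) :
    (∀ n, wordT C lam n x ∈ serreSub C) ∧ ∀ i, wordE C lam i x ∈ serreSub C := by
  have hp := word_pre (C := C) lam
  have : serreSub C ≤ serreSub C ⊓ ((⨅ n, (serreSub C).comap (wordT C lam n)) ⊓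
      ⨅ i, (serreSub C).comap (wordE C lam i)) := by
    refine serreSub_le ?_ ?_
    · intro i j hij x
      simp only [Submodule.mem_inf, Submodule.mem_iInf, Submodule.mem_comap]
      refine ⟨serre_mem_serreSub hij x, fun n => ?_, fun l => ?_⟩
      · have := LinearMap.congr_fun (serre_conj (v := C.v i) (n := C.serreDeg i j)
          (hp.t_f n i) (hp.t_f n j)) x
        simp only [Module.End.mul_apply, LinearMap.smul_apply] at this
        rw [this]
        exact Submodule.smul_mem _ _ (serre_mem_serreSub hij _)
      · have := LinearMap.congr_fun (hp.e_serre hij l) x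
        simp only [Module.End.mul_apply] at this
        rw [this]
        exact serre_mem_serreSub hij _
    · intro i x hx
      simp only [Submodule.mem_inf, Submodule.mem_iInf, Submodule.mem_comap] at hx ⊢
      refine ⟨wordF_mem_serreSub i hx.1, fun n => ?_, fun l => ?_⟩
      · have := LinearMap.congr_fun (hp.t_f n i) x
        simp only [Module.End.mul_apply, LinearMap.smul_apply] at this
        rw [this]
        exact Submodule.smul_mem _ _ (wordF_mem_serreSub i (hx.2.1 n))
      · have := LinearMap.congr_fun (hp.e_mul_f l i) x
        simp only [Module.End.mul_apply, LinearMap.add_apply] at this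
        rw [this]
        refine Submodule.add_mem _ (wordF_mem_serreSub i (hx.2.2 l)) ?_
        split_ifs
        · exact Submodule.smul_mem _ _ (Submodule.sub_mem _ (hx.2.1 _) (hx.2.1 _))
        · exact Submodule.zero_mem _
  have h := this hx
  simp only [Submodule.mem_inf, Submodule.mem_iInf, Submodule.mem_comap] at h
  exact h.2

/-- The coefficient of the empty word. -/
def emptyCoeff : Words r →ₗ[𝕜] 𝕜 := Finsupp.lapply []

theorem emptyCoeff_wordF (i : Fin r) (x : Words r) : emptyCoeff (wordF i x) = 0 := by
  have : emptyCoeff ∘ₗ wordF i = (0 : Words r →ₗ[𝕜] 𝕜) := words_ext fun w => by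
    simp [emptyCoeff, wordF_single]
  exact LinearMap.congr_fun this x

theorem serreSub_le_ker : serreSub C ≤ LinearMap.ker (emptyCoeff (r := r)) := by
  refine serreSub_le ?_ fun i x _ => emptyCoeff_wordF i x
  intro i j _ x
  rw [LinearMap.mem_ker, serre, LinearMap.sum_apply, map_sum]
  refine Finset.sum_eq_zero fun m _ => ?_
  rw [LinearMap.smul_apply, map_smul]
  cases m with
  | zero => simp [emptyCoeff_wordF]
  | succ m => simp [pow_succ' _ m, emptyCoeff_wordF]

theorem wordE_serre (lam : Fin r → ℚ) {i j : Fin r} (hij : i ≠ j) :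
    serre (C.v i) (C.serreDeg i j) (wordE C lam i) (wordE C lam j) = 0 := by
  refine words_ext fun w => ?_
  induction w with
  | nil =>
    have h0 : ∀ i, wordE C lam i (Finsupp.single [] 1) = 0 := fun i => wordE_single lam i []
    rw [serre, LinearMap.sum_apply, LinearMap.zero_apply]
    refine Finset.sum_eq_zero fun m _ => ?_
    rw [LinearMap.smul_apply]
    cases C.serreDeg i j - m with
    | zero => simp [h0]
    | succ m => simp [pow_succ _ m, h0]
  | cons l w ih =>
    have := LinearMap.congr_fun ((word_pre (C := C) lam).f_serre hij l) (Finsupp.single w 1)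
    simp only [Module.End.mul_apply, wordF_single, ih] at this
    rw [← this]
    simp

variable (C)

theorem serre_intertwine {V W : Type*} [AddCommGroup V] [Module 𝕜 V] [AddCommGroup W] [Module 𝕜 W]
    (π : V →ₗ[𝕜] W) {a b : Module.End 𝕜 V} {a' b' : Module.End 𝕜 W} (ha : ∀ x, a' (π x) = π (a x))
    (hb : ∀ x, b' (π x) = π (b x)) (v : 𝕜) (n : ℕ) (x : V) :
    serre v n a' b' (π x) = π (serre v n a b x) := by
  have hp : ∀ (s : ℕ) (x : V), (a' ^ s) (π x) = π ((a ^ s) x) := by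
    intro s
    induction s with
    | zero => intro x; simp
    | succ s ih => intro x; simp [pow_succ, ha, ih]
  simp [serre, LinearMap.sum_apply, map_sum, hp, hb]

/-- The torus on the quotient by the Serre submodule. -/
def vermaT (lam : Fin r → ℚ) (n : Fin r → ℤ) : Module.End 𝕜 (Words r ⧸ serreSub C) :=
  (serreSub C).mapQ (serreSub C) (wordT C lam n) fun _ hx => (serreSub_stable lam hx).1 n

/-- `e i` on the quotient by the Serre submodule. -/
def vermaE (lam : Fin r → ℚ) (i : Fin r) : Module.End 𝕜 (Words r ⧸ serreSub C) :=
  (serreSub C).mapQ (serreSub C) (wordE C lam i) fun _ hx => (serreSub_stable lam hx).2 i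

/-- `f i` on the quotient by the Serre submodule. -/
def vermaF (i : Fin r) : Module.End 𝕜 (Words r ⧸ serreSub C) :=
  (serreSub C).mapQ (serreSub C) (wordF i) fun _ hx => wordF_mem_serreSub i hx

variable {C}

theorem verma_relations (lam : Fin r → ℚ) :
    Relations C (vermaT C lam) (vermaE C lam) (vermaF C) where
  t_zero := Submodule.linearMap_qext _ <| LinearMap.ext fun x =>
    congrArg (serreSub C).mkQ (LinearMap.congr_fun (word_pre (C := C) lam).t_zero x)
  t_add m n := Submodule.linearMap_qext _ <| LinearMap.ext fun x =>
    congrArg (serreSub C).mkQ (LinearMap.congr_fun ((word_pre (C := C) lam).t_add m n) x)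
  t_e n j := Submodule.linearMap_qext _ <| LinearMap.ext fun x =>
    congrArg (serreSub C).mkQ (LinearMap.congr_fun ((word_pre (C := C) lam).t_e n j) x)
  t_f n j := Submodule.linearMap_qext _ <| LinearMap.ext fun x =>
    congrArg (serreSub C).mkQ (LinearMap.congr_fun ((word_pre (C := C) lam).t_f n j) x)
  e_f i j := Submodule.linearMap_qext _ <| LinearMap.ext fun x => by
    have := congrArg (serreSub C).mkQ (LinearMap.congr_fun ((word_pre (C := C) lam).e_f i j) x)
    refine Eq.trans (by rfl) (this.trans ?_)
    split_ifs <;> rfl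
  serre_e i j hij := Submodule.linearMap_qext _ <| LinearMap.ext fun x => by
    refine (serre_intertwine (serreSub C).mkQ (a := wordE C lam i) (b := wordE C lam j)
      (fun _ => rfl) (fun _ => rfl) _ _ x).trans ?_
    rw [wordE_serre lam hij]
    rfl
  serre_f i j hij := Submodule.linearMap_qext _ <| LinearMap.ext fun x => by
    refine (serre_intertwine (serreSub C).mkQ (a := wordF i) (b := wordF j)
      (fun _ => rfl) (fun _ => rfl) _ _ x).trans ?_
    exact (Submodule.Quotient.mk_eq_zero _).2 (serre_mem_serreSub hij x)

variable (C)

/-- A highest weight representation of `U` of highest weight `lam`, on the space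
`U⁻ · (empty word)`. -/
def wordRep (lam : Fin r → ℚ) : QEA C →ₐ[𝕜] Module.End 𝕜 (Words r ⧸ serreSub C) :=
  QEA.lift (verma_relations lam)

/-- The coefficient of the highest weight vector in `x · (highest weight vector)`. -/
def hwFun (lam : Fin r → ℚ) : QEA C →ₗ[𝕜] 𝕜 :=
  (serreSub C).liftQ emptyCoeff serreSub_le_ker ∘ₗ
    (LinearMap.applyₗ ((serreSub C).mkQ (Finsupp.single [] 1))) ∘ₗ (wordRep C lam).toLinearMap

variable {C}

theorem hwFun_apply (lam : Fin r → ℚ) (x : QEA C) : hwFun C lam x =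
    (serreSub C).liftQ emptyCoeff serreSub_le_ker
      (wordRep C lam x ((serreSub C).mkQ (Finsupp.single [] 1))) := rfl

theorem hwFun_one (lam : Fin r → ℚ) : hwFun C lam 1 = 1 := by
  rw [hwFun_apply, map_one]
  simp [emptyCoeff]

theorem hwFun_mul_e (lam : Fin r → ℚ) (x : QEA C) (i : Fin r) :
    hwFun C lam (x * QEA.e C i) = 0 := by
  rw [hwFun_apply, map_mul, Module.End.mul_apply]
  have : wordRep C lam (QEA.e C i) ((serreSub C).mkQ (Finsupp.single [] 1)) = 0 := by
    rw [wordRep, QEA.lift_e]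
    change (serreSub C).mkQ (wordE C lam i (Finsupp.single [] 1)) = 0
    rw [wordE_single, wordEBasis, map_zero]
  rw [this, map_zero, map_zero]

theorem hwFun_mul_t (lam : Fin r → ℚ) (x : QEA C) (n : Fin r → ℤ) :
    hwFun C lam (x * QEA.t C n) = qwt C lam n * hwFun C lam x := by
  rw [hwFun_apply, hwFun_apply, map_mul, Module.End.mul_apply]
  have : wordRep C lam (QEA.t C n) ((serreSub C).mkQ (Finsupp.single [] 1)) =
      qwt C lam n • ((serreSub C).mkQ (Finsupp.single [] 1)) := by
    rw [wordRep, QEA.lift_t]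
    change (serreSub C).mkQ (wordT C lam n (Finsupp.single [] 1)) = _
    rw [wordT_single, wordWt, map_smul]
  rw [this, map_smul, map_smul, smul_eq_mul]

theorem hwFun_f_mul (lam : Fin r → ℚ) (i : Fin r) (x : QEA C) :
    hwFun C lam (QEA.f C i * x) = 0 := by
  rw [hwFun_apply, map_mul, Module.End.mul_apply]
  generalize wordRep C lam x ((serreSub C).mkQ (Finsupp.single [] 1)) = y
  obtain ⟨y, rfl⟩ := (serreSub C).mkQ_surjective y
  rw [wordRep, QEA.lift_f]
  exact emptyCoeff_wordF i y

theorem hwFun_t_mul (lam : Fin r → ℚ) (n : Fin r → ℤ) (x : QEA C) :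
    hwFun C lam (QEA.t C n * x) = qwt C lam n * hwFun C lam x := by
  rw [hwFun_apply, hwFun_apply, map_mul, Module.End.mul_apply]
  generalize wordRep C lam x ((serreSub C).mkQ (Finsupp.single [] 1)) = y
  obtain ⟨y, rfl⟩ := (serreSub C).mkQ_surjective y
  rw [wordRep, QEA.lift_t]
  change emptyCoeff (wordT C lam n y) = qwt C lam n * emptyCoeff y
  have : emptyCoeff ∘ₗ wordT C lam n = qwt C lam n • (emptyCoeff : Words r →ₗ[𝕜] 𝕜) := by
    refine words_ext fun w => ?_
    simp only [LinearMap.comp_apply, wordT_single, map_smul, LinearMap.smul_apply]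
    cases w with
    | nil => rfl
    | cons i w => simp [emptyCoeff]
  exact LinearMap.congr_fun this y

end HighestWeight

section TriangularDecomposition

/-- `U⁻₊ · U + U · U⁺₊`, where `U^±₊` is the kernel of the counit on `U^±`. -/
def offTorus : Submodule 𝕜 (QEA C) :=
  (Subalgebra.toSubmodule (QEA.UNeg C) ⊓ LinearMap.ker (QEA.counit C).toLinearMap) * ⊤ ⊔
    ⊤ * (Subalgebra.toSubmodule (QEA.UPos C) ⊓ LinearMap.ker (QEA.counit C).toLinearMap)

variable {C}

theorem toSub_mul_self (S : Subalgebra 𝕜 (QEA C)) :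
    Subalgebra.toSubmodule S * Subalgebra.toSubmodule S = Subalgebra.toSubmodule S :=
  Subalgebra.isIdempotentElem_toSubmodule S

theorem t_mem (n : Fin r → ℤ) : QEA.t C n ∈ QEA.U0 C := Algebra.subset_adjoin ⟨n, rfl⟩

theorem e_mem (i : Fin r) : QEA.e C i ∈ QEA.UPos C := Algebra.subset_adjoin ⟨i, rfl⟩

theorem f_mem (i : Fin r) : QEA.f C i ∈ QEA.UNeg C := Algebra.subset_adjoin ⟨i, rfl⟩

theorem hwFun_neg_mul (lam : Fin r → ℚ) {y : QEA C} (hy : y ∈ QEA.UNeg C) :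
    ∀ u, hwFun C lam (y * u) = QEA.counit C y * hwFun C lam u := by
  induction hy using Algebra.adjoin_induction with
  | mem x hx =>
    obtain ⟨i, rfl⟩ := hx
    intro u
    rw [hwFun_f_mul, QEA.counit, QEA.lift_f, zero_mul]
  | algebraMap c => intro u; rw [← Algebra.smul_def, map_smul, AlgHom.commutes]; rfl
  | add x y _ _ hx hy => intro u; rw [add_mul, map_add, hx, hy, map_add, add_mul]
  | mul x y _ _ hx hy => intro u; rw [mul_assoc, hx, hy, map_mul, mul_assoc]

theorem hwFun_mul_pos (lam : Fin r → ℚ) {x : QEA C} (hx : x ∈ QEA.UPos C) :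
    ∀ u, hwFun C lam (u * x) = QEA.counit C x * hwFun C lam u := by
  induction hx using Algebra.adjoin_induction with
  | mem x hx =>
    obtain ⟨i, rfl⟩ := hx
    intro u
    rw [hwFun_mul_e, QEA.counit, QEA.lift_e, zero_mul]
  | algebraMap c =>
    intro u; rw [← Algebra.commutes, ← Algebra.smul_def, map_smul, AlgHom.commutes]; rfl
  | add x y _ _ hx hy => intro u; rw [mul_add, map_add, hx, hy, map_add, add_mul]
  | mul x y _ _ hx hy =>
    intro u; rw [← mul_assoc, hy, hx, map_mul, mul_left_comm, mul_assoc]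

theorem hwFun_torus_mul (lam : Fin r → ℚ) {u : QEA C} (hu : u ∈ QEA.U0 C) :
    ∀ x, hwFun C lam (u * x) = hwFun C lam u * hwFun C lam x := by
  induction hu using Algebra.adjoin_induction with
  | mem x hx =>
    obtain ⟨n, rfl⟩ := hx
    intro x
    rw [hwFun_t_mul, ← mul_one (QEA.t C n), hwFun_t_mul, hwFun_one, mul_one]
  | algebraMap c =>
    intro x
    rw [← Algebra.smul_def, map_smul, Algebra.algebraMap_eq_smul_one, map_smul, hwFun_one,
      smul_eq_mul, smul_eq_mul, mul_one]
  | add x y _ _ hx hy => intro u; rw [add_mul, map_add, hx, hy, map_add, add_mul]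
  | mul x y _ _ hx hy => intro u; rw [mul_assoc, hx, hy, hx y, mul_assoc]

theorem hwFun_offTorus (lam : Fin r → ℚ) {x : QEA C} (hx : x ∈ offTorus C) :
    hwFun C lam x = 0 := by
  have : offTorus C ≤ LinearMap.ker (hwFun C lam) := by
    refine sup_le (Submodule.mul_le.2 ?_) (Submodule.mul_le.2 ?_)
    · rintro y ⟨hy, hy'⟩ u -
      rw [LinearMap.mem_ker, hwFun_neg_mul lam hy, show QEA.counit C y = 0 from hy', zero_mul]
    · rintro u - x ⟨hx, hx'⟩
      rw [LinearMap.mem_ker, hwFun_mul_pos lam hx, show QEA.counit C x = 0 from hx', zero_mul]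
  exact this hx

variable (C)

/-- `q ^ λ (t ^ n)` as a character in the variable `λ`. -/
def qwtHom (n : Fin r → ℤ) : Multiplicative (Fin r → ℚ) →* 𝕜 where
  toFun lam := qwt C lam.toAdd n
  map_one' := qwt_zero_left C n
  map_mul' _ _ := qwt_add_left C _ _ n

variable {C}

theorem qwtHom_injective : Function.Injective (qwtHom C) := by
  intro m n h
  funext i
  have h1 := DFunLike.congr_fun h (Multiplicative.ofAdd (Pi.single i 1))
  change qwt C (Pi.single i 1) m = qwt C (Pi.single i 1) n at h1
  rw [qwt_single, qwt_single] at h1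
  have h2 := qpow_injective h1
  have h3 : (C.d i : ℚ) ≠ 0 := by exact_mod_cast (C.d_pos i).ne'
  have h4 := mul_left_cancel₀ (mul_ne_zero h3 one_ne_zero) h2
  exact_mod_cast h4

theorem U0_eq_span : Subalgebra.toSubmodule (QEA.U0 C) = Submodule.span 𝕜 (Set.range (QEA.t C)) := by
  have : Set.range (QEA.t C) = (MonoidHom.mrange
      ({ toFun := fun n => QEA.t C n.toAdd, map_one' := QEA.pre.t_zero,
         map_mul' := fun m n => (QEA.pre.t_add m.toAdd n.toAdd).symm } :
        Multiplicative (Fin r → ℤ) →* QEA C) : Set (QEA C)) := rfl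
  rw [QEA.U0, Algebra.adjoin_eq_span, this, Submonoid.closure_eq]

theorem eq_zero_of_hwFun {u : QEA C} (hu : u ∈ QEA.U0 C) (h : ∀ lam, hwFun C lam u = 0) :
    u = 0 := by
  rw [← Subalgebra.mem_toSubmodule, U0_eq_span, Finsupp.mem_span_range_iff_exists_finsupp] at hu
  obtain ⟨c, rfl⟩ := hu
  have hli : LinearIndependent 𝕜 (fun n => (qwtHom C n : Multiplicative (Fin r → ℚ) → 𝕜)) :=
    (linearIndependent_monoidHom _ 𝕜).comp _ qwtHom_injective
  rw [linearIndependent_iff] at hli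
  have : c = 0 := by
    refine hli c (funext fun lam => ?_)
    have := h lam.toAdd
    rw [Finsupp.sum, map_sum] at this
    rw [Finsupp.linearCombination_apply, Finsupp.sum, Finset.sum_apply, Pi.zero_apply, ← this]
    refine Finset.sum_congr rfl fun n _ => ?_
    rw [Pi.smul_apply, map_smul, ← mul_one (QEA.t C n), hwFun_t_mul, hwFun_one, mul_one]
    rfl
  simp [this]

theorem torus_mul_neg {y u : QEA C} (hy : y ∈ QEA.UNeg C) (hu : u ∈ QEA.U0 C) :
    u * y ∈ Subalgebra.toSubmodule (QEA.UNeg C) * Subalgebra.toSubmodule (QEA.U0 C) := by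
  rw [← Subalgebra.mem_toSubmodule, U0_eq_span] at hu
  induction hu using Submodule.span_induction with
  | mem x hx =>
    obtain ⟨n, rfl⟩ := hx
    have : ∃ y' ∈ QEA.UNeg C, QEA.t C n * y = y' * QEA.t C n := by
      induction hy using Algebra.adjoin_induction with
      | mem x hx =>
        obtain ⟨i, rfl⟩ := hx
        exact ⟨qpow (-(C.d i * n i)) • QEA.f C i,
          Subalgebra.smul_mem _ (f_mem i) _,
          by rw [QEA.pre.t_f, smul_mul_assoc]⟩
      | algebraMap c => exact ⟨algebraMap _ _ c, Subalgebra.algebraMap_mem _ c,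
          (Algebra.commutes c _).symm⟩
      | add x y _ _ hx hy =>
        obtain ⟨x', hx', ex⟩ := hx
        obtain ⟨y', hy', ey⟩ := hy
        exact ⟨x' + y', add_mem hx' hy', by rw [mul_add, add_mul, ex, ey]⟩
      | mul x y _ _ hx hy =>
        obtain ⟨x', hx', ex⟩ := hx
        obtain ⟨y', hy', ey⟩ := hy
        exact ⟨x' * y', mul_mem hx' hy', by rw [← mul_assoc, ex, mul_assoc, ey, mul_assoc]⟩
    obtain ⟨y', hy', e⟩ := this
    rw [e]
    exact Submodule.mul_mem_mul hy' (t_mem n)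
  | zero => rw [zero_mul]; exact Submodule.zero_mem _
  | add a b _ _ ha hb => rw [add_mul]; exact Submodule.add_mem _ ha hb
  | smul c a _ ha => rw [smul_mul_assoc]; exact Submodule.smul_mem _ c ha

theorem e_mul_torus (i : Fin r) {u : QEA C} (hu : u ∈ QEA.U0 C) :
    ∃ u' ∈ QEA.U0 C, QEA.e C i * u = u' * QEA.e C i := by
  induction hu using Algebra.adjoin_induction with
  | mem x hx =>
    obtain ⟨n, rfl⟩ := hx
    exact ⟨qpow (-(C.d i * n i)) • QEA.t C n,
      Subalgebra.smul_mem _ (t_mem n) _,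
      by rw [QEA.pre.e_t, smul_mul_assoc]⟩
  | algebraMap c => exact ⟨algebraMap _ _ c, Subalgebra.algebraMap_mem _ c,
      (Algebra.commutes c _).symm⟩
  | add x y _ _ hx hy =>
    obtain ⟨x', hx', ex⟩ := hx
    obtain ⟨y', hy', ey⟩ := hy
    exact ⟨x' + y', add_mem hx' hy', by rw [mul_add, add_mul, ex, ey]⟩
  | mul x y _ _ hx hy =>
    obtain ⟨x', hx', ex⟩ := hx
    obtain ⟨y', hy', ey⟩ := hy
    exact ⟨x' * y', mul_mem hx' hy', by rw [← mul_assoc, ex, mul_assoc, ey, mul_assoc]⟩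

theorem e_commutator_neg (i : Fin r) {y : QEA C} (hy : y ∈ QEA.UNeg C) :
    QEA.e C i * y - y * QEA.e C i ∈
      Subalgebra.toSubmodule (QEA.UNeg C) * Subalgebra.toSubmodule (QEA.U0 C) := by
  induction hy using Algebra.adjoin_induction with
  | mem x hx =>
    obtain ⟨j, rfl⟩ := hx
    rw [QEA.pre.e_f]
    split_ifs
    · rw [← one_mul (_ • _)]
      exact Submodule.mul_mem_mul (one_mem (QEA.UNeg C)) (Subalgebra.smul_mem _
        (sub_mem (t_mem _) (t_mem _)) _)
    · exact Submodule.zero_mem _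
  | algebraMap c => rw [Algebra.commutes, sub_self]; exact Submodule.zero_mem _
  | add x y _ _ hx hy =>
    rw [mul_add, add_mul, add_sub_add_comm]; exact Submodule.add_mem _ hx hy
  | mul x y hx' hy' hx hy =>
    have e1 : QEA.e C i * (x * y) - x * y * QEA.e C i =
        (QEA.e C i * x - x * QEA.e C i) * y + x * (QEA.e C i * y - y * QEA.e C i) := by
      noncomm_ring
    rw [e1]
    refine Submodule.add_mem _ ?_ ?_
    · have h1 : ∀ z ∈ Subalgebra.toSubmodule (QEA.UNeg C) * Subalgebra.toSubmodule (QEA.U0 C),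
          z * y ∈ Subalgebra.toSubmodule (QEA.UNeg C) * Subalgebra.toSubmodule (QEA.U0 C) := by
        intro z hz
        induction hz using Submodule.mul_induction_on' with
        | mem_mul_mem a ha b hb =>
          rw [mul_assoc]
          have h2 := Submodule.mul_mem_mul ha (torus_mul_neg hy' hb)
          rwa [← mul_assoc, toSub_mul_self] at h2
        | add a _ b _ ha hb => rw [add_mul]; exact Submodule.add_mem _ ha hb
      exact h1 _ hx
    · have h2 := Submodule.mul_mem_mul (show x ∈ Subalgebra.toSubmodule (QEA.UNeg C) from hx') hy
      rwa [← mul_assoc, toSub_mul_self] at h2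

/-- `U = U⁻ U⁰ U⁺`. -/
theorem triangular_span : Subalgebra.toSubmodule (QEA.UNeg C) *
    Subalgebra.toSubmodule (QEA.U0 C) * Subalgebra.toSubmodule (QEA.UPos C) = ⊤ := by
  set N := Subalgebra.toSubmodule (QEA.UNeg C) with hN
  set Z := Subalgebra.toSubmodule (QEA.U0 C) with hZ
  set P := Subalgebra.toSubmodule (QEA.UPos C) with hP
  have hNN : N * N = N := toSub_mul_self _
  have hZZ : Z * Z = Z := toSub_mul_self _
  have hPP : P * P = P := toSub_mul_self _
  have hZN : Z * N ≤ N * Z := Submodule.mul_le.2 fun u hu y hy => torus_mul_neg hy hu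
  have key : ∀ x : QEA C, ∀ z ∈ N * Z * P, x * z ∈ N * Z * P := by
    intro x
    induction x using QEA.induction with
    | hs c => intro z hz; rw [← Algebra.smul_def]; exact Submodule.smul_mem _ c hz
    | ht n =>
      intro z hz
      have hn : QEA.t C n ∈ Z := t_mem n
      have h1 : Z * (N * Z * P) ≤ N * Z * P := by
        calc Z * (N * Z * P) = Z * N * (Z * P) := by simp only [mul_assoc]
          _ ≤ N * Z * (Z * P) := mul_le_mul_left hZN _
          _ = N * (Z * Z) * P := by simp only [mul_assoc]
          _ = N * Z * P := by rw [hZZ]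
      exact h1 (Submodule.mul_mem_mul hn hz)
    | hf i =>
      intro z hz
      have hn : QEA.f C i ∈ N := f_mem i
      have h1 := Submodule.mul_mem_mul hn hz
      rwa [← mul_assoc, ← mul_assoc, hNN] at h1
    | he i =>
      intro z hz
      have hn : QEA.e C i ∈ P := e_mem i
      induction hz using Submodule.mul_induction_on' with
      | mem_mul_mem a ha x hx =>
        induction ha using Submodule.mul_induction_on' with
        | mem_mul_mem y hy u hu =>
          obtain ⟨u', hu', eu⟩ := e_mul_torus i hu
          have e1 : QEA.e C i * (y * u * x) =
              (QEA.e C i * y - y * QEA.e C i) * u * x + y * u' * (QEA.e C i * x) := by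
            have : y * u' * (QEA.e C i * x) = y * (QEA.e C i * u) * x := by
              rw [eu]; simp only [mul_assoc]
            rw [this]; noncomm_ring
          rw [e1]
          refine Submodule.add_mem _ ?_ ?_
          · have h1 := Submodule.mul_mem_mul (Submodule.mul_mem_mul (e_commutator_neg i hy) hu) hx
            rwa [mul_assoc N Z Z, hZZ] at h1
          · have h2 := Submodule.mul_mem_mul hn hx
            rw [hPP] at h2
            exact Submodule.mul_mem_mul (Submodule.mul_mem_mul hy hu') h2
        | add a _ b _ ha hb => rw [add_mul, mul_add]; exact Submodule.add_mem _ ha hb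
      | add a _ b _ ha hb => rw [mul_add]; exact Submodule.add_mem _ ha hb
    | hadd x y hx hy => intro z hz; rw [add_mul]; exact Submodule.add_mem _ (hx z hz) (hy z hz)
    | hmul x y hx hy => intro z hz; rw [mul_assoc x y z]; exact hx _ (hy z hz)
  rw [eq_top_iff]
  intro x _
  have h1 : (1 : QEA C) ∈ N * Z * P := by
    have hN1 : (1 : QEA C) ∈ N := one_mem (QEA.UNeg C)
    have hZ1 : (1 : QEA C) ∈ Z := one_mem (QEA.U0 C)
    have hP1 : (1 : QEA C) ∈ P := one_mem (QEA.UPos C)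
    simpa using Submodule.mul_mem_mul (Submodule.mul_mem_mul hN1 hZ1) hP1
  simpa using key x 1 h1

/-- `U = U⁰ ⊕ (U⁻₊ U + U U⁺₊)`. -/
theorem isCompl_torus : IsCompl (Subalgebra.toSubmodule (QEA.U0 C)) (offTorus C) := by
  constructor
  · rw [Submodule.disjoint_def]
    exact fun u hu hu' => eq_zero_of_hwFun hu fun lam => hwFun_offTorus lam hu'
  · rw [codisjoint_iff, eq_top_iff, ← triangular_span]
    refine Submodule.mul_le.2 fun a ha x hx => ?_
    induction ha using Submodule.mul_induction_on' with
    | mem_mul_mem y hy u hu =>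
      have e1 : y * u * x = (QEA.counit C y * QEA.counit C x) • u +
          ((y - algebraMap 𝕜 _ (QEA.counit C y)) * (u * x) +
            (QEA.counit C y • u) * (x - algebraMap 𝕜 _ (QEA.counit C x))) := by
        simp only [sub_mul, mul_sub, Algebra.algebraMap_eq_smul_one, smul_mul_assoc, mul_smul_comm,
          one_mul, mul_one, smul_smul, mul_assoc, mul_comm]
        abel
      rw [e1]
      refine Submodule.add_mem_sup (Submodule.smul_mem _ _ hu) (Submodule.add_mem_sup ?_ ?_)
      · exact Submodule.mul_mem_mul ⟨sub_mem hy (Subalgebra.algebraMap_mem _ _), by simp⟩ trivial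
      · exact Submodule.mul_mem_mul trivial ⟨sub_mem hx (Subalgebra.algebraMap_mem _ _), by simp⟩
    | add a _ b _ ha hb => rw [add_mul]; exact Submodule.add_mem _ ha hb

variable (C)

/-- The projection `x ↦ (x)₀` of `U` onto `U⁰` along `U⁻₊ U + U U⁺₊`. -/
def zeroPart : QEA C →ₗ[𝕜] QEA.U0 C := Submodule.projectionOnto _ _ isCompl_torus

/-- The character `q ^ λ` of `U⁰`. -/
def qchar (lam : Fin r → ℚ) : QEA.U0 C →ₐ[𝕜] 𝕜 :=
  AlgHom.ofLinearMap (hwFun C lam ∘ₗ (QEA.U0 C).val.toLinearMap) (hwFun_one lam)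
    fun x y => hwFun_torus_mul lam x.2 y.1

/-- The element `t ^ n` of `U⁰`. -/
def torusElt (n : Fin r → ℤ) : QEA.U0 C := ⟨QEA.t C n, t_mem n⟩

variable {C}

/-- `q ^ λ` is the linear extension to `U⁰` of the character `t ^ n ↦ q ^ λ (t ^ n)`. -/
theorem qchar_torusElt (lam : Fin r → ℚ) (n : Fin r → ℤ) :
    qchar C lam (torusElt C n) = qwt C lam n := by
  change hwFun C lam (QEA.t C n) = _
  rw [← mul_one (QEA.t C n), hwFun_t_mul, hwFun_one, mul_one]

/-- `hwFun C lam` is `x ↦ q ^ λ ((x)₀)`. -/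
theorem qchar_zeroPart (lam : Fin r → ℚ) (x : QEA C) :
    qchar C lam (zeroPart C x) = hwFun C lam x := by
  have hx : x - (zeroPart C x : QEA C) ∈ offTorus C := by
    rw [← Submodule.projectionOnto_apply_eq_zero_iff isCompl_torus, map_sub]
    exact sub_eq_zero.2 (Submodule.projectionOnto_apply_left isCompl_torus _).symm
  have := hwFun_offTorus lam hx
  rw [map_sub, sub_eq_zero] at this
  exact this.symm

end TriangularDecomposition

section ShapovalovForm

/-- The linear form `x ↦ q ^ λ ((x)₀)` on `U`. -/
def hcForm (lam : Fin r → ℚ) : QEA C →ₗ[𝕜] 𝕜 := (qchar C lam).toLinearMap ∘ₗ zeroPart C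

/-- The pairing `π_λ(x, y) = q ^ λ ((σ(x) y)₀)`. -/
def piForm (lam : Fin r → ℚ) : QEA C →ₗ[𝕜] QEA C →ₗ[𝕜] 𝕜 :=
  (LinearMap.mul 𝕜 (QEA C) ∘ₗ QEA.antipode C).compr₂ (hcForm C lam)

/-- The Shapovalov form `S_λ(x, y) = q ^ λ ((ω(x) y)₀)`. -/
def shapovalov (lam : Fin r → ℚ) : QEA C →ₗ[𝕜] QEA C →ₗ[𝕜] 𝕜 :=
  (LinearMap.mul 𝕜 (QEA C) ∘ₗ QEA.omega C).compr₂ (hcForm C lam)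

/-- `K_λ = {y ∈ U⁻ | π_λ(x, y) = 0 for all x ∈ U⁺}`. -/
def KNeg (lam : Fin r → ℚ) : Submodule 𝕜 (QEA C) where
  carrier := {y | y ∈ QEA.UNeg C ∧ ∀ x ∈ QEA.UPos C, piForm C lam x y = 0}
  zero_mem' := ⟨zero_mem _, fun x _ => map_zero _⟩
  add_mem' ha hb := ⟨add_mem ha.1 hb.1, fun x hx => by rw [map_add, ha.2 x hx, hb.2 x hx, add_zero]⟩
  smul_mem' c a ha := ⟨Subalgebra.smul_mem _ ha.1 c, fun x hx => by
    rw [map_smul, ha.2 x hx, smul_zero]⟩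

/-- `K̃_λ = {x ∈ U⁺ | π_λ(x, y) = 0 for all y ∈ U⁻}`. -/
def KPos (lam : Fin r → ℚ) : Submodule 𝕜 (QEA C) where
  carrier := {x | x ∈ QEA.UPos C ∧ ∀ y ∈ QEA.UNeg C, piForm C lam x y = 0}
  zero_mem' := ⟨zero_mem _, fun y _ => by rw [map_zero, LinearMap.zero_apply]⟩
  add_mem' ha hb := ⟨add_mem ha.1 hb.1, fun y hy => by
    rw [map_add, LinearMap.add_apply, ha.2 y hy, hb.2 y hy, add_zero]⟩
  smul_mem' c a ha := ⟨Subalgebra.smul_mem _ ha.1 c, fun y hy => by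
    rw [map_smul, LinearMap.smul_apply, ha.2 y hy, smul_zero]⟩

end ShapovalovForm

section Modules

/-- The left ideal generated by the `e i` and the `t - q ^ λ (t)`. -/
def vermaIdeal (lam : Fin r → ℚ) : Submodule (QEA C) (QEA C) :=
  Submodule.span (QEA C) (Set.range (QEA.e C) ∪
    Set.range fun n => QEA.t C n - algebraMap 𝕜 (QEA C) (qwt C lam n))

/-- The Verma module `M(λ)` with highest weight `λ`. -/
abbrev Verma (lam : Fin r → ℚ) : Type := QEA C ⧸ vermaIdeal C lam

/-- The highest weight vector `1_λ` of `M(λ)`. -/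
def vermaVec (lam : Fin r → ℚ) : Verma C lam := (vermaIdeal C lam).mkQ 1

/-- The submodule `K(λ) = K_λ · 1_λ` of `M(λ)`. -/
def maxSub (lam : Fin r → ℚ) : Submodule (QEA C) (Verma C lam) :=
  Submodule.span (QEA C) ((fun y : QEA C => y • vermaVec C lam) '' (KNeg C lam : Set (QEA C)))

/-- The irreducible module `L(λ) = M(λ) / K(λ)` with highest weight `λ`. -/
abbrev Simple (lam : Fin r → ℚ) : Type := Verma C lam ⧸ maxSub C lam

/-- The image of `1_λ` in `L(λ)`. -/
def hwVec (lam : Fin r → ℚ) : Simple C lam := (maxSub C lam).mkQ (vermaVec C lam)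

/-- The action of `U` on `L(λ)`. -/
def simpleRep (lam : Fin r → ℚ) : QEA C →ₐ[𝕜] Module.End 𝕜 (Simple C lam) :=
  Algebra.lsmul 𝕜 𝕜 (Simple C lam)

variable {C}

/-- The weight space `V[μ] = {v | t v = q ^ μ (t) v for all t ∈ T}`. -/
def wtSpace {V : Type*} [AddCommMonoid V] [Module 𝕜 V] (ρ : QEA C →ₐ[𝕜] Module.End 𝕜 V)
    (mu : Fin r → ℚ) : Submodule 𝕜 V where
  carrier := {v | ∀ n, ρ (QEA.t C n) v = qwt C mu n • v}
  zero_mem' n := by rw [map_zero, smul_zero]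
  add_mem' ha hb n := by rw [map_add, ha n, hb n, smul_add]
  smul_mem' c a ha n := by rw [map_smul, ha n, smul_comm]

/-- A finite-dimensional representation is admissible if it is the sum of its weight spaces
(the sum is then direct and the weight spaces are finite-dimensional). -/
def IsAdmissible {V : Type*} [AddCommMonoid V] [Module 𝕜 V] (ρ : QEA C →ₐ[𝕜] Module.End 𝕜 V) :
    Prop := ⨆ mu, wtSpace ρ mu = ⊤

/-- The action of `U ⊗ U` on the tensor product of two representations. -/
def tensorAct {V W : Type*} [AddCommMonoid V] [Module 𝕜 V] [AddCommMonoid W] [Module 𝕜 W]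
    (ρ : QEA C →ₐ[𝕜] Module.End 𝕜 V) (τ : QEA C →ₐ[𝕜] Module.End 𝕜 W) :
    QEA C ⊗[𝕜] QEA C →ₐ[𝕜] Module.End 𝕜 (V ⊗[𝕜] W) :=
  Module.endTensorEndAlgHom.comp (Algebra.TensorProduct.map ρ τ)

/-- The tensor product of two representations of `U`, through the comultiplication. -/
def tensorRep {V W : Type*} [AddCommMonoid V] [Module 𝕜 V] [AddCommMonoid W] [Module 𝕜 W]
    (ρ : QEA C →ₐ[𝕜] Module.End 𝕜 V) (τ : QEA C →ₐ[𝕜] Module.End 𝕜 W) :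
    QEA C →ₐ[𝕜] Module.End 𝕜 (V ⊗[𝕜] W) := (tensorAct ρ τ).comp (QEA.comul C)

end Modules

section HighestWeightCoefficient

variable {C}

theorem hcForm_eq (lam : Fin r → ℚ) : hcForm C lam = hwFun C lam :=
  LinearMap.ext fun x => qchar_zeroPart lam x

theorem piForm_apply (lam : Fin r → ℚ) (x y : QEA C) :
    piForm C lam x y = hwFun C lam (QEA.antipode C x * y) := by
  rw [← hcForm_eq]; rfl

theorem antipode_mul (x y : QEA C) :
    QEA.antipode C (x * y) = QEA.antipode C y * QEA.antipode C x := by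
  change MulOpposite.unop (QEA.antipodeOp C (x * y)) = _
  rw [map_mul, MulOpposite.unop_mul]
  rfl

theorem antipode_e (i : Fin r) :
    QEA.antipode C (QEA.e C i) = -(QEA.kInv C i * QEA.e C i) := by
  change MulOpposite.unop (QEA.antipodeOp C (QEA.e C i)) = _
  rw [QEA.antipodeOp, QEA.lift_e, MulOpposite.unop_op]

theorem upos_eq_torus_mul_antipode {x : QEA C} (hx : x ∈ QEA.UPos C) (u : QEA C)
    (lam : Fin r → ℚ) (h : ∀ x ∈ QEA.UPos C, hwFun C lam (QEA.antipode C x * u) = 0) :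
    hwFun C lam (x * u) = 0 := by
  rw [QEA.UPos, ← Subalgebra.mem_toSubmodule, Algebra.adjoin_eq_span] at hx
  have key : ∀ z ∈ Submonoid.closure (Set.range (QEA.e C)), ∃ n, ∃ x' ∈ QEA.UPos C,
      z = QEA.t C n * QEA.antipode C x' := by
    intro z hz
    induction hz using Submonoid.closure_induction_left with
    | one =>
      refine ⟨0, 1, one_mem _, ?_⟩
      change 1 = _ * MulOpposite.unop (QEA.antipodeOp C 1)
      rw [QEA.pre.t_zero, map_one]; simp
    | mul_left a ha b _ ih =>
      obtain ⟨i, rfl⟩ := ha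
      obtain ⟨n, x', hx', rfl⟩ := ih
      refine ⟨n + C.kExp i, (-qpow (-(C.d i * n i))) • (x' * QEA.e C i),
        Subalgebra.smul_mem _ (mul_mem hx' (e_mem i)) _, ?_⟩
      rw [map_smul, antipode_mul, antipode_e, ← mul_assoc, QEA.pre.e_t, neg_mul, smul_neg,
        neg_smul, neg_neg, mul_smul_comm, smul_mul_assoc, ← QEA.pre.t_add, QEA.kInv]
      congr 1
      rw [mul_assoc (QEA.t C n), mul_assoc (QEA.t C n), ← mul_assoc (QEA.t C (C.kExp i)),
        ← mul_assoc (QEA.t C (C.kExp i)), QEA.pre.t_mul_neg, one_mul]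
  induction hx using Submodule.span_induction with
  | mem x hx =>
    obtain ⟨n, x', hx', rfl⟩ := key x hx
    rw [mul_assoc, hwFun_t_mul, h x' hx', mul_zero]
  | zero => rw [zero_mul, map_zero]
  | add a b _ _ ha hb => rw [add_mul, map_add, ha, hb, add_zero]
  | smul c a _ ha => rw [smul_mul_assoc, map_smul, ha, smul_zero]

theorem hwFun_mul_KNeg (lam : Fin r → ℚ) {y : QEA C} (hy : y ∈ KNeg C lam) (x : QEA C) :
    hwFun C lam (x * y) = 0 := by
  have hx : x ∈ Subalgebra.toSubmodule (QEA.UNeg C) * Subalgebra.toSubmodule (QEA.U0 C) *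
      Subalgebra.toSubmodule (QEA.UPos C) := by rw [triangular_span]; trivial
  induction hx using Submodule.mul_induction_on' with
  | mem_mul_mem a ha x hx =>
    induction ha using Submodule.mul_induction_on' with
    | mem_mul_mem b hb u hu =>
      rw [mul_assoc, mul_assoc, hwFun_neg_mul lam hb, hwFun_torus_mul lam hu,
        upos_eq_torus_mul_antipode hx y lam fun x hx => by rw [← piForm_apply]; exact hy.2 x hx,
        mul_zero, mul_zero]
    | add a _ b _ ha hb => rw [add_mul, add_mul, map_add, ha, hb, add_zero]
  | add a _ b _ ha hb => rw [add_mul, map_add, ha, hb, add_zero]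

theorem hwFun_vermaIdeal (lam : Fin r → ℚ) {x : QEA C} (hx : x ∈ vermaIdeal C lam) :
    ∀ u, hwFun C lam (u * x) = 0 := by
  induction hx using Submodule.span_induction with
  | mem x hx =>
    intro u
    rcases hx with ⟨i, rfl⟩ | ⟨n, rfl⟩
    · rw [hwFun_mul_e]
    · rw [mul_sub, map_sub, ← Algebra.commutes, ← Algebra.smul_def, map_smul, hwFun_mul_t,
        smul_eq_mul, sub_self]
  | zero => intro u; rw [mul_zero, map_zero]
  | add a b _ _ ha hb => intro u; rw [mul_add, map_add, ha, hb, add_zero]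
  | smul w a _ ha => intro u; rw [smul_eq_mul, ← mul_assoc]; exact ha _

variable (C)

/-- The form induced by `x ↦ q ^ λ ((x)₀)` on `M(λ)`. -/
def vermaCoeff (lam : Fin r → ℚ) : Verma C lam →ₗ[𝕜] 𝕜 :=
  ((vermaIdeal C lam).restrictScalars 𝕜).liftQ (hcForm C lam) (fun x hx => by
    rw [LinearMap.mem_ker, hcForm_eq, ← one_mul x]; exact hwFun_vermaIdeal lam hx 1) ∘ₗ
  (Submodule.Quotient.restrictScalarsEquiv 𝕜 (vermaIdeal C lam)).symm.toLinearMap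

variable {C}

theorem vermaCoeff_smul (lam : Fin r → ℚ) (x : QEA C) :
    vermaCoeff C lam (x • vermaVec C lam) = hwFun C lam x := by
  rw [vermaVec, ← map_smul, smul_eq_mul, mul_one, ← hcForm_eq]
  rfl

theorem exists_smul_vermaVec (lam : Fin r → ℚ) (m : Verma C lam) :
    ∃ x : QEA C, m = x • vermaVec C lam := by
  obtain ⟨x, rfl⟩ := (vermaIdeal C lam).mkQ_surjective m
  exact ⟨x, by rw [vermaVec, ← map_smul, smul_eq_mul, mul_one]⟩

theorem vermaCoeff_maxSub (lam : Fin r → ℚ) {m : Verma C lam} (hm : m ∈ maxSub C lam) :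
    ∀ u : QEA C, vermaCoeff C lam (u • m) = 0 := by
  induction hm using Submodule.span_induction with
  | mem m hm =>
    obtain ⟨y, hy, rfl⟩ := hm
    intro u
    change vermaCoeff C lam (u • y • vermaVec C lam) = 0
    rw [smul_smul, vermaCoeff_smul, hwFun_mul_KNeg lam hy]
  | zero => intro u; rw [smul_zero, map_zero]
  | add a b _ _ ha hb => intro u; rw [smul_add, map_add, ha, hb, add_zero]
  | smul w a _ ha => intro u; rw [smul_smul]; exact ha _

variable (C)

/-- The linear form on `L(λ)` that gives the coefficient of the highest weight vector: its value
at the highest weight vector is `1`, and it vanishes on the weight spaces `L(λ)[μ]`, `μ ≠ λ`. -/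
def hwCoeff (lam : Fin r → ℚ) : Simple C lam →ₗ[𝕜] 𝕜 :=
  ((maxSub C lam).restrictScalars 𝕜).liftQ (vermaCoeff C lam) (fun m hm => by
    rw [LinearMap.mem_ker, ← one_smul (QEA C) m]; exact vermaCoeff_maxSub lam hm 1) ∘ₗ
  (Submodule.Quotient.restrictScalarsEquiv 𝕜 (maxSub C lam)).symm.toLinearMap

variable {C}

theorem hwCoeff_smul (lam : Fin r → ℚ) (x : QEA C) :
    hwCoeff C lam (x • hwVec C lam) = hwFun C lam x := by
  rw [hwVec, ← map_smul, ← vermaCoeff_smul]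
  rfl

theorem hwCoeff_hwVec (lam : Fin r → ℚ) : hwCoeff C lam (hwVec C lam) = 1 := by
  rw [← one_smul (QEA C) (hwVec C lam), hwCoeff_smul, hwFun_one]

theorem exists_smul_hwVec (lam : Fin r → ℚ) (m : Simple C lam) :
    ∃ x : QEA C, m = x • hwVec C lam := by
  obtain ⟨m, rfl⟩ := (maxSub C lam).mkQ_surjective m
  obtain ⟨x, rfl⟩ := exists_smul_vermaVec lam m
  exact ⟨x, by rw [hwVec, ← map_smul]⟩

theorem qwt_injective {lam mu : Fin r → ℚ} (h : ∀ n, qwt C lam n = qwt C mu n) : lam = mu := by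
  funext i
  have h1 := qpow_injective (h (Pi.single i 1))
  rw [Finset.sum_eq_single i (by intro j _ hj; simp [hj]) (by simp),
    Finset.sum_eq_single i (by intro j _ hj; simp [hj]) (by simp)] at h1
  have h3 : (C.d i : ℚ) ≠ 0 := by exact_mod_cast (C.d_pos i).ne'
  simpa [h3] using h1

theorem hwCoeff_wtSpace {lam mu : Fin r → ℚ} (hmu : mu ≠ lam) {m : Simple C lam}
    (hm : m ∈ wtSpace (simpleRep C lam) mu) : hwCoeff C lam m = 0 := by
  by_contra h0
  refine hmu (qwt_injective (C := C) fun n => ?_)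
  have h1 : QEA.t C n • m = qwt C mu n • m := hm n
  obtain ⟨x, rfl⟩ := exists_smul_hwVec lam m
  have h2 := congrArg (hwCoeff C lam) h1
  rw [smul_smul, hwCoeff_smul, hwFun_t_mul, ← hwCoeff_smul, (hwCoeff C lam).map_smul,
    smul_eq_mul] at h2
  exact (mul_right_cancel₀ h0 h2).symm

end HighestWeightCoefficient

section RegularFunctions

/-- The left regular action of `U` on `U*`: `(a f)(x) = f (x a)`. -/
def leftReg : QEA C →ₐ[𝕜] Module.End 𝕜 (Module.Dual 𝕜 (QEA C)) where
  toFun a := (LinearMap.mulRight 𝕜 a).dualMap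
  map_one' := by ext f x; simp
  map_mul' a b := by ext f x; simp [LinearMap.dualMap_apply, mul_assoc]
  map_zero' := by ext f x; simp [LinearMap.dualMap_apply]
  map_add' a b := by ext f x; simp [LinearMap.dualMap_apply, mul_add]
  commutes' c := by
    ext f x
    simp [LinearMap.dualMap_apply, ← Algebra.commutes c x, ← Algebra.smul_def]

/-- The product of `U*` dual to the comultiplication: `(f g)(x) = (f ⊗ g)(Δ x)`. -/
def dualMul : Module.Dual 𝕜 (QEA C) →ₗ[𝕜] Module.Dual 𝕜 (QEA C) →ₗ[𝕜] Module.Dual 𝕜 (QEA C) :=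
  LinearMap.mk₂ 𝕜 (fun f g => LinearMap.mul' 𝕜 𝕜 ∘ₗ TensorProduct.map f g ∘ₗ
    (QEA.comul C).toLinearMap)
    (fun f f' g => by ext x; simp [TensorProduct.map_add_left])
    (fun c f g => by ext x; simp [TensorProduct.map_smul_left])
    (fun f g g' => by ext x; simp [TensorProduct.map_add_right])
    (fun c f g => by ext x; simp [TensorProduct.map_smul_right])

/-- The algebra `F` of quantized regular functions, the subspace of `U*` spanned by the matrix
elements of the finite-dimensional admissible representations. -/
def RegFun : Submodule 𝕜 (Module.Dual 𝕜 (QEA C)) :=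
  Submodule.span 𝕜 {φ | ∃ (n : ℕ) (ρ : QEA C →ₐ[𝕜] Module.End 𝕜 (Fin n → 𝕜)), IsAdmissible ρ ∧
    ∃ (v : Fin n → 𝕜) (ξ : Module.Dual 𝕜 (Fin n → 𝕜)), ∀ x, φ x = ξ (ρ x v)}

variable {C}

theorem leftReg_apply (a : QEA C) (φ : Module.Dual 𝕜 (QEA C)) (x : QEA C) :
    leftReg C a φ x = φ (x * a) := rfl

theorem tensorAct_tmul {V W : Type*} [AddCommMonoid V] [Module 𝕜 V] [AddCommMonoid W] [Module 𝕜 W]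
    (ρ : QEA C →ₐ[𝕜] Module.End 𝕜 V) (τ : QEA C →ₐ[𝕜] Module.End 𝕜 W) (x y : QEA C) :
    tensorAct ρ τ (x ⊗ₜ y) = TensorProduct.map (ρ x) (τ y) := rfl

theorem IsAdmissible.tensorRep {V W : Type*} [AddCommMonoid V] [Module 𝕜 V] [AddCommMonoid W]
    [Module 𝕜 W] {ρ : QEA C →ₐ[𝕜] Module.End 𝕜 V} {τ : QEA C →ₐ[𝕜] Module.End 𝕜 W}
    (hρ : IsAdmissible ρ) (hτ : IsAdmissible τ) : IsAdmissible (tensorRep ρ τ) := by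
  rw [IsAdmissible, eq_top_iff]
  have key : ∀ v w, v ⊗ₜ[𝕜] w ∈ ⨆ mu, wtSpace (StarProduct.tensorRep ρ τ) mu := by
    intro v w
    have hv : v ∈ ⨆ mu, wtSpace ρ mu := hρ ▸ Submodule.mem_top
    have hw : w ∈ ⨆ mu, wtSpace τ mu := hτ ▸ Submodule.mem_top
    induction hv using Submodule.iSup_induction' with
    | mem mu v hv =>
      induction hw using Submodule.iSup_induction' with
      | mem nu w hw =>
        refine Submodule.mem_iSup_of_mem (mu + nu) fun n => ?_
        have : StarProduct.tensorRep ρ τ (QEA.t C n) = StarProduct.tensorAct ρ τ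
            (QEA.t C n ⊗ₜ QEA.t C n) := by
          rw [StarProduct.tensorRep, AlgHom.comp_apply, QEA.comul, QEA.lift_t]
        rw [this]
        rw [tensorAct_tmul, TensorProduct.map_tmul, hv n, hw n, TensorProduct.smul_tmul_smul, qwt_add_left]
      | zero => rw [TensorProduct.tmul_zero]; exact Submodule.zero_mem _
      | add a b _ _ ha hb => rw [TensorProduct.tmul_add]; exact Submodule.add_mem _ ha hb
    | zero => rw [TensorProduct.zero_tmul]; exact Submodule.zero_mem _
    | add a b _ _ ha hb => rw [TensorProduct.add_tmul]; exact Submodule.add_mem _ ha hb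
  intro z _
  induction z with
  | zero => exact Submodule.zero_mem _
  | tmul v w => exact key v w
  | add a b ha hb => exact Submodule.add_mem _ (ha trivial) (hb trivial)

theorem mem_RegFun {V : Type*} [AddCommGroup V] [Module 𝕜 V] [FiniteDimensional 𝕜 V]
    {ρ : QEA C →ₐ[𝕜] Module.End 𝕜 V} (hρ : IsAdmissible ρ) (v : V) (ξ : Module.Dual 𝕜 V)
    {φ : Module.Dual 𝕜 (QEA C)} (h : ∀ x, φ x = ξ (ρ x v)) : φ ∈ RegFun C := by
  let b := (Module.finBasis 𝕜 V).equivFun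
  refine Submodule.subset_span ⟨Module.finrank 𝕜 V, (b.conjAlgEquiv 𝕜).toAlgHom.comp ρ, ?_, b v,
    ξ ∘ₗ b.symm.toLinearMap, fun x => ?_⟩
  · rw [IsAdmissible, eq_top_iff]
    intro w _
    have hw : b.symm w ∈ ⨆ mu, wtSpace ρ mu := hρ ▸ Submodule.mem_top
    have h1 : ⨆ mu, wtSpace ρ mu ≤ (⨆ mu, wtSpace ((b.conjAlgEquiv 𝕜).toAlgHom.comp ρ) mu).comap
        b.toLinearMap := by
      refine iSup_le fun mu => le_trans ?_ (Submodule.comap_mono (le_iSup _ mu))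
      intro v hv n
      have := congrArg b (hv n)
      rw [map_smul] at this
      simpa [LinearEquiv.conjAlgEquiv_apply] using this
    simpa using h1 hw
  · rw [h x]
    simp [LinearEquiv.conjAlgEquiv_apply]

theorem leftReg_mem (a : QEA C) {φ : Module.Dual 𝕜 (QEA C)} (hφ : φ ∈ RegFun C) :
    leftReg C a φ ∈ RegFun C := by
  induction hφ using Submodule.span_induction with
  | mem φ hφ =>
    obtain ⟨n, ρ, hρ, v, ξ, h⟩ := hφ
    exact mem_RegFun hρ (ρ a v) ξ fun x => by
      rw [leftReg_apply, h, map_mul, Module.End.mul_apply]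
  | zero => rw [map_zero]; exact Submodule.zero_mem _
  | add φ ψ _ _ h1 h2 => rw [map_add]; exact Submodule.add_mem _ h1 h2
  | smul c φ _ h => rw [map_smul]; exact Submodule.smul_mem _ c h

theorem dualMul_apply (φ ψ : Module.Dual 𝕜 (QEA C)) (x : QEA C) :
    dualMul C φ ψ x = LinearMap.mul' 𝕜 𝕜 (TensorProduct.map φ ψ (QEA.comul C x)) := rfl

theorem dualMul_mem {φ ψ : Module.Dual 𝕜 (QEA C)} (hφ : φ ∈ RegFun C) (hψ : ψ ∈ RegFun C) :
    dualMul C φ ψ ∈ RegFun C := by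
  induction hφ using Submodule.span_induction with
  | mem φ hφ =>
    induction hψ using Submodule.span_induction with
    | mem ψ hψ =>
      obtain ⟨n, ρ, hρ, v, ξ, h⟩ := hφ
      obtain ⟨m, τ, hτ, w, η, h'⟩ := hψ
      refine mem_RegFun (hρ.tensorRep hτ) (v ⊗ₜ w) (LinearMap.mul' 𝕜 𝕜 ∘ₗ TensorProduct.map ξ η)
        fun x => ?_
      rw [dualMul_apply, tensorRep, AlgHom.comp_apply]
      generalize QEA.comul C x = z
      induction z with
      | zero => simp
      | tmul x y =>
        rw [TensorProduct.map_tmul, LinearMap.mul'_apply, h, h', tensorAct_tmul,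
          LinearMap.comp_apply, TensorProduct.map_tmul, TensorProduct.map_tmul,
          LinearMap.mul'_apply]
      | add a b ha hb => simp only [map_add, LinearMap.add_apply, ha, hb]
    | zero => rw [map_zero]; exact Submodule.zero_mem _
    | add a b _ _ h1 h2 => rw [map_add]; exact Submodule.add_mem _ h1 h2
    | smul c a _ h => rw [map_smul]; exact Submodule.smul_mem _ c h
  | zero => rw [map_zero, LinearMap.zero_apply]; exact Submodule.zero_mem _
  | add a b _ _ h1 h2 => rw [map_add, LinearMap.add_apply]; exact Submodule.add_mem _ h1 h2
  | smul c a _ h => rw [map_smul, LinearMap.smul_apply]; exact Submodule.smul_mem _ c h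

variable (C)

/-- The left regular action of `U` on `F`. -/
def regRep : QEA C →ₐ[𝕜] Module.End 𝕜 (RegFun C) where
  toFun a := (leftReg C a).restrict fun _ h => leftReg_mem a h
  map_one' := by ext φ x; simp
  map_mul' a b := by ext φ x; simp [leftReg_apply]
  map_zero' := by ext φ x; simp
  map_add' a b := by ext φ x; simp
  commutes' c := by ext φ x; simp

/-- The multiplication of `F`, as a map `μ : F ⊗ F → F`. -/
def regMul : RegFun C ⊗[𝕜] RegFun C →ₗ[𝕜] RegFun C :=
  TensorProduct.lift (LinearMap.mk₂ 𝕜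
    (fun φ ψ => ⟨dualMul C φ.1 ψ.1, dualMul_mem φ.2 ψ.2⟩)
    (fun φ φ' ψ => Subtype.ext (by simp))
    (fun c φ ψ => Subtype.ext (by simp))
    (fun φ ψ ψ' => Subtype.ext (by simp))
    (fun c φ ψ => Subtype.ext (by simp)))

end RegularFunctions

section Convolution

variable {C}

/-- The space `Hom_U(V, W)`. -/
def HomU {V W : Type*} [AddCommMonoid V] [Module 𝕜 V] [AddCommMonoid W] [Module 𝕜 W]
    (ρ : QEA C →ₐ[𝕜] Module.End 𝕜 V) (τ : QEA C →ₐ[𝕜] Module.End 𝕜 W) :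
    Submodule 𝕜 (V →ₗ[𝕜] W) where
  carrier := {φ | ∀ x v, φ (ρ x v) = τ x (φ v)}
  zero_mem' x v := by simp
  add_mem' ha hb x v := by rw [LinearMap.add_apply, ha, hb, LinearMap.add_apply, map_add]
  smul_mem' c a ha x v := by rw [LinearMap.smul_apply, ha, LinearMap.smul_apply, map_smul]

section Tensor

variable {V W X : Type*} [AddCommMonoid V] [Module 𝕜 V] [AddCommMonoid W] [Module 𝕜 W]
  [AddCommMonoid X] [Module 𝕜 X] {ρ : QEA C →ₐ[𝕜] Module.End 𝕜 V}
  {τ : QEA C →ₐ[𝕜] Module.End 𝕜 W} {κ : QEA C →ₐ[𝕜] Module.End 𝕜 X}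

theorem rTensor_mem_HomU {φ : V →ₗ[𝕜] W} (h : φ ∈ HomU ρ τ) :
    φ.rTensor X ∈ HomU (tensorRep ρ κ) (tensorRep τ κ) := by
  intro u z
  rw [tensorRep, tensorRep, AlgHom.comp_apply, AlgHom.comp_apply]
  generalize QEA.comul C u = w
  induction w with
  | zero => simp
  | add a b ha hb => rw [map_add, map_add, LinearMap.add_apply, LinearMap.add_apply, map_add, ha, hb]
  | tmul x y =>
    induction z with
    | zero => simp
    | add a b ha hb => simp only [map_add, ha, hb]
    | tmul v w =>
      simp only [tensorAct_tmul, TensorProduct.map_tmul, LinearMap.rTensor_tmul, h x v]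

theorem lTensor_mem_HomU {φ : V →ₗ[𝕜] W} (h : φ ∈ HomU ρ τ) :
    φ.lTensor X ∈ HomU (tensorRep κ ρ) (tensorRep κ τ) := by
  intro u z
  rw [tensorRep, tensorRep, AlgHom.comp_apply, AlgHom.comp_apply]
  generalize QEA.comul C u = w
  induction w with
  | zero => simp
  | add a b ha hb => rw [map_add, map_add, LinearMap.add_apply, LinearMap.add_apply, map_add, ha, hb]
  | tmul x y =>
    induction z with
    | zero => simp
    | add a b ha hb => simp only [map_add, ha, hb]
    | tmul v w =>
      simp only [tensorAct_tmul, TensorProduct.map_tmul, LinearMap.lTensor_tmul, h y w]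

theorem tensorRep_t (n : Fin r → ℤ) : tensorRep ρ τ (QEA.t C n) =
    TensorProduct.map (ρ (QEA.t C n)) (τ (QEA.t C n)) := by
  rw [tensorRep, AlgHom.comp_apply, QEA.comul, QEA.lift_t, tensorAct_tmul]

theorem tensorRep_e (i : Fin r) : tensorRep ρ τ (QEA.e C i) =
    TensorProduct.map (ρ (QEA.e C i)) 1 + TensorProduct.map (ρ (QEA.k C i)) (τ (QEA.e C i)) := by
  rw [tensorRep, AlgHom.comp_apply, QEA.comul, QEA.lift_e, map_add, tensorAct_tmul, tensorAct_tmul,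
    map_one]

theorem tensorRep_f (i : Fin r) : tensorRep ρ τ (QEA.f C i) =
    TensorProduct.map (ρ (QEA.f C i)) (τ (QEA.kInv C i)) +
      TensorProduct.map 1 (τ (QEA.f C i)) := by
  rw [tensorRep, AlgHom.comp_apply, QEA.comul, QEA.lift_f, map_add, tensorAct_tmul, tensorAct_tmul,
    map_one]

theorem assoc_mem_HomU : (TensorProduct.assoc 𝕜 V W X).toLinearMap ∈
    HomU (tensorRep (tensorRep ρ τ) κ) (tensorRep ρ (tensorRep τ κ)) := by
  intro u
  induction u using QEA.induction with
  | hs c => intro z; simp only [AlgHom.commutes, Module.algebraMap_end_apply, map_smul]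
  | hadd x y hx hy => intro z; simp only [map_add, LinearMap.add_apply, hx, hy]
  | hmul x y hx hy => intro z; simp only [map_mul, Module.End.mul_apply, hx, hy]
  | ht n =>
    have h : (TensorProduct.assoc 𝕜 V W X).toLinearMap ∘ₗ
        tensorRep (tensorRep ρ τ) κ (QEA.t C n) =
        tensorRep ρ (tensorRep τ κ) (QEA.t C n) ∘ₗ
          (TensorProduct.assoc 𝕜 V W X).toLinearMap :=
      TensorProduct.ext_threefold fun v w x => by simp [tensorRep_t]
    exact LinearMap.congr_fun h
  | he i =>
    have h : (TensorProduct.assoc 𝕜 V W X).toLinearMap ∘ₗ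
        tensorRep (tensorRep ρ τ) κ (QEA.e C i) =
        tensorRep ρ (tensorRep τ κ) (QEA.e C i) ∘ₗ
          (TensorProduct.assoc 𝕜 V W X).toLinearMap :=
      TensorProduct.ext_threefold fun v w x => by simp [tensorRep_e, tensorRep_t, QEA.k,
        TensorProduct.tmul_add, TensorProduct.add_tmul, add_assoc]
    exact LinearMap.congr_fun h
  | hf i =>
    have h : (TensorProduct.assoc 𝕜 V W X).toLinearMap ∘ₗ
        tensorRep (tensorRep ρ τ) κ (QEA.f C i) =
        tensorRep ρ (tensorRep τ κ) (QEA.f C i) ∘ₗ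
          (TensorProduct.assoc 𝕜 V W X).toLinearMap :=
      TensorProduct.ext_threefold fun v w x => by simp [tensorRep_f, tensorRep_t, QEA.kInv,
        TensorProduct.tmul_add, TensorProduct.add_tmul, add_assoc]
    exact LinearMap.congr_fun h

end Tensor

theorem regMul_tensorAct_apply (w : QEA C ⊗[𝕜] QEA C) (φ ψ : RegFun C) (a : QEA C) :
    (regMul C (tensorAct (regRep C) (regRep C) w (φ ⊗ₜ ψ))).1 a =
      LinearMap.mul' 𝕜 𝕜 (TensorProduct.map φ.1 ψ.1 (QEA.comul C a * w)) := by
  induction w with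
  | zero => simp
  | add w w' h h' =>
    rw [map_add, LinearMap.add_apply, map_add, mul_add, map_add, map_add, ← h, ← h']
    rfl
  | tmul x y =>
    rw [tensorAct_tmul, TensorProduct.map_tmul]
    change dualMul C (regRep C x φ).1 (regRep C y ψ).1 a = _
    rw [dualMul_apply]
    generalize QEA.comul C a = z
    induction z with
    | zero => simp
    | add z z' h h' => rw [add_mul, map_add, map_add, map_add, map_add, h, h']
    | tmul b c =>
      rw [Algebra.TensorProduct.tmul_mul_tmul, TensorProduct.map_tmul, TensorProduct.map_tmul]
      rfl

theorem regMul_mem_HomU : regMul C ∈ HomU (tensorRep (regRep C) (regRep C)) (regRep C) := by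
  intro u z
  induction z with
  | zero => simp
  | add a b ha hb => simp only [map_add, ha, hb]
  | tmul φ ψ =>
    refine Subtype.ext (LinearMap.ext fun x => ?_)
    rw [tensorRep, AlgHom.comp_apply, regMul_tensorAct_apply, ← map_mul]
    rfl

/-- The product `φ * ψ = (id ⊗ μ) ∘ (φ ⊗ id) ∘ ψ` on `Hom_U(V, V ⊗ F)`. -/
def conv {V : Type*} [AddCommMonoid V] [Module 𝕜 V] {ρ : QEA C →ₐ[𝕜] Module.End 𝕜 V}
    (φ ψ : HomU ρ (tensorRep ρ (regRep C))) : HomU ρ (tensorRep ρ (regRep C)) :=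
  ⟨(regMul C).lTensor V ∘ₗ (TensorProduct.assoc 𝕜 V (RegFun C) (RegFun C)).toLinearMap ∘ₗ
    φ.1.rTensor (RegFun C) ∘ₗ ψ.1, fun u v => by
      simp only [LinearMap.comp_apply]
      rw [ψ.2 u v, rTensor_mem_HomU φ.2 u, assoc_mem_HomU u, lTensor_mem_HomU regMul_mem_HomU u]⟩

end Convolution

section StarProduct

/-- The map `Θ : Hom_U(L(λ), L(λ) ⊗ F) → F`, `φ ↦ f_φ`, where
`φ(1̄_λ) = 1̄_λ ⊗ f_φ + ∑ v_μ ⊗ f_μ` with `v_μ` of weight `μ < λ`. -/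
def Theta (lam : Fin r → ℚ) :
    HomU (simpleRep C lam) (tensorRep (simpleRep C lam) (regRep C)) →ₗ[𝕜] RegFun C :=
  (TensorProduct.lid 𝕜 (RegFun C)).toLinearMap ∘ₗ (hwCoeff C lam).rTensor (RegFun C) ∘ₗ
    LinearMap.applyₗ (hwVec C lam) ∘ₗ Submodule.subtype _

variable {C}

/-- `Θ` reads off the coefficient of `1̄_λ`. -/
theorem Theta_eq (lam : Fin r → ℚ)
    (φ : HomU (simpleRep C lam) (tensorRep (simpleRep C lam) (regRep C))) (f : RegFun C)
    {ι : Type*} (s : Finset ι) (mu : ι → Fin r → ℚ) (v : ι → Simple C lam) (g : ι → RegFun C)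
    (hmu : ∀ i ∈ s, mu i ≠ lam) (hv : ∀ i ∈ s, v i ∈ wtSpace (simpleRep C lam) (mu i))
    (h : φ.1 (hwVec C lam) = hwVec C lam ⊗ₜ f + ∑ i ∈ s, v i ⊗ₜ g i) : Theta C lam φ = f := by
  change TensorProduct.lid 𝕜 (RegFun C)
    ((hwCoeff C lam).rTensor (RegFun C) (φ.1 (hwVec C lam))) = f
  rw [h, map_add, map_add, LinearMap.rTensor_tmul, hwCoeff_hwVec, TensorProduct.lid_tmul, one_smul,
    map_sum, map_sum, Finset.sum_eq_zero, add_zero]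
  intro i hi
  rw [LinearMap.rTensor_tmul, hwCoeff_wtSpace (hmu i hi) (hv i hi), TensorProduct.lid_tmul,
    zero_smul]

variable (C)

/-- The space `F[0]^{K_λ + K̃_λ}`: the elements of weight `0` in `F` that are annihilated by
`K_λ` and by `K̃_λ` for the left regular action. -/
def invSub (lam : Fin r → ℚ) : Submodule 𝕜 (RegFun C) where
  carrier := {f | f ∈ wtSpace (regRep C) 0 ∧ (∀ y ∈ KNeg C lam, regRep C y f = 0) ∧
    ∀ x ∈ KPos C lam, regRep C x f = 0}
  zero_mem' := ⟨zero_mem _, fun _ _ => map_zero _, fun _ _ => map_zero _⟩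
  add_mem' ha hb := ⟨add_mem ha.1 hb.1,
    fun y hy => by rw [map_add, ha.2.1 y hy, hb.2.1 y hy, add_zero],
    fun x hx => by rw [map_add, ha.2.2 x hx, hb.2.2 x hx, add_zero]⟩
  smul_mem' c a ha := ⟨Submodule.smul_mem _ c ha.1,
    fun y hy => by rw [map_smul, ha.2.1 y hy, smul_zero],
    fun x hx => by rw [map_smul, ha.2.2 x hx, smul_zero]⟩

/-- The star product `f₁ ⋆_λ f₂ = Θ(Θ⁻¹(f₁) * Θ⁻¹(f₂))`; it is meaningful on the image of `Θ`. -/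
def star (lam : Fin r → ℚ) (f₁ f₂ : RegFun C) : RegFun C :=
  Theta C lam (conv (Function.invFun (Theta C lam) f₁) (Function.invFun (Theta C lam) f₂))

/-- For each `β = ∑ j, β j • α j` in `Q₊`, elements `y β i` of weight `-β` in `U⁻` such that the
vectors `y β i · 1̄_λ` form a basis of `L(λ)[λ - β]`. -/
structure WeightBases (lam : Fin r → ℚ) (ι : (Fin r → ℕ) → Type*) where
  y : ∀ β, ι β → QEA C
  mem_UNeg : ∀ β i, y β i ∈ QEA.UNeg C
  weight : ∀ β i n,
    QEA.t C n * y β i * QEA.t C (-n) = qwt C (fun j => -(β j : ℚ)) n • y β i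
  linearIndependent : ∀ β, LinearIndependent 𝕜 fun i => y β i • hwVec C lam
  span_eq : ∀ β, Submodule.span 𝕜 (Set.range fun i => y β i • hwVec C lam) =
    wtSpace (simpleRep C lam) fun j => lam j - β j

variable {C}

/-- The matrix, in the basis `y β i · 1̄_λ`, of the form induced by the Shapovalov form on
`L(λ)[λ - β]`. -/
def WeightBases.shapMatrix {lam : Fin r → ℚ} {ι : (Fin r → ℕ) → Type*}
    (B : WeightBases C lam ι) (β : Fin r → ℕ) : Matrix (ι β) (ι β) 𝕜 :=
  Matrix.of fun i j => shapovalov C lam (B.y β i) (B.y β j)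

/-- The component `∑ i j, (S̄^β)⁻¹ i j • y β i ⊗ θ(y β j)` of the reduced fusion element
`J^red(λ) = ∑ β, ∑ i j, (S̄^β)⁻¹ i j • y β i ⊗ θ(y β j)`. -/
def WeightBases.Jred {lam : Fin r → ℚ} {ι : (Fin r → ℕ) → Type*} [∀ β, Fintype (ι β)]
    [∀ β, DecidableEq (ι β)] (B : WeightBases C lam ι) (β : Fin r → ℕ) :
    QEA C ⊗[𝕜] QEA C :=
  ∑ i, ∑ j, (B.shapMatrix β)⁻¹ i j • (B.y β i ⊗ₜ QEA.theta C (B.y β j))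

end StarProduct
end Algebra

end StarProduct

end

/-!
Write `L` for `L(λ)`, `ξ` for the functional `hwCoeff` on `L`, and let `U` act on `L ⊗ W` through the
comultiplication. A homomorphism `L → L ⊗ F` is determined by the image `w` of `1̄_λ`, a vector of
weight `λ` killed by the `e i`, and `Θ` reads off `f = (ξ ⊗ id) w`.

* If the `e i` kill `w`, then `(id ⊗ x) w = (σ(x) ⊗ id) w` for `x ∈ U⁺` (`contract_antipode`), so that
  `x f = (ξ σ(x) ⊗ id) w`. The functionals `ξ σ(x)` separate the points of `L`, by the very
  definition of `K_λ`; hence `f` determines `w`, and `K̃_λ`, which consists of the `x` with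
  `ξ σ(x) = 0`, kills `f`. Since `ξ` is invariant under `U⁻` up to the counit, `y ∈ U⁻` satisfies
  `(ξ ⊗ id)(y w) = y f`, and so `K_λ` kills `f` too.
* Conversely, let `f` be invariant. The Shapovalov form is symmetric, because `ω` is an involutive
  antiautomorphism compatible with `x ↦ (x)₀`. Therefore `θ(K_λ) ⊆ K̃_λ`, the matrices `S̄^β` are
  invertible, and the vector `w = ∑ (S̄^β)⁻¹ i j • y β i 1̄_λ ⊗ θ(y β j) f` satisfies
  `(ξ σ(x) ⊗ id) w = x f` for all `x ∈ U⁺`, which makes it a highest weight vector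
  (`sum_component`). The sum is finite because `f` is a sum of matrix elements of
  finite-dimensional modules, which have finitely many weights.
  The assignment `x 1̄_λ ↦ x w` is well defined: if `x 1̄_λ = 0`, then `(ξ ⊗ id)(u x w) ∈ K_λ f = 0`
  for all `u ∈ U`, and a vector `z` with `(ξ ⊗ id)(U z) = 0` vanishes
  (`eq_zero_of_contract_tensorRep`).
* In `Θ(φ * ψ)` the vector `ψ(1̄_λ)` is this explicit `w` for `f₂`, and
  `(ξ ⊗ id) φ(y β i 1̄_λ) = y β i f₁`; the result is the formula with `J^red(λ)`.
-/

open scoped TensorProduct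
noncomputable section
namespace StarProduct

local notation "𝕜" => GroundField

variable {r : ℕ} {C : CartanDatum r}

/-! ### The automorphism `θ`, the antiautomorphism `ω` and the symmetry of the Shapovalov form -/

theorem antipode_one : QEA.antipode C 1 = 1 := by
  change MulOpposite.unop (QEA.antipodeOp C 1) = 1
  rw [map_one, MulOpposite.unop_one]

theorem antipode_t (n : Fin r → ℤ) : QEA.antipode C (QEA.t C n) = QEA.t C (-n) := by
  change MulOpposite.unop (QEA.antipodeOp C (QEA.t C n)) = _
  rw [QEA.antipodeOp, QEA.lift_t, MulOpposite.unop_op]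

theorem antipode_f (i : Fin r) :
    QEA.antipode C (QEA.f C i) = -(QEA.f C i * QEA.k C i) := by
  change MulOpposite.unop (QEA.antipodeOp C (QEA.f C i)) = _
  rw [QEA.antipodeOp, QEA.lift_f, MulOpposite.unop_op]

theorem theta_t (n : Fin r → ℤ) : QEA.theta C (QEA.t C n) = QEA.t C (-n) := by
  rw [QEA.theta, QEA.lift_t]

theorem theta_e (i : Fin r) : QEA.theta C (QEA.e C i) = -QEA.f C i := by
  rw [QEA.theta, QEA.lift_e]

theorem theta_f (i : Fin r) : QEA.theta C (QEA.f C i) = -QEA.e C i := by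
  rw [QEA.theta, QEA.lift_f]

theorem theta_theta (x : QEA C) : QEA.theta C (QEA.theta C x) = x := by
  induction x using QEA.induction with
  | hs c => rw [AlgHom.commutes, AlgHom.commutes]
  | ht n => rw [theta_t, theta_t, neg_neg]
  | he i => rw [theta_e, map_neg, theta_f, neg_neg]
  | hf i => rw [theta_f, map_neg, theta_e, neg_neg]
  | hadd x y hx hy => rw [map_add, map_add, hx, hy]
  | hmul x y hx hy => rw [map_mul, map_mul, hx, hy]

theorem theta_mem_UPos {y : QEA C} (hy : y ∈ QEA.UNeg C) : QEA.theta C y ∈ QEA.UPos C := by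
  have h : QEA.UNeg C ≤ (QEA.UPos C).comap (QEA.theta C) := by
    refine Algebra.adjoin_le ?_
    rintro _ ⟨i, rfl⟩
    change QEA.theta C _ ∈ QEA.UPos C
    rw [theta_f]
    exact neg_mem (e_mem i)
  exact h hy

theorem theta_mem_UNeg {x : QEA C} (hx : x ∈ QEA.UPos C) : QEA.theta C x ∈ QEA.UNeg C := by
  have h : QEA.UPos C ≤ (QEA.UNeg C).comap (QEA.theta C) := by
    refine Algebra.adjoin_le ?_
    rintro _ ⟨i, rfl⟩
    change QEA.theta C _ ∈ QEA.UNeg C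
    rw [theta_e]
    exact neg_mem (f_mem i)
  exact h hx

theorem omega_apply (x : QEA C) : QEA.omega C x = QEA.antipode C (QEA.theta C x) := rfl

theorem omega_mul (x y : QEA C) :
    QEA.omega C (x * y) = QEA.omega C y * QEA.omega C x := by
  rw [omega_apply, map_mul, antipode_mul, ← omega_apply, ← omega_apply]

theorem omega_one : QEA.omega C 1 = 1 := by
  rw [omega_apply, map_one, antipode_one]

theorem omega_t (n : Fin r → ℤ) : QEA.omega C (QEA.t C n) = QEA.t C n := by
  rw [omega_apply, theta_t, antipode_t, neg_neg]

theorem omega_e (i : Fin r) : QEA.omega C (QEA.e C i) = QEA.f C i * QEA.k C i := by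
  rw [omega_apply, theta_e, map_neg, antipode_f, neg_neg]

theorem omega_f (i : Fin r) : QEA.omega C (QEA.f C i) = QEA.kInv C i * QEA.e C i := by
  rw [omega_apply, theta_f, map_neg, antipode_e, neg_neg]

theorem omega_algebraMap (c : 𝕜) :
    QEA.omega C (algebraMap 𝕜 _ c) = algebraMap 𝕜 (QEA C) c := by
  rw [Algebra.algebraMap_eq_smul_one, map_smul, omega_one]

theorem omega_omega (x : QEA C) : QEA.omega C (QEA.omega C x) = x := by
  induction x using QEA.induction with
  | hs c => rw [omega_algebraMap, omega_algebraMap]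
  | ht n => rw [omega_t, omega_t]
  | he i =>
    rw [omega_e, omega_mul, omega_f, QEA.k, omega_t, ← mul_assoc, QEA.kInv, QEA.pre.t_mul_neg,
      one_mul]
  | hf i =>
    rw [omega_f, omega_mul, omega_e, QEA.kInv, omega_t, mul_assoc, QEA.k, QEA.pre.t_mul_neg,
      mul_one]
  | hadd x y hx hy => rw [map_add, map_add, hx, hy]
  | hmul x y hx hy => rw [omega_mul, omega_mul, hx, hy]

theorem omega_U0 {u : QEA C} (hu : u ∈ QEA.U0 C) : QEA.omega C u = u := by
  rw [← Subalgebra.mem_toSubmodule, U0_eq_span] at hu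
  induction hu using Submodule.span_induction with
  | mem x hx => obtain ⟨n, rfl⟩ := hx; exact omega_t n
  | zero => exact map_zero _
  | add a b _ _ ha hb => rw [map_add, ha, hb]
  | smul c a _ ha => rw [map_smul, ha]

theorem hwFun_mul_omega_neg (lam : Fin r → ℚ) {y : QEA C} (hy : y ∈ QEA.UNeg C) :
    ∀ u, hwFun C lam (u * QEA.omega C y) = QEA.counit C y * hwFun C lam u := by
  induction hy using Algebra.adjoin_induction with
  | mem x hx =>
    obtain ⟨i, rfl⟩ := hx
    intro u
    rw [omega_f, ← mul_assoc, hwFun_mul_e, QEA.counit, QEA.lift_f, zero_mul]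
  | algebraMap c =>
    intro u
    rw [omega_algebraMap, ← Algebra.commutes, ← Algebra.smul_def, map_smul, AlgHom.commutes]; rfl
  | add x y _ _ hx hy => intro u; rw [map_add, mul_add, map_add, hx, hy, map_add, add_mul]
  | mul x y _ _ hx hy =>
    intro u; rw [omega_mul, ← mul_assoc, hx, hy, map_mul, mul_assoc]

theorem hwFun_omega_pos_mul (lam : Fin r → ℚ) {x : QEA C} (hx : x ∈ QEA.UPos C) :
    ∀ u, hwFun C lam (QEA.omega C x * u) = QEA.counit C x * hwFun C lam u := by
  induction hx using Algebra.adjoin_induction with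
  | mem x hx =>
    obtain ⟨i, rfl⟩ := hx
    intro u
    rw [omega_e, mul_assoc, hwFun_f_mul, QEA.counit, QEA.lift_e, zero_mul]
  | algebraMap c =>
    intro u
    rw [omega_algebraMap, ← Algebra.smul_def, map_smul, AlgHom.commutes]; rfl
  | add x y _ _ hx hy => intro u; rw [map_add, add_mul, map_add, hx, hy, map_add, add_mul]
  | mul x y _ _ hx hy =>
    intro u; rw [omega_mul, mul_assoc, hy, hx, map_mul, mul_left_comm, mul_assoc]

/-- Additive statements about `U` need only be checked on products from `U⁻`, `U⁰` and `U⁺`. -/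
theorem triangular_induction {p : QEA C → Prop}
    (hmul : ∀ y ∈ QEA.UNeg C, ∀ u ∈ QEA.U0 C, ∀ x ∈ QEA.UPos C, p (y * u * x))
    (hadd : ∀ a b, p a → p b → p (a + b)) (x : QEA C) : p x := by
  have hx : x ∈ Subalgebra.toSubmodule (QEA.UNeg C) * Subalgebra.toSubmodule (QEA.U0 C) *
      Subalgebra.toSubmodule (QEA.UPos C) := by rw [triangular_span]; trivial
  refine Submodule.mul_induction_on hx (fun a ha x hx => ?_) hadd
  induction ha using Submodule.mul_induction_on' with
  | mem_mul_mem y hy u hu => exact hmul y hy u hu x hx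
  | add a _ b _ ha hb => rw [add_mul]; exact hadd _ _ ha hb

theorem hwFun_omega (lam : Fin r → ℚ) (u : QEA C) :
    hwFun C lam (QEA.omega C u) = hwFun C lam u := by
  induction u using triangular_induction with
  | hmul y hy u hu x hx =>
    rw [hwFun_mul_pos lam hx, hwFun_neg_mul lam hy, omega_mul, hwFun_omega_pos_mul lam hx,
      omega_mul, hwFun_mul_omega_neg lam hy, omega_U0 hu]
  | hadd a b ha hb => rw [map_add, map_add, ha, hb, map_add]

theorem shapovalov_apply (lam : Fin r → ℚ) (x y : QEA C) :
    shapovalov C lam x y = hwFun C lam (QEA.omega C x * y) := by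
  rw [← hcForm_eq]; rfl

/-- `S_λ` is symmetric because `ω` is an involutive antiautomorphism that fixes `U⁰` and exchanges
`U⁻₊ U` with `U U⁺₊`. -/
theorem shapovalov_symm (lam : Fin r → ℚ) (x y : QEA C) :
    shapovalov C lam x y = shapovalov C lam y x := by
  rw [shapovalov_apply, shapovalov_apply, ← hwFun_omega, omega_mul, omega_omega]

theorem piForm_theta (lam : Fin r → ℚ) (x y : QEA C) :
    piForm C lam (QEA.theta C x) y = shapovalov C lam x y := by
  rw [piForm_apply, shapovalov_apply, omega_apply]

theorem mem_KNeg_iff {lam : Fin r → ℚ} {y : QEA C} (hy : y ∈ QEA.UNeg C) :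
    y ∈ KNeg C lam ↔ ∀ z ∈ QEA.UNeg C, shapovalov C lam z y = 0 := by
  refine ⟨fun h z hz => ?_, fun h => ⟨hy, fun x hx => ?_⟩⟩
  · rw [← piForm_theta]
    exact h.2 _ (theta_mem_UPos hz)
  · rw [← theta_theta x, piForm_theta]
    exact h _ (theta_mem_UNeg hx)

theorem theta_mem_KPos {lam : Fin r → ℚ} {y : QEA C} (hy : y ∈ KNeg C lam) :
    QEA.theta C y ∈ KPos C lam :=
  ⟨theta_mem_UPos hy.1, fun z hz => by
    rw [piForm_theta, shapovalov_symm]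
    exact (mem_KNeg_iff hy.1).1 hy z hz⟩

/-! ### Weights in `U` -/

/-- `x ∈ U` has weight `μ`: `t x t⁻¹ = q ^ μ (t) x` for all `t ∈ T`. -/
def HasWeight (x : QEA C) (mu : Fin r → ℚ) : Prop :=
  ∀ n, QEA.t C n * x * QEA.t C (-n) = qwt C mu n • x

theorem qwt_neg (mu : Fin r → ℚ) (n : Fin r → ℤ) : qwt C (-mu) (-n) = qwt C mu n := by
  simp [qwt]

theorem HasWeight.one : HasWeight (1 : QEA C) 0 := fun n => by
  rw [mul_one, QEA.pre.t_mul_neg, qwt_zero_left, one_smul]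

theorem HasWeight.mul {x y : QEA C} {mu nu : Fin r → ℚ} (hx : HasWeight x mu)
    (hy : HasWeight y nu) : HasWeight (x * y) (mu + nu) := fun n => by
  have h : QEA.t C n * (x * y) * QEA.t C (-n) =
      (QEA.t C n * x * QEA.t C (-n)) * (QEA.t C n * y * QEA.t C (-n)) := by
    have e := QEA.pre (C := C).t_neg_mul n
    calc QEA.t C n * (x * y) * QEA.t C (-n)
        = QEA.t C n * x * 1 * y * QEA.t C (-n) := by simp only [mul_one, mul_assoc]
      _ = _ := by rw [← e]; simp only [mul_assoc]
  rw [h, hx n, hy n, smul_mul_smul_comm, qwt_add_left]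

theorem HasWeight.f (i : Fin r) : HasWeight (QEA.f C i) (-Pi.single i 1) := fun n => by
  rw [QEA.pre.t_f, smul_mul_assoc, mul_assoc, QEA.pre.t_mul_neg, mul_one, ← Pi.single_neg,
    qwt_single]
  congr 2; ring

theorem HasWeight.theta {x : QEA C} {mu : Fin r → ℚ} (hx : HasWeight x mu) :
    HasWeight (QEA.theta C x) (-mu) := fun n => by
  have h := congrArg (QEA.theta C) (hx (-n))
  rw [map_mul, map_mul, theta_t, theta_t, neg_neg, map_smul] at h
  rw [h, ← qwt_neg, neg_neg]

theorem HasWeight.omega {x : QEA C} {mu : Fin r → ℚ} (hx : HasWeight x mu) :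
    HasWeight (QEA.omega C x) (-mu) := fun n => by
  have h := congrArg (QEA.omega C) (hx (-n))
  rw [omega_mul, omega_mul, omega_t, omega_t, neg_neg, map_smul, ← mul_assoc] at h
  rw [h, ← qwt_neg, neg_neg]

/-- An element of weight `β` maps `V[μ]` to `V[β + μ]`. -/
theorem HasWeight.map_wtSpace {V : Type*} [AddCommMonoid V] [Module 𝕜 V]
    {ρ : QEA C →ₐ[𝕜] Module.End 𝕜 V} {x : QEA C} {β mu : Fin r → ℚ} (hx : HasWeight x β) {v : V}
    (hv : v ∈ wtSpace ρ mu) : ρ x v ∈ wtSpace ρ (β + mu) := fun n => by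
  have h : QEA.t C n * x = qwt C β n • (x * QEA.t C n) := by
    rw [← smul_mul_assoc, ← hx n, mul_assoc _ (QEA.t C (-n)), QEA.pre.t_neg_mul, mul_one]
  rw [← Module.End.mul_apply, ← map_mul, h, map_smul, map_mul, LinearMap.smul_apply,
    Module.End.mul_apply, hv n, map_smul, smul_smul, qwt_add_left]

theorem hwFun_eq_zero_of_hasWeight {lam mu : Fin r → ℚ} {x : QEA C} (hx : HasWeight x mu)
    (hmu : mu ≠ 0) : hwFun C lam x = 0 := by
  by_contra h0
  refine hmu (qwt_injective (C := C) fun n => ?_)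
  have h := congrArg (hwFun C lam) (hx n)
  rw [hwFun_mul_t, hwFun_t_mul, ← mul_assoc, ← qwt_add_right, neg_add_cancel, qwt_zero_right,
    one_mul, map_smul, smul_eq_mul] at h
  rw [qwt_zero_left]
  exact (mul_right_cancel₀ h0 ((one_mul _).trans h)).symm

/-- The negative of `∑ j, β j • α j ∈ Q₊`, in coordinates. -/
abbrev negWt (β : Fin r → ℕ) : Fin r → ℚ := fun j => -(β j : ℚ)

theorem negWt_injective : Function.Injective (negWt (r := r)) := fun β γ h => by
  funext j
  have := congrFun h j
  simpa [negWt] using this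

/-- Weight vectors of different weights are orthogonal for the Shapovalov form. -/
theorem shapovalov_eq_zero_of_ne {lam : Fin r → ℚ} {β γ : Fin r → ℕ} (h : β ≠ γ) {y z : QEA C}
    (hy : HasWeight y (negWt β)) (hz : HasWeight z (negWt γ)) : shapovalov C lam y z = 0 := by
  rw [shapovalov_apply]
  refine hwFun_eq_zero_of_hasWeight (hy.omega.mul hz) fun h0 => h ?_
  exact negWt_injective (neg_add_eq_zero.1 h0)

/-- `U⁻` is spanned by its elements of weights in `-Q₊`. -/
theorem UNeg_le_span : Subalgebra.toSubmodule (QEA.UNeg C) ≤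
    Submodule.span 𝕜 {y | y ∈ QEA.UNeg C ∧ ∃ β, HasWeight y (negWt β)} := by
  rw [QEA.UNeg, Algebra.adjoin_eq_span]
  refine Submodule.span_mono fun y hy => ?_
  induction hy using Submonoid.closure_induction with
  | mem x hx =>
    obtain ⟨i, rfl⟩ := hx
    refine ⟨f_mem i, Pi.single i 1, ?_⟩
    convert HasWeight.f (C := C) i using 1
    funext j
    by_cases h : j = i
    · subst h; simp
    · simp [h]
  | one =>
    refine ⟨one_mem _, 0, ?_⟩
    convert HasWeight.one (C := C) using 1
    funext j; simp
  | mul x y _ _ hx hy =>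
    obtain ⟨hx, β, hβ⟩ := hx
    obtain ⟨hy, γ, hγ⟩ := hy
    refine ⟨mul_mem hx hy, β + γ, ?_⟩
    convert hβ.mul hγ using 1
    funext j; simp [negWt, add_comm]

theorem UNeg_induction {p : QEA C → Prop}
    (hwt : ∀ β, ∀ y ∈ QEA.UNeg C, HasWeight y (negWt β) → p y) (hzero : p 0)
    (hadd : ∀ a b, p a → p b → p (a + b)) (hsmul : ∀ (c : 𝕜) a, p a → p (c • a)) {y : QEA C}
    (hy : y ∈ QEA.UNeg C) : p y := by
  have h := UNeg_le_span hy
  clear hy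
  induction h using Submodule.span_induction with
  | mem y hy => obtain ⟨hy, β, hβ⟩ := hy; exact hwt β y hy hβ
  | zero => exact hzero
  | add a b _ _ ha hb => exact hadd a b ha hb
  | smul c a _ ha => exact hsmul c a ha

/-! ### Highest weight vectors -/

/-- `w` is a highest weight vector of weight `λ` (or zero): it is killed by the `e i` and lies in
`V[λ]`. -/
structure IsHighestWeight {V : Type*} [AddCommMonoid V] [Module 𝕜 V]
    (ρ : QEA C →ₐ[𝕜] Module.End 𝕜 V) (lam : Fin r → ℚ) (w : V) : Prop where
  e : ∀ i, ρ (QEA.e C i) w = 0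
  t : w ∈ wtSpace ρ lam

theorem IsHighestWeight.apply_vermaIdeal {V : Type*} [AddCommMonoid V] [Module 𝕜 V]
    {ρ : QEA C →ₐ[𝕜] Module.End 𝕜 V} {lam : Fin r → ℚ} {w : V} (hw : IsHighestWeight ρ lam w)
    {x : QEA C} (hx : x ∈ vermaIdeal C lam) : ρ x w = 0 := by
  -- A module over a field has negatives, given by the scalar `-1`.
  let _ : AddCommGroup V := Module.addCommMonoidToAddCommGroup 𝕜
  induction hx using Submodule.span_induction with
  | mem x hx =>
    rcases hx with ⟨i, rfl⟩ | ⟨n, rfl⟩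
    · exact hw.e i
    · rw [map_sub, AlgHom.commutes, LinearMap.sub_apply, hw.t n, Module.algebraMap_end_apply,
        sub_self]
  | zero => rw [map_zero, LinearMap.zero_apply]
  | add a b _ _ ha hb => rw [map_add, LinearMap.add_apply, ha, hb, add_zero]
  | smul u a _ ha => rw [smul_eq_mul, map_mul, Module.End.mul_apply, ha, map_zero]

theorem smul_mem_vermaIdeal (lam : Fin r → ℚ) (c : 𝕜) {x : QEA C} (hx : x ∈ vermaIdeal C lam) :
    c • x ∈ vermaIdeal C lam := by
  rw [Algebra.smul_def]; exact Submodule.smul_mem _ _ hx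

theorem pos_sub_mem_vermaIdeal (lam : Fin r → ℚ) {x : QEA C} (hx : x ∈ QEA.UPos C) :
    x - algebraMap 𝕜 _ (QEA.counit C x) ∈ vermaIdeal C lam := by
  induction hx using Algebra.adjoin_induction with
  | mem x hx =>
    obtain ⟨i, rfl⟩ := hx
    rw [QEA.counit, QEA.lift_e, map_zero, sub_zero]
    exact Submodule.subset_span (Or.inl ⟨i, rfl⟩)
  | algebraMap c => rw [AlgHom.commutes]; simp
  | add x y _ _ hx hy => rw [map_add, map_add, add_sub_add_comm]; exact add_mem hx hy
  | mul x y _ _ hx hy =>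
    have e : x * y - algebraMap 𝕜 _ (QEA.counit C (x * y)) =
        x * (y - algebraMap 𝕜 _ (QEA.counit C y)) +
          QEA.counit C y • (x - algebraMap 𝕜 _ (QEA.counit C x)) := by
      rw [mul_sub, ← Algebra.commutes, ← Algebra.smul_def, map_mul, map_mul, smul_sub,
        Algebra.smul_def _ (algebraMap 𝕜 (QEA C) _), Algebra.commutes (QEA.counit C x)]
      abel
    rw [e]
    exact add_mem (Submodule.smul_mem _ x hy) (smul_mem_vermaIdeal lam _ hx)

theorem torus_sub_mem_vermaIdeal (lam : Fin r → ℚ) {u : QEA C} (hu : u ∈ QEA.U0 C) :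
    ∃ c : 𝕜, u - algebraMap 𝕜 _ c ∈ vermaIdeal C lam := by
  rw [← Subalgebra.mem_toSubmodule, U0_eq_span] at hu
  induction hu using Submodule.span_induction with
  | mem x hx =>
    obtain ⟨n, rfl⟩ := hx
    exact ⟨_, Submodule.subset_span (Or.inr ⟨n, rfl⟩)⟩
  | zero => exact ⟨0, by simp⟩
  | add a b _ _ ha hb =>
    obtain ⟨c, hc⟩ := ha
    obtain ⟨d, hd⟩ := hb
    exact ⟨c + d, by rw [map_add, add_sub_add_comm]; exact add_mem hc hd⟩
  | smul c a _ ha =>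
    obtain ⟨d, hd⟩ := ha
    refine ⟨c * d, ?_⟩
    have := smul_mem_vermaIdeal lam c hd
    rwa [smul_sub, Algebra.smul_def c (algebraMap 𝕜 (QEA C) d), ← map_mul] at this

/-- Modulo the left ideal that defines `M(λ)`, every element of `U` is congruent to one of
`U⁻`. -/
theorem exists_neg_sub_mem_vermaIdeal (lam : Fin r → ℚ) (u : QEA C) :
    ∃ y ∈ QEA.UNeg C, u - y ∈ vermaIdeal C lam := by
  induction u using triangular_induction with
  | hmul y hy u hu x hx =>
    obtain ⟨c, hc⟩ := torus_sub_mem_vermaIdeal lam hu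
    refine ⟨(QEA.counit C x * c) • y, Subalgebra.smul_mem _ hy _, ?_⟩
    have e : y * u * x - (QEA.counit C x * c) • y =
        (y * u) * (x - algebraMap 𝕜 _ (QEA.counit C x)) +
          (QEA.counit C x) • (y * (u - algebraMap 𝕜 _ c)) := by
      rw [mul_sub, mul_sub, ← Algebra.commutes, ← Algebra.commutes, ← Algebra.smul_def,
        ← Algebra.smul_def, smul_sub, smul_smul]
      abel
    rw [e]
    exact add_mem (Submodule.smul_mem _ _ (pos_sub_mem_vermaIdeal lam hx))
      (smul_mem_vermaIdeal lam _ (Submodule.smul_mem _ y hc))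
  | hadd a b ha hb =>
    obtain ⟨y, hy, hay⟩ := ha
    obtain ⟨z, hz, hbz⟩ := hb
    exact ⟨y + z, add_mem hy hz, by rw [add_sub_add_comm]; exact add_mem hay hbz⟩

theorem smul_hwVec_eq_zero_of_mem_vermaIdeal {lam : Fin r → ℚ} {x : QEA C}
    (hx : x ∈ vermaIdeal C lam) : x • hwVec C lam = 0 := by
  have h : x • vermaVec C lam = 0 := by
    rw [vermaVec, ← map_smul, smul_eq_mul, mul_one]
    exact (Submodule.Quotient.mk_eq_zero _).2 hx
  rw [hwVec, ← map_smul, h, map_zero]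

theorem isHighestWeight_hwVec (lam : Fin r → ℚ) :
    IsHighestWeight (simpleRep C lam) lam (hwVec C lam) where
  e i := smul_hwVec_eq_zero_of_mem_vermaIdeal (Submodule.subset_span (Or.inl ⟨i, rfl⟩))
  t n := by
    have h := smul_hwVec_eq_zero_of_mem_vermaIdeal (C := C) (lam := lam)
      (Submodule.subset_span (Or.inr ⟨n, rfl⟩))
    rw [sub_smul, algebraMap_smul, sub_eq_zero] at h
    exact h

theorem exists_neg_smul_hwVec (lam : Fin r → ℚ) (m : Simple C lam) :
    ∃ y ∈ QEA.UNeg C, m = y • hwVec C lam := by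
  obtain ⟨u, rfl⟩ := exists_smul_hwVec lam m
  obtain ⟨y, hy, h⟩ := exists_neg_sub_mem_vermaIdeal lam u
  refine ⟨y, hy, ?_⟩
  rw [← sub_eq_zero, ← sub_smul, smul_hwVec_eq_zero_of_mem_vermaIdeal h]

theorem smul_hwVec_eq_zero_iff {lam : Fin r → ℚ} {y : QEA C} (hy : y ∈ QEA.UNeg C) :
    y • hwVec C lam = 0 ↔ y ∈ KNeg C lam := by
  refine ⟨fun h => ⟨hy, fun x _ => ?_⟩, fun h => ?_⟩
  · rw [piForm_apply, ← hwCoeff_smul, mul_smul, h, smul_zero, map_zero]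
  · rw [hwVec, ← map_smul]
    exact (Submodule.Quotient.mk_eq_zero _).2 (Submodule.subset_span ⟨y, h, rfl⟩)

/-- The functionals `m ↦ hwCoeff (σ(x) m)` with `x ∈ U⁺` separate the points of `L(λ)`. -/
theorem eq_zero_of_hwCoeff_antipode {lam : Fin r → ℚ} {m : Simple C lam}
    (h : ∀ x ∈ QEA.UPos C, hwCoeff C lam (QEA.antipode C x • m) = 0) : m = 0 := by
  obtain ⟨y, hy, rfl⟩ := exists_neg_smul_hwVec lam m
  refine (smul_hwVec_eq_zero_iff hy).2 ⟨hy, fun x hx => ?_⟩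
  rw [piForm_apply, ← hwCoeff_smul, mul_smul]
  exact h x hx

/-! ### The matrices of the Shapovalov form -/

namespace WeightBases

variable {lam : Fin r → ℚ} {ι : (Fin r → ℕ) → Type*} (B : WeightBases C lam ι)

theorem hasWeight (β : Fin r → ℕ) (i : ι β) : HasWeight (B.y β i) (negWt β) := B.weight β i

/-- An element of weight `-β` of `U⁻` is, modulo `K_λ`, a combination of the `y β i`. -/
theorem exists_sub_mem_KNeg [∀ β, Fintype (ι β)] {β : Fin r → ℕ} {y : QEA C}
    (hy : y ∈ QEA.UNeg C) (hβ : HasWeight y (negWt β)) :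
    ∃ c : ι β → 𝕜, y - ∑ i, c i • B.y β i ∈ KNeg C lam := by
  have h : y • hwVec C lam ∈ wtSpace (simpleRep C lam) fun j => lam j - β j := by
    have h' : y • hwVec C lam ∈ wtSpace (simpleRep C lam) (negWt β + lam) :=
      hβ.map_wtSpace (isHighestWeight_hwVec lam).t
    convert h' using 2
    funext j; simp [sub_eq_neg_add]
  rw [← B.span_eq, Submodule.mem_span_range_iff_exists_fun] at h
  obtain ⟨c, hc⟩ := h
  refine ⟨c, (smul_hwVec_eq_zero_iff (sub_mem hy (sum_mem fun i _ =>
    Subalgebra.smul_mem _ (B.mem_UNeg β i) _))).1 ?_⟩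
  rw [sub_smul, Finset.sum_smul, ← hc, sub_eq_zero]
  simp only [smul_assoc]

theorem isUnit_shapMatrix [∀ β, Fintype (ι β)] [∀ β, DecidableEq (ι β)] (β : Fin r → ℕ) :
    IsUnit (B.shapMatrix β) := by
  rw [← Matrix.mulVec_injective_iff_isUnit]
  refine (injective_iff_map_eq_zero (B.shapMatrix β).mulVecLin).2 fun c hc => ?_
  have hc' : ∀ i, shapovalov C lam (B.y β i) (∑ j, c j • B.y β j) = 0 := fun i => by
    rw [← Pi.zero_apply (M := fun _ : ι β => 𝕜) i, ← hc, map_sum]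
    simp [Matrix.mulVec, dotProduct, shapMatrix, mul_comm]
  have hy : ∑ j, c j • B.y β j ∈ QEA.UNeg C :=
    sum_mem fun i _ => Subalgebra.smul_mem _ (B.mem_UNeg β i) _
  -- A vector in the kernel of the matrix is orthogonal to all of `U⁻`, as `U⁻[-β]` is spanned by
  -- the `y β i` and by the radical of the (symmetric) form.
  have hK : ∑ j, c j • B.y β j ∈ KNeg C lam := by
    refine (mem_KNeg_iff hy).2 fun z hz => ?_
    refine UNeg_induction (p := fun z => shapovalov C lam z (∑ j, c j • B.y β j) = 0) ?_ ?_ ?_ ?_ hz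
    · intro γ z hz hγ
      by_cases h : γ = β
      · subst h
        obtain ⟨d, hd⟩ := B.exists_sub_mem_KNeg hz hγ
        have h1 := (mem_KNeg_iff hd.1).1 hd _ hy
        rw [shapovalov_symm, map_sub, LinearMap.sub_apply, sub_eq_zero] at h1
        rw [h1, map_sum (shapovalov C lam), LinearMap.sum_apply]
        refine Finset.sum_eq_zero fun i _ => ?_
        rw [map_smul, LinearMap.smul_apply, hc', smul_zero]
      · rw [map_sum]
        refine Finset.sum_eq_zero fun i _ => ?_
        rw [map_smul, shapovalov_eq_zero_of_ne h hγ (B.hasWeight β i), smul_zero]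
    · rw [map_zero, LinearMap.zero_apply]
    · intro a b ha hb
      rw [map_add, LinearMap.add_apply, ha, hb, add_zero]
    · intro a z h
      rw [map_smul, LinearMap.smul_apply, h, smul_zero]
  have h0 := (smul_hwVec_eq_zero_iff hy).2 hK
  simp only [Finset.sum_smul, smul_assoc] at h0
  funext i
  exact Fintype.linearIndependent_iff.1 (B.linearIndependent β) c h0 i

end WeightBases

/-! ### Contraction of tensor products with functionals -/

section Contract

variable {V W : Type*} [AddCommMonoid V] [Module 𝕜 V] [AddCommMonoid W] [Module 𝕜 W]

/-- The contraction `ζ ⊗ id : V ⊗ W → W` with a functional `ζ` on `V`. -/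
def contract (ζ : Module.Dual 𝕜 V) : V ⊗[𝕜] W →ₗ[𝕜] W :=
  (TensorProduct.lid 𝕜 W).toLinearMap ∘ₗ ζ.rTensor W

theorem contract_tmul (ζ : Module.Dual 𝕜 V) (v : V) (w : W) :
    contract ζ (v ⊗ₜ w) = ζ v • w := by
  simp [contract]

theorem contract_smul (c : 𝕜) (ζ : Module.Dual 𝕜 V) (z : V ⊗[𝕜] W) :
    contract (c • ζ) z = c • contract ζ z := by
  induction z with
  | zero => simp
  | add a b ha hb => rw [map_add, map_add, ha, hb, smul_add]
  | tmul v w => rw [contract_tmul, contract_tmul, LinearMap.smul_apply, smul_assoc]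

theorem contract_add (ζ ζ' : Module.Dual 𝕜 V) (z : V ⊗[𝕜] W) :
    contract (ζ + ζ') z = contract ζ z + contract ζ' z := by
  induction z with
  | zero => simp
  | add a b ha hb => rw [map_add, map_add, map_add, ha, hb]; exact add_add_add_comm _ _ _ _
  | tmul v w => simp only [contract_tmul, LinearMap.add_apply, add_smul]

theorem contract_map (ζ : Module.Dual 𝕜 V) (a : Module.End 𝕜 V) (b : Module.End 𝕜 W)
    (z : V ⊗[𝕜] W) : contract ζ (TensorProduct.map a b z) = b (contract (ζ ∘ₗ a) z) := by
  induction z with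
  | zero => simp
  | add z z' h h' => simp only [map_add, h, h']
  | tmul v w => simp [contract_tmul]

/-- If a family of functionals separates the points of `V`, then the contractions with it separate
the points of `V ⊗ W`. -/
theorem eq_zero_of_contract (S : Set (Module.Dual 𝕜 V))
    (hS : ∀ v, (∀ ζ ∈ S, ζ v = 0) → v = 0) {z : V ⊗[𝕜] W} (h : ∀ ζ ∈ S, contract ζ z = 0) :
    z = 0 := by
  classical
  let _ : AddCommGroup W := Module.addCommMonoidToAddCommGroup 𝕜
  let b := Module.Basis.ofVectorSpace 𝕜 W
  refine (TensorProduct.equivFinsuppOfBasisRight b).map_eq_zero_iff.1 (Finsupp.ext fun i => ?_)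
  refine hS _ fun ζ hζ => ?_
  have key : ∀ z : V ⊗[𝕜] W,
      ζ (TensorProduct.equivFinsuppOfBasisRight b z i) = b.repr (contract ζ z) i := by
    intro z
    induction z with
    | zero => simp
    | add z z' h h' => simp only [map_add, Finsupp.add_apply, h, h']
    | tmul v w =>
      rw [TensorProduct.equivFinsuppOfBasisRight_apply_tmul_apply, contract_tmul, map_smul,
        map_smul, Finsupp.smul_apply, smul_eq_mul, smul_eq_mul, mul_comm]
  rw [key, h ζ hζ, map_zero, Finsupp.zero_apply]

variable {ρ : QEA C →ₐ[𝕜] Module.End 𝕜 V} {τ : QEA C →ₐ[𝕜] Module.End 𝕜 W}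

theorem contract_tensorRep_t (ζ : Module.Dual 𝕜 V) (n : Fin r → ℤ) (z : V ⊗[𝕜] W) :
    contract ζ (tensorRep ρ τ (QEA.t C n) z) =
      τ (QEA.t C n) (contract (ζ ∘ₗ ρ (QEA.t C n)) z) := by
  rw [tensorRep_t, contract_map]

theorem contract_tensorRep_e (ζ : Module.Dual 𝕜 V) (i : Fin r) (z : V ⊗[𝕜] W) :
    contract ζ (tensorRep ρ τ (QEA.e C i) z) = contract (ζ ∘ₗ ρ (QEA.e C i)) z +
      τ (QEA.e C i) (contract (ζ ∘ₗ ρ (QEA.k C i)) z) := by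
  rw [tensorRep_e, LinearMap.add_apply, map_add, contract_map, contract_map]
  rfl

theorem contract_tensorRep_f (ζ : Module.Dual 𝕜 V) (i : Fin r) (z : V ⊗[𝕜] W) :
    contract ζ (tensorRep ρ τ (QEA.f C i) z) =
      τ (QEA.kInv C i) (contract (ζ ∘ₗ ρ (QEA.f C i)) z) + τ (QEA.f C i) (contract ζ z) := by
  rw [tensorRep_f, LinearMap.add_apply, map_add, contract_map, contract_map]
  rfl

/-- The functionals whose contraction kills `U z` are stable under the action of `U`, although
`U` acts on `V ⊗ W` through the comultiplication. -/
theorem contract_comp_eq_zero {z : V ⊗[𝕜] W} (x : QEA C) :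
    ∀ ζ : Module.Dual 𝕜 V, (∀ u, contract ζ (tensorRep ρ τ u z) = 0) →
      ∀ u, contract (ζ ∘ₗ ρ x) (tensorRep ρ τ u z) = 0 := by
  have ht : ∀ n, ∀ ζ : Module.Dual 𝕜 V, (∀ u, contract ζ (tensorRep ρ τ u z) = 0) →
      ∀ u, contract (ζ ∘ₗ ρ (QEA.t C n)) (tensorRep ρ τ u z) = 0 := by
    intro n ζ h u
    have h1 := h (QEA.t C n * u)
    rw [map_mul, Module.End.mul_apply, contract_tensorRep_t] at h1
    have h2 := congrArg (τ (QEA.t C (-n))) h1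
    rwa [← Module.End.mul_apply, ← map_mul, QEA.pre.t_neg_mul, map_one, map_zero] at h2
  induction x using QEA.induction with
  | hs c =>
    intro ζ h u
    have e : ζ ∘ₗ ρ (algebraMap 𝕜 _ c) = c • ζ := by ext v; simp
    rw [e, contract_smul, h, smul_zero]
  | ht n => exact ht n
  | he i =>
    intro ζ h u
    have h1 := h (QEA.e C i * u)
    rwa [map_mul, Module.End.mul_apply, contract_tensorRep_e, QEA.k, ht _ ζ h, map_zero,
      add_zero] at h1
  | hf i =>
    intro ζ h u
    have h1 := h (QEA.f C i * u)
    rw [map_mul, Module.End.mul_apply, contract_tensorRep_f, h, map_zero, add_zero] at h1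
    have h2 := congrArg (τ (QEA.k C i)) h1
    rwa [← Module.End.mul_apply, ← map_mul, QEA.k, QEA.kInv, QEA.pre.t_mul_neg, map_one,
      map_zero] at h2
  | hadd x y hx hy =>
    intro ζ h u
    rw [map_add, LinearMap.comp_add, contract_add, hx ζ h, hy ζ h, add_zero]
  | hmul x y hx hy =>
    intro ζ h
    rw [map_mul, Module.End.mul_eq_comp, ← LinearMap.comp_assoc]
    exact hy _ (hx ζ h)

/-- On a vector killed by the `e i`, an element `x ∈ U⁺` acting on the second factor is the same as
`σ(x)` acting on the first factor. -/
theorem contract_antipode {w : V ⊗[𝕜] W} (hw : ∀ i, tensorRep ρ τ (QEA.e C i) w = 0) {x : QEA C}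
    (hx : x ∈ QEA.UPos C) : ∀ ζ : Module.Dual 𝕜 V,
      contract (ζ ∘ₗ ρ (QEA.antipode C x)) w = τ x (contract ζ w) := by
  let _ : AddCommGroup W := Module.addCommMonoidToAddCommGroup 𝕜
  induction hx using Algebra.adjoin_induction with
  | mem x hx =>
    obtain ⟨i, rfl⟩ := hx
    intro ζ
    have h := contract_tensorRep_e (ρ := ρ) (τ := τ) (ζ ∘ₗ ρ (QEA.kInv C i)) i w
    have e1 : (ζ ∘ₗ ρ (QEA.kInv C i)) ∘ₗ ρ (QEA.k C i) = ζ := by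
      rw [LinearMap.comp_assoc, ← Module.End.mul_eq_comp, ← map_mul, QEA.kInv, QEA.k,
        QEA.pre.t_neg_mul, map_one]
      rfl
    have e2 : ζ ∘ₗ ρ (QEA.antipode C (QEA.e C i)) =
        (-1 : 𝕜) • ((ζ ∘ₗ ρ (QEA.kInv C i)) ∘ₗ ρ (QEA.e C i)) := by
      rw [antipode_e, ← neg_one_smul 𝕜, map_smul, LinearMap.comp_smul, map_mul,
        Module.End.mul_eq_comp, ← LinearMap.comp_assoc]
    rw [hw, map_zero, e1] at h
    rw [e2, contract_smul, neg_one_smul]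
    exact neg_eq_of_add_eq_zero_right h.symm
  | algebraMap c =>
    intro ζ
    have e : ζ ∘ₗ ρ (QEA.antipode C (algebraMap 𝕜 _ c)) = c • ζ := by
      ext v; simp [Algebra.algebraMap_eq_smul_one, antipode_one]
    rw [e, contract_smul, AlgHom.commutes, Module.algebraMap_end_apply]
  | add x y _ _ hx hy =>
    intro ζ
    rw [map_add, map_add, LinearMap.comp_add, contract_add, hx, hy, map_add, LinearMap.add_apply]
  | mul x y _ _ hx hy =>
    intro ζ
    rw [antipode_mul, map_mul, Module.End.mul_eq_comp, ← LinearMap.comp_assoc, hx, hy, map_mul,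
      Module.End.mul_apply]

end Contract

/-! ### Highest weight vectors in `L(λ) ⊗ W` -/

section SimpleTensor

variable {lam : Fin r → ℚ} {W : Type*} [AddCommMonoid W] [Module 𝕜 W]
  {τ : QEA C →ₐ[𝕜] Module.End 𝕜 W}

theorem hwCoeff_comp_t (n : Fin r → ℤ) :
    hwCoeff C lam ∘ₗ simpleRep C lam (QEA.t C n) = qwt C lam n • hwCoeff C lam := by
  refine LinearMap.ext fun m => ?_
  obtain ⟨x, rfl⟩ := exists_smul_hwVec lam m
  change hwCoeff C lam (QEA.t C n • x • hwVec C lam) = qwt C lam n • hwCoeff C lam _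
  rw [smul_smul, hwCoeff_smul, hwFun_t_mul, hwCoeff_smul, smul_eq_mul]

theorem hwCoeff_comp_f (i : Fin r) : hwCoeff C lam ∘ₗ simpleRep C lam (QEA.f C i) = 0 := by
  refine LinearMap.ext fun m => ?_
  obtain ⟨x, rfl⟩ := exists_smul_hwVec lam m
  change hwCoeff C lam (QEA.f C i • x • hwVec C lam) = 0
  rw [smul_smul, hwCoeff_smul, hwFun_f_mul]

theorem eq_zero_of_contract_antipode {z : Simple C lam ⊗[𝕜] W}
    (h : ∀ x ∈ QEA.UPos C,
      contract (hwCoeff C lam ∘ₗ simpleRep C lam (QEA.antipode C x)) z = 0) : z = 0 := by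
  refine eq_zero_of_contract
    {ζ | ∃ x ∈ QEA.UPos C, ζ = hwCoeff C lam ∘ₗ simpleRep C lam (QEA.antipode C x)}
    (fun m hm => eq_zero_of_hwCoeff_antipode fun x hx => hm _ ⟨x, hx, rfl⟩) ?_
  rintro _ ⟨x, hx, rfl⟩
  exact h x hx

/-- A highest weight vector of `L(λ) ⊗ W` is determined by its coefficient at `1̄_λ`. -/
theorem IsHighestWeight.eq_of_contract_hwCoeff {w w' : Simple C lam ⊗[𝕜] W}
    (hw : IsHighestWeight (tensorRep (simpleRep C lam) τ) lam w)
    (hw' : IsHighestWeight (tensorRep (simpleRep C lam) τ) lam w')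
    (h : contract (hwCoeff C lam) w = contract (hwCoeff C lam) w') : w = w' := by
  let _ : AddCommGroup W := Module.addCommMonoidToAddCommGroup 𝕜
  have he : ∀ i, tensorRep (simpleRep C lam) τ (QEA.e C i) (w - w') = 0 := fun i => by
    rw [map_sub, hw.e, hw'.e, sub_zero]
  refine sub_eq_zero.1 (eq_zero_of_contract_antipode fun x hx => ?_)
  rw [contract_antipode he hx, map_sub, h, sub_self, map_zero]

/-- A non-zero submodule of `L(λ) ⊗ W` contains a vector with non-zero coefficient at `1̄_λ`. -/
theorem eq_zero_of_contract_tensorRep {z : Simple C lam ⊗[𝕜] W}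
    (h : ∀ u, contract (hwCoeff C lam) (tensorRep (simpleRep C lam) τ u z) = 0) : z = 0 :=
  eq_zero_of_contract_antipode fun x _ => by
    simpa using contract_comp_eq_zero (QEA.antipode C x) _ h 1

/-- `(ξ ⊗ id)(y z) = y (ξ ⊗ id)(z)` for `y ∈ U⁻` and `ξ = hwCoeff`, because `Δ(y) - 1 ⊗ y` has its
first factors in the augmentation ideal of `U⁻`, which `ξ` kills. -/
theorem contract_hwCoeff_neg {y : QEA C} (hy : y ∈ QEA.UNeg C) :
    ∀ z : Simple C lam ⊗[𝕜] W, contract (hwCoeff C lam) (tensorRep (simpleRep C lam) τ y z) =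
      τ y (contract (hwCoeff C lam) z) := by
  induction hy using Algebra.adjoin_induction with
  | mem x hx =>
    obtain ⟨i, rfl⟩ := hx
    intro z
    have e : (0 : Module.Dual 𝕜 (Simple C lam)) = (0 : 𝕜) • 0 := (zero_smul _ _).symm
    rw [contract_tensorRep_f, hwCoeff_comp_f, e, contract_smul, zero_smul, map_zero, zero_add]
  | algebraMap c => intro z; simp only [AlgHom.commutes, Module.algebraMap_end_apply, map_smul]
  | add x y _ _ hx hy => intro z; simp only [map_add, LinearMap.add_apply, hx, hy]
  | mul x y _ _ hx hy => intro z; simp only [map_mul, Module.End.mul_apply, hx, hy]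

theorem exists_pos_t_mul (n : Fin r → ℤ) {x : QEA C} (hx : x ∈ QEA.UPos C) :
    ∃ x' ∈ QEA.UPos C, QEA.t C n * x = x' * QEA.t C n := by
  induction hx using Algebra.adjoin_induction with
  | mem x hx =>
    obtain ⟨i, rfl⟩ := hx
    exact ⟨qpow (C.d i * n i) • QEA.e C i, Subalgebra.smul_mem _ (e_mem i) _,
      by rw [QEA.pre.t_e, smul_mul_assoc]⟩
  | algebraMap c => exact ⟨algebraMap _ _ c, Subalgebra.algebraMap_mem _ c,
      (Algebra.commutes c _).symm⟩
  | add x y _ _ hx hy =>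
    obtain ⟨x', hx', ex⟩ := hx
    obtain ⟨y', hy', ey⟩ := hy
    exact ⟨x' + y', add_mem hx' hy', by rw [mul_add, add_mul, ex, ey]⟩
  | mul x y _ _ hx hy =>
    obtain ⟨x', hx', ex⟩ := hx
    obtain ⟨y', hy', ey⟩ := hy
    exact ⟨x' * y', mul_mem hx' hy', by rw [← mul_assoc, ex, mul_assoc, ey, mul_assoc]⟩

/-- Converse of `contract_antipode`. -/
theorem tensorRep_e_eq_zero {w : Simple C lam ⊗[𝕜] W} {f : W}
    (h : ∀ x ∈ QEA.UPos C,
      contract (hwCoeff C lam ∘ₗ simpleRep C lam (QEA.antipode C x)) w = τ x f) (i : Fin r) :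
    tensorRep (simpleRep C lam) τ (QEA.e C i) w = 0 := by
  let _ : AddCommGroup W := Module.addCommMonoidToAddCommGroup 𝕜
  refine eq_zero_of_contract_antipode fun x hx => ?_
  obtain ⟨x', hx', ex⟩ := exists_pos_t_mul (-C.kExp i) hx
  -- With `k x' = x k`, both `σ(x) k` and `σ(x) e` are `k` times an element of `σ(U⁺)`.
  have h1 : QEA.antipode C x * QEA.k C i = QEA.k C i * QEA.antipode C x' := by
    have := congrArg (QEA.antipode C) ex
    rw [antipode_mul, antipode_mul, antipode_t, neg_neg] at this
    exact this
  have h2 : QEA.antipode C x * QEA.e C i = -(QEA.k C i * QEA.antipode C (QEA.e C i * x')) := by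
    have e : QEA.e C i = -(QEA.k C i * QEA.antipode C (QEA.e C i)) := by
      rw [antipode_e, mul_neg, neg_neg, ← mul_assoc, QEA.k, QEA.kInv, QEA.pre.t_mul_neg, one_mul]
    rw [antipode_mul, ← mul_assoc, ← h1, mul_assoc, ← mul_neg, ← e]
  have e1 : (hwCoeff C lam ∘ₗ simpleRep C lam (QEA.antipode C x)) ∘ₗ simpleRep C lam (QEA.k C i) =
      qwt C lam (C.kExp i) • (hwCoeff C lam ∘ₗ simpleRep C lam (QEA.antipode C x')) := by
    rw [LinearMap.comp_assoc, ← Module.End.mul_eq_comp, ← map_mul, h1, map_mul,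
      Module.End.mul_eq_comp, ← LinearMap.comp_assoc, QEA.k, hwCoeff_comp_t, LinearMap.smul_comp]
  have e2 : (hwCoeff C lam ∘ₗ simpleRep C lam (QEA.antipode C x)) ∘ₗ simpleRep C lam (QEA.e C i) =
      (-qwt C lam (C.kExp i)) •
        (hwCoeff C lam ∘ₗ simpleRep C lam (QEA.antipode C (QEA.e C i * x'))) := by
    rw [LinearMap.comp_assoc, ← Module.End.mul_eq_comp, ← map_mul, h2, map_neg, map_mul,
      LinearMap.comp_neg, Module.End.mul_eq_comp, ← LinearMap.comp_assoc, QEA.k, hwCoeff_comp_t,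
      LinearMap.smul_comp]
    exact (neg_smul _ _).symm
  rw [contract_tensorRep_e, e1, e2, contract_smul, contract_smul, h _ hx',
    h _ (mul_mem (e_mem i) hx'), map_smul, map_mul, Module.End.mul_apply, neg_smul,
    neg_add_cancel]

/-- A highest weight vector `w` of `L(λ) ⊗ W` is the image of `1̄_λ` under a homomorphism as soon
as `K_λ` kills its coefficient at `1̄_λ`. -/
theorem exists_hom_of_isHighestWeight {w : Simple C lam ⊗[𝕜] W}
    (hw : IsHighestWeight (tensorRep (simpleRep C lam) τ) lam w)
    (hK : ∀ y ∈ KNeg C lam, τ y (contract (hwCoeff C lam) w) = 0) :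
    ∃ φ ∈ HomU (simpleRep C lam) (tensorRep (simpleRep C lam) τ), φ (hwVec C lam) = w := by
  let _ : AddCommGroup W := Module.addCommMonoidToAddCommGroup 𝕜
  set T := tensorRep (simpleRep C lam) τ with hT
  have hker : ∀ x : QEA C, x • hwVec C lam = 0 → T x w = 0 := by
    intro x hx
    refine eq_zero_of_contract_tensorRep (τ := τ) fun u => ?_
    obtain ⟨y, hy, huy⟩ := exists_neg_sub_mem_vermaIdeal lam (u * x)
    have h1 := hw.apply_vermaIdeal huy
    have h2 := smul_hwVec_eq_zero_of_mem_vermaIdeal huy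
    rw [map_sub, LinearMap.sub_apply, sub_eq_zero] at h1
    rw [sub_smul, mul_smul, hx, smul_zero, zero_sub, neg_eq_zero] at h2
    rw [← hT, ← Module.End.mul_apply, ← map_mul, h1, contract_hwCoeff_neg hy,
      hK y ((smul_hwVec_eq_zero_iff hy).1 h2)]
  let a : QEA C →ₗ[𝕜] Simple C lam :=
    (LinearMap.toSpanSingleton (QEA C) (Simple C lam) (hwVec C lam)).restrictScalars 𝕜
  have ha : Function.Surjective a := fun m => by
    obtain ⟨x, rfl⟩ := exists_smul_hwVec lam m
    exact ⟨x, rfl⟩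
  let b : QEA C →ₗ[𝕜] Simple C lam ⊗[𝕜] W := LinearMap.applyₗ w ∘ₗ T.toLinearMap
  have hab : LinearMap.ker a ≤ LinearMap.ker b := fun x hx => hker x hx
  let φ : Simple C lam →ₗ[𝕜] Simple C lam ⊗[𝕜] W :=
    (LinearMap.ker a).liftQ b hab ∘ₗ (a.quotKerEquivOfSurjective ha).symm.toLinearMap
  have hφ : ∀ x, φ (x • hwVec C lam) = T x w := by
    intro x
    have e : (a.quotKerEquivOfSurjective ha).symm (x • hwVec C lam) =
        (LinearMap.ker a).mkQ x := by
      rw [LinearEquiv.symm_apply_eq]; rfl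
    change (LinearMap.ker a).liftQ b hab ((a.quotKerEquivOfSurjective ha).symm _) = _
    rw [e]; rfl
  refine ⟨φ, fun x m => ?_, ?_⟩
  · obtain ⟨u, rfl⟩ := exists_smul_hwVec lam m
    change φ (x • u • hwVec C lam) = _
    rw [smul_smul, hφ, hφ, map_mul, Module.End.mul_apply]
  · rw [← one_smul (QEA C) (hwVec C lam), hφ, map_one, Module.End.one_apply]

end SimpleTensor

/-! ### Finiteness of the weights of regular functions -/

/-- Vectors of distinct weights are linearly independent, by the independence of characters of `T`. -/
theorem linearIndependent_of_wtSpace {V : Type*} [AddCommGroup V] [Module 𝕜 V]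
    (ρ : QEA C →ₐ[𝕜] Module.End 𝕜 V) {I : Type*} {mu : I → Fin r → ℚ}
    (hmu : Function.Injective mu) (v : I → V) (hv : ∀ i, v i ∈ wtSpace ρ (mu i))
    (h0 : ∀ i, v i ≠ 0) : LinearIndependent 𝕜 v := by
  let χ : I → Multiplicative (Fin r → ℤ) →* 𝕜 := fun i =>
    { toFun := fun n => qwt C (mu i) n.toAdd
      map_one' := qwt_zero_right C _
      map_mul' := fun _ _ => qwt_add_right C _ _ _ }
  have hχ : Function.Injective χ := fun i j h => hmu <| qwt_injective (C := C) fun n =>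
    DFunLike.congr_fun h (Multiplicative.ofAdd n)
  have hli : LinearIndependent 𝕜 fun i => (χ i : Multiplicative (Fin r → ℤ) → 𝕜) :=
    (linearIndependent_monoidHom _ 𝕜).comp χ hχ
  rw [linearIndependent_iff'] at hli ⊢
  intro s c hc i hi
  by_contra hci
  refine h0 i ((Module.forall_dual_apply_eq_zero_iff 𝕜 _).1 fun η => ?_)
  -- Applying `t ^ n` and a functional `η` to the relation gives one between distinct characters.
  refine (mul_eq_zero.1 (hli s (fun j => c j * η (v j)) (funext fun n => ?_) i hi)).resolve_left hci
  have h1 := congrArg (fun z => η (ρ (QEA.t C n.toAdd) z)) hc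
  simp only [map_sum, map_smul, map_zero, hv _ n.toAdd, smul_eq_mul] at h1
  rw [Finset.sum_apply, Pi.zero_apply, ← h1]
  refine Finset.sum_congr rfl fun j _ => ?_
  change c j * η (v j) * qwt C (mu j) n.toAdd = _
  ring

theorem finite_setOf_apply_ne_zero {V : Type*} [AddCommGroup V] [Module 𝕜 V]
    [FiniteDimensional 𝕜 V] {ρ : QEA C →ₐ[𝕜] Module.End 𝕜 V} (hρ : IsAdmissible ρ) (v : V) :
    {β : Fin r → ℚ | ∃ x, HasWeight x β ∧ ρ x v ≠ 0}.Finite := by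
  have hfin : {mu | wtSpace ρ mu ≠ ⊥}.Finite := by
    have h : ∀ mu : {mu | wtSpace ρ mu ≠ ⊥}, ∃ v ∈ wtSpace ρ mu, v ≠ 0 := fun mu =>
      Submodule.exists_mem_ne_zero_of_ne_bot mu.2
    choose w hw hw0 using h
    exact (linearIndependent_of_wtSpace ρ Subtype.val_injective w hw hw0).finite
  have hv : v ∈ ⨆ mu, wtSpace ρ mu := hρ ▸ Submodule.mem_top
  induction hv using Submodule.iSup_induction' with
  | mem mu v hv =>
    refine (hfin.preimage (f := fun β => β + mu) (add_left_injective mu).injOn).subset ?_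
    rintro β ⟨x, hx, h⟩
    exact Submodule.ne_bot_iff _ |>.2 ⟨_, hx.map_wtSpace hv, h⟩
  | zero => simp
  | add a b _ _ ha hb =>
    refine (ha.union hb).subset ?_
    rintro β ⟨x, hx, h⟩
    by_cases h1 : ρ x a = 0
    · exact Or.inr ⟨x, hx, fun h2 => h (by rw [map_add, h1, h2, add_zero])⟩
    · exact Or.inl ⟨x, hx, h1⟩

theorem finite_setOf_regRep_ne_zero (f : RegFun C) :
    {β : Fin r → ℚ | ∃ x, HasWeight x β ∧ regRep C x f ≠ 0}.Finite := by
  have key : ∀ φ ∈ RegFun C,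
      {β : Fin r → ℚ | ∃ x, HasWeight x β ∧ leftReg C x φ ≠ 0}.Finite := by
    intro φ hφ
    induction hφ using Submodule.span_induction with
    | mem φ hφ =>
      obtain ⟨n, ρ, hρ, v, ξ, h⟩ := hφ
      refine (finite_setOf_apply_ne_zero hρ v).subset ?_
      rintro β ⟨x, hx, h0⟩
      refine ⟨x, hx, fun h1 => h0 (LinearMap.ext fun u => ?_)⟩
      rw [leftReg_apply, h, map_mul, Module.End.mul_apply, h1, map_zero, map_zero,
        LinearMap.zero_apply]
    | zero => simp
    | add a b _ _ ha hb =>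
      refine (ha.union hb).subset ?_
      rintro β ⟨x, hx, h⟩
      by_cases h1 : leftReg C x a = 0
      · exact Or.inr ⟨x, hx, fun h2 => h (by rw [map_add, h1, h2, add_zero])⟩
      · exact Or.inl ⟨x, hx, h1⟩
    | smul c a _ ha =>
      refine ha.subset ?_
      rintro β ⟨x, hx, h⟩
      exact ⟨x, hx, fun h1 => h (by rw [map_smul, h1, smul_zero])⟩
  refine (key f.1 f.2).subset ?_
  rintro β ⟨x, hx, h⟩
  exact ⟨x, hx, fun h1 => h (Subtype.ext h1)⟩

/-! ### The highest weight vector attached to an invariant regular function -/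

section Reconstruct

variable {lam : Fin r → ℚ} {ι : (Fin r → ℕ) → Type*} [∀ β, Fintype (ι β)]
  [∀ β, DecidableEq (ι β)] (B : WeightBases C lam ι)

/-- The `β`-component `∑ i j, (S̄^β)⁻¹ i j • y β i 1̄_λ ⊗ θ(y β j) f` of the highest weight vector of
`L(λ) ⊗ W` whose coefficient at `1̄_λ` is `f`. -/
def WeightBases.component (B : WeightBases C lam ι) {W : Type*} [AddCommMonoid W] [Module 𝕜 W]
    (τ : QEA C →ₐ[𝕜] Module.End 𝕜 W) (f : W) (β : Fin r → ℕ) : Simple C lam ⊗[𝕜] W :=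
  ∑ i, ∑ j, (B.shapMatrix β)⁻¹ i j • ((B.y β i • hwVec C lam) ⊗ₜ τ (QEA.theta C (B.y β j)) f)

variable {W : Type*} [AddCommMonoid W] [Module 𝕜 W] {τ : QEA C →ₐ[𝕜] Module.End 𝕜 W}

theorem contract_antipode_theta_component (f : W) (β : Fin r → ℕ) (y : QEA C) :
    contract (hwCoeff C lam ∘ₗ simpleRep C lam (QEA.antipode C (QEA.theta C y)))
      (B.component τ f β) = ∑ i, ∑ j, ((B.shapMatrix β)⁻¹ i j * shapovalov C lam y (B.y β i)) •
        τ (QEA.theta C (B.y β j)) f := by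
  rw [WeightBases.component, map_sum]
  refine Finset.sum_congr rfl fun i _ => ?_
  rw [map_sum]
  refine Finset.sum_congr rfl fun j _ => ?_
  rw [map_smul, contract_tmul, shapovalov_apply, ← hwCoeff_smul, mul_smul (QEA.omega C y),
    mul_smul ((B.shapMatrix β)⁻¹ i j) (hwCoeff C lam _)]
  rfl

theorem contract_component_of_ne (f : W) {β γ : Fin r → ℕ} (h : γ ≠ β) {y : QEA C}
    (hy : HasWeight y (negWt γ)) :
    contract (hwCoeff C lam ∘ₗ simpleRep C lam (QEA.antipode C (QEA.theta C y)))
      (B.component τ f β) = 0 := by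
  rw [contract_antipode_theta_component]
  refine Finset.sum_eq_zero fun i _ => Finset.sum_eq_zero fun j _ => ?_
  rw [shapovalov_eq_zero_of_ne h hy (B.hasWeight β i), mul_zero, zero_smul]

/-- The matrix `(S̄^β)⁻¹` in `component` cancels the matrix of the form on the `y β i`, and the
assumption on `f` makes `τ (θ y) f` depend on `y` modulo `K_λ` only. -/
theorem contract_component_self {f : W} (hf : ∀ x ∈ KPos C lam, τ x f = 0) {β : Fin r → ℕ}
    {y : QEA C} (hy : y ∈ QEA.UNeg C) (hβ : HasWeight y (negWt β)) :
    contract (hwCoeff C lam ∘ₗ simpleRep C lam (QEA.antipode C (QEA.theta C y)))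
      (B.component τ f β) = τ (QEA.theta C y) f := by
  let _ : AddCommGroup W := Module.addCommMonoidToAddCommGroup 𝕜
  obtain ⟨c, hc⟩ := B.exists_sub_mem_KNeg hy hβ
  have h1 : ∀ i, shapovalov C lam y (B.y β i) = ∑ l, c l * B.shapMatrix β l i := by
    intro i
    have h := (mem_KNeg_iff hc.1).1 hc _ (B.mem_UNeg β i)
    rw [shapovalov_symm, map_sub, LinearMap.sub_apply, sub_eq_zero] at h
    rw [h, map_sum, LinearMap.sum_apply]
    refine Finset.sum_congr rfl fun l _ => ?_
    rw [map_smul, LinearMap.smul_apply, smul_eq_mul]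
    rfl
  have h2 : τ (QEA.theta C y) f = ∑ l, c l • τ (QEA.theta C (B.y β l)) f := by
    have h := hf _ (theta_mem_KPos hc)
    rw [map_sub, map_sub, LinearMap.sub_apply, sub_eq_zero] at h
    rw [h]
    simp only [map_sum, map_smul, LinearMap.sum_apply, LinearMap.smul_apply]
  have h3 : ∀ l j, ∑ i, B.shapMatrix β l i * (B.shapMatrix β)⁻¹ i j = if l = j then 1 else 0 := by
    intro l j
    have := congrFun (congrFun (Matrix.mul_nonsing_inv _
      ((Matrix.isUnit_iff_isUnit_det _).1 (B.isUnit_shapMatrix β))) l) j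
    rwa [Matrix.mul_apply, Matrix.one_apply] at this
  rw [contract_antipode_theta_component, h2, Finset.sum_comm]
  refine Finset.sum_congr rfl fun j _ => ?_
  rw [← Finset.sum_smul]
  congr 1
  calc ∑ i, (B.shapMatrix β)⁻¹ i j * shapovalov C lam y (B.y β i)
      = ∑ l, c l * ∑ i, B.shapMatrix β l i * (B.shapMatrix β)⁻¹ i j := by
        simp only [h1, Finset.mul_sum]
        rw [Finset.sum_comm]
        exact Finset.sum_congr rfl fun l _ => Finset.sum_congr rfl fun i _ => by ring
    _ = c j := by simp [h3]

theorem component_mem_wtSpace {f : W} (hf : f ∈ wtSpace τ 0) (β : Fin r → ℕ) :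
    B.component τ f β ∈ wtSpace (tensorRep (simpleRep C lam) τ) lam := by
  refine sum_mem fun i _ => sum_mem fun j _ => Submodule.smul_mem _ _ fun n => ?_
  have h1 : simpleRep C lam (B.y β i) (hwVec C lam) ∈ _ :=
    (B.hasWeight β i).map_wtSpace (isHighestWeight_hwVec lam).t
  have h2 := (B.hasWeight β j).theta.map_wtSpace hf
  rw [tensorRep_t, TensorProduct.map_tmul, h2 n]
  change (simpleRep C lam (QEA.t C n) (simpleRep C lam (B.y β i) (hwVec C lam))) ⊗ₜ _ = _
  rw [h1 n, TensorProduct.smul_tmul_smul, ← qwt_add_left]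
  congr 2
  abel

/-- If `K̃_λ` kills `f ∈ W[0]` and `s` contains all weights `β ∈ Q₊` of elements of `U` that do not
kill `f`, then the sum of the components of `f` over `s` is a highest weight vector with coefficient `f`
at `1̄_λ`. -/
theorem sum_component {f : W} (h0 : f ∈ wtSpace τ 0) (hf : ∀ x ∈ KPos C lam, τ x f = 0)
    {s : Finset (Fin r → ℕ)} (hs : ∀ β x, HasWeight x (-negWt β) → τ x f ≠ 0 → β ∈ s) :
    IsHighestWeight (tensorRep (simpleRep C lam) τ) lam (∑ β ∈ s, B.component τ f β) ∧
      contract (hwCoeff C lam) (∑ β ∈ s, B.component τ f β) = f := by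
  have key : ∀ y ∈ QEA.UNeg C,
      contract (hwCoeff C lam ∘ₗ simpleRep C lam (QEA.antipode C (QEA.theta C y)))
        (∑ β ∈ s, B.component τ f β) = τ (QEA.theta C y) f := by
    intro y hy
    refine UNeg_induction (p := fun y =>
      contract (hwCoeff C lam ∘ₗ simpleRep C lam (QEA.antipode C (QEA.theta C y)))
        (∑ β ∈ s, B.component τ f β) = τ (QEA.theta C y) f) ?_ ?_ ?_ ?_ hy
    · intro γ y hy hγ
      rw [map_sum]
      by_cases hγs : γ ∈ s
      · rw [Finset.sum_eq_single_of_mem γ hγs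
          (fun β _ h => contract_component_of_ne B f h.symm hγ),
          contract_component_self B hf hy hγ]
      · rw [Finset.sum_eq_zero fun β hβ => contract_component_of_ne B f
          (ne_of_mem_of_not_mem hβ hγs).symm hγ]
        by_contra h
        exact hγs (hs γ _ hγ.theta (Ne.symm h))
    · have e : hwCoeff C lam ∘ₗ simpleRep C lam (QEA.antipode C (QEA.theta C 0)) =
          (0 : 𝕜) • hwCoeff C lam := by
        simp only [map_zero, LinearMap.comp_zero, zero_smul]
      rw [e, contract_smul, zero_smul, map_zero, map_zero, LinearMap.zero_apply]
    · intro a b ha hb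
      rw [map_add, map_add, map_add, LinearMap.comp_add, contract_add, ha, hb, map_add,
        LinearMap.add_apply]
    · intro c a ha
      rw [map_smul, map_smul, map_smul, LinearMap.comp_smul, contract_smul, ha, map_smul,
        LinearMap.smul_apply]
  have hpos : ∀ x ∈ QEA.UPos C,
      contract (hwCoeff C lam ∘ₗ simpleRep C lam (QEA.antipode C x))
        (∑ β ∈ s, B.component τ f β) = τ x f := fun x hx => by
    have := key _ (theta_mem_UNeg hx)
    rwa [theta_theta] at this
  refine ⟨⟨tensorRep_e_eq_zero hpos, sum_mem fun β _ => component_mem_wtSpace B h0 β⟩, ?_⟩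
  have h1 := hpos 1 (one_mem _)
  rwa [antipode_one, map_one, map_one, Module.End.one_eq_id, LinearMap.comp_id] at h1

end Reconstruct

/-! ### The map `Θ` and the star product -/

section Theta

variable {lam : Fin r → ℚ}

local notation "𝓗" => HomU (simpleRep C lam) (tensorRep (simpleRep C lam) (regRep C))

theorem Theta_apply (φ : 𝓗) :
    Theta C lam φ = contract (hwCoeff C lam) (φ.1 (hwVec C lam)) := rfl

theorem isHighestWeight_hom {W : Type*} [AddCommMonoid W] [Module 𝕜 W]
    {τ : QEA C →ₐ[𝕜] Module.End 𝕜 W} {φ : Simple C lam →ₗ[𝕜] W}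
    (hφ : φ ∈ HomU (simpleRep C lam) τ) :
    IsHighestWeight τ lam (φ (hwVec C lam)) where
  e i := by rw [← hφ, (isHighestWeight_hwVec lam).e, map_zero]
  t n := by rw [← hφ, (isHighestWeight_hwVec lam).t, map_smul]

theorem hom_ext {W : Type*} [AddCommMonoid W] [Module 𝕜 W]
    {τ : QEA C →ₐ[𝕜] Module.End 𝕜 W} {φ ψ : HomU (simpleRep C lam) τ}
    (h : φ.1 (hwVec C lam) = ψ.1 (hwVec C lam)) : φ = ψ := by
  refine Subtype.ext (LinearMap.ext fun m => ?_)
  obtain ⟨x, rfl⟩ := exists_smul_hwVec lam m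
  exact (φ.2 x _).trans ((congrArg _ h).trans (ψ.2 x _).symm)

theorem contract_hom_neg (φ : 𝓗) {y : QEA C} (hy : y ∈ QEA.UNeg C) :
    contract (hwCoeff C lam) (φ.1 (y • hwVec C lam)) = regRep C y (Theta C lam φ) := by
  exact (congrArg (contract (hwCoeff C lam)) (φ.2 y _)).trans
    (contract_hwCoeff_neg (τ := regRep C) hy _)

theorem Theta_mem_invSub (φ : 𝓗) : Theta C lam φ ∈ invSub C lam := by
  have hw := isHighestWeight_hom φ.2
  refine ⟨fun n => ?_, fun y hy => ?_, fun x hx => ?_⟩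
  · have h1 := congrArg (contract (hwCoeff C lam)) (hw.t n)
    rw [contract_tensorRep_t, hwCoeff_comp_t, contract_smul, map_smul, map_smul] at h1
    rw [qwt_zero_left, one_smul]
    exact smul_right_injective _ (qpow_ne_zero _) h1
  · rw [← contract_hom_neg φ hy.1, (smul_hwVec_eq_zero_iff hy.1).2 hy, map_zero, map_zero]
  · rw [Theta_apply, ← contract_antipode hw.e hx.1]
    have e : hwCoeff C lam ∘ₗ simpleRep C lam (QEA.antipode C x) = (0 : 𝕜) • hwCoeff C lam := by
      refine LinearMap.ext fun m => ?_
      obtain ⟨y, hy, rfl⟩ := exists_neg_smul_hwVec lam m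
      rw [zero_smul, LinearMap.zero_apply, ← hx.2 y hy, piForm_apply, ← hwCoeff_smul, mul_smul]
      rfl
    rw [e, contract_smul, zero_smul]

theorem Theta_injective : Function.Injective (Theta C lam) := by
  intro φ ψ h
  exact hom_ext ((isHighestWeight_hom φ.2).eq_of_contract_hwCoeff (isHighestWeight_hom ψ.2) h)

variable {ι : (Fin r → ℕ) → Type*} [∀ β, Fintype (ι β)] [∀ β, DecidableEq (ι β)]

theorem exists_Theta_eq (B : WeightBases C lam ι) {f : RegFun C} (hf : f ∈ invSub C lam)
    {s : Finset (Fin r → ℕ)} (hs : ∀ β x, HasWeight x (-negWt β) → regRep C x f ≠ 0 → β ∈ s) :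
    ∃ φ : 𝓗, Theta C lam φ = f ∧
      φ.1 (hwVec C lam) = ∑ β ∈ s, B.component (regRep C) f β := by
  obtain ⟨hw, hc⟩ := sum_component B hf.1 hf.2.2 hs
  obtain ⟨φ, hφ, e⟩ := exists_hom_of_isHighestWeight hw (by rw [hc]; exact hf.2.1)
  exact ⟨⟨φ, hφ⟩, by rw [Theta_apply, e, hc], e⟩

/-- The elements of `Q₊` that are weights of elements of `U` not killing `f`. -/
theorem finite_posWeights (f : RegFun C) :
    {β : Fin r → ℕ | ∃ x, HasWeight x (-negWt β) ∧ regRep C x f ≠ 0}.Finite :=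
  (finite_setOf_regRep_ne_zero f).preimage (f := fun β => -negWt β)
    (neg_injective.comp negWt_injective).injOn

theorem star_Theta (φ ψ : 𝓗) :
    star C lam (Theta C lam φ) (Theta C lam ψ) = Theta C lam (conv φ ψ) := by
  rw [star, Function.leftInverse_invFun Theta_injective, Function.leftInverse_invFun Theta_injective]

theorem Theta_conv (φ ψ : 𝓗) : Theta C lam (conv φ ψ) =
    regMul C ((contract (hwCoeff C lam) ∘ₗ φ.1).rTensor (RegFun C) (ψ.1 (hwVec C lam))) := by
  rw [Theta_apply]
  change contract (hwCoeff C lam) ((regMul C).lTensor _ (TensorProduct.assoc 𝕜 _ _ _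
    (φ.1.rTensor _ (ψ.1 (hwVec C lam))))) = _
  induction ψ.1 (hwVec C lam) with
  | zero => simp only [map_zero]
  | add a b ha hb => simp only [map_add, ha, hb]
  | tmul m g =>
    rw [LinearMap.rTensor_tmul, LinearMap.rTensor_tmul, LinearMap.comp_apply]
    induction φ.1 m with
    | zero => simp only [map_zero, TensorProduct.zero_tmul]
    | add a b ha hb => simp only [map_add, TensorProduct.add_tmul, ha, hb]
    | tmul n g' =>
      rw [TensorProduct.assoc_tmul, LinearMap.lTensor_tmul, contract_tmul, contract_tmul,
        ← TensorProduct.smul_tmul', map_smul]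

theorem rTensor_component (B : WeightBases C lam ι) (φ : 𝓗) (f : RegFun C) (β : Fin r → ℕ) :
    (contract (hwCoeff C lam) ∘ₗ φ.1).rTensor (RegFun C) (B.component (regRep C) f β) =
      tensorAct (regRep C) (regRep C) (B.Jred β) (Theta C lam φ ⊗ₜ[𝕜] f) := by
  rw [WeightBases.component, WeightBases.Jred]
  simp only [map_sum, map_smul, LinearMap.sum_apply, LinearMap.smul_apply, LinearMap.rTensor_tmul,
    tensorAct_tmul, TensorProduct.map_tmul, LinearMap.comp_apply,
    contract_hom_neg φ (B.mem_UNeg β _)]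

theorem mem_of_tensorAct_Jred_ne_zero (B : WeightBases C lam ι) {f₁ f₂ : RegFun C}
    {β : Fin r → ℕ}
    (h : tensorAct (regRep C) (regRep C) (B.Jred β) (f₁ ⊗ₜ[𝕜] f₂) ≠ 0) :
    ∃ x, HasWeight x (-negWt β) ∧ regRep C x f₂ ≠ 0 := by
  by_contra! h0
  refine h ?_
  rw [WeightBases.Jred]
  simp only [map_sum, map_smul, LinearMap.sum_apply, LinearMap.smul_apply, tensorAct_tmul,
    TensorProduct.map_tmul, h0 _ (B.hasWeight β _).theta, TensorProduct.tmul_zero, smul_zero,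
    Finset.sum_const_zero]

end Theta

end StarProduct

end

theorem theorem14 {r : ℕ} (C : StarProduct.CartanDatum r) (lam : Fin r → ℚ)
    {ι : (Fin r → ℕ) → Type*} [∀ β, Fintype (ι β)] [∀ β, DecidableEq (ι β)]
    (B : StarProduct.WeightBases C lam ι) :
    Set.BijOn (StarProduct.Theta C lam) Set.univ (StarProduct.invSub C lam) ∧
    (∀ β, IsUnit (B.shapMatrix β)) ∧
    ∀ f₁ ∈ StarProduct.invSub C lam, ∀ f₂ ∈ StarProduct.invSub C lam,
      {β | StarProduct.tensorAct (StarProduct.regRep C) (StarProduct.regRep C) (B.Jred β)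
        (f₁ ⊗ₜ[StarProduct.GroundField] f₂) ≠ 0}.Finite ∧
      StarProduct.star C lam f₁ f₂ =
        StarProduct.regMul C (∑ᶠ β : Fin r → ℕ,
          StarProduct.tensorAct (StarProduct.regRep C) (StarProduct.regRep C) (B.Jred β)
            (f₁ ⊗ₜ[StarProduct.GroundField] f₂)) := by
  refine ⟨⟨fun φ _ => StarProduct.Theta_mem_invSub φ, StarProduct.Theta_injective.injOn,
    fun f hf => ?_⟩, B.isUnit_shapMatrix, fun f₁ hf₁ f₂ hf₂ => ?_⟩
  · obtain ⟨φ, hφ, -⟩ := StarProduct.exists_Theta_eq B hf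
      (s := (StarProduct.finite_posWeights f).toFinset)
      fun β x hx h => (Set.Finite.mem_toFinset _).2 ⟨x, hx, h⟩
    exact ⟨φ, trivial, hφ⟩
  · have hfin := StarProduct.finite_posWeights f₂
    refine ⟨hfin.subset fun β hβ => StarProduct.mem_of_tensorAct_Jred_ne_zero B hβ, ?_⟩
    obtain ⟨φ, hφ, -⟩ := StarProduct.exists_Theta_eq B hf₁
      (s := (StarProduct.finite_posWeights f₁).toFinset)
      fun β x hx h => (Set.Finite.mem_toFinset _).2 ⟨x, hx, h⟩
    obtain ⟨ψ, hψ, e⟩ := StarProduct.exists_Theta_eq B hf₂ (s := hfin.toFinset)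
      fun β x hx h => (Set.Finite.mem_toFinset _).2 ⟨x, hx, h⟩
    rw [finsum_eq_sum_of_support_subset _ (s := hfin.toFinset) fun β hβ =>
        (Set.Finite.mem_toFinset _).2 (StarProduct.mem_of_tensorAct_Jred_ne_zero B hβ),
      show StarProduct.star C lam f₁ f₂ = _ by
        rw [← hφ, ← hψ, StarProduct.star_Theta, StarProduct.Theta_conv], e, map_sum]
    refine congrArg _ (Finset.sum_congr rfl fun β _ => ?_)
    rw [StarProduct.rTensor_component B φ f₂ β, hφ]
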